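/- **Conventions.** Graphs are finite and undirected and may have parallel edges. For a finite abelian group $\Gamma$, a $\Gamma$-labelled graph $(G,\gamma)$ is a graph $G$ with a map $\gamma:E(G)\to\Gamma$; the weight of a path or cycle is the sum of the labels of its edges, and it is *zero* if its weight is $0$. For $A\subseteq V(G)$, an *$A$-path* is a nontrivial path whose intersection with $A$ consists exactly of its endpoints. $(G,\gamma)$ is *$\Gamma$-bipartite* if all its cycles are zero. A *3-block* of a graph $H$ is a maximal set $B$ of at least three vertices such that no set of at most two vertices disconnects two vertices of $B$ in $H$. The labelled 3-block $(B,\gamma)$ of $(H,\gamma)$ has vertex set $B$ and, for $u,v\in B$ and $\alpha\in\Gamma$, an edge $uv$ with label $\alpha$ whenever $(H,\gamma)$ contains a $B$-path of weight $\alpha$ with endpoints $u,v$. The *elementary $r$-wall* ($r\ge 2$) has the vertices $(i,j)$, $1\le i\le r+1$, $1\le j\le 2r+2$; its edges are all $(i,j)(i,j+1)$, and those $(i,j)(i+1,j)$ with $i\equiv j \pmod 2$; finally the two vertices of degree $1$ are deleted. An *$r$-wall* is a subdivision of it; its *horizontal paths* are the $r+1$ paths corresponding to the rows. A *separation* of $H$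 is a pair $(C,D)$ of subgraphs with $C\cup D=H$; its *order* is $|V(C)\cap V(D)|$. An $r$-wall $W$ in $H$ induces the tangle $\mathcal T_W$ consisting of all separations $(C,D)$ of $H$ of order at most $r$ such that $D$ contains a horizontal path of $W$. The *$\mathcal T_W$-large 3-block* of $H$ is the 3-block that is not contained in $V(C)$ for any $(C,D)\in\mathcal T_W$. Let $BR(k)$ be the least $b$ such that every red-blue colouring of the edges of $K_{b,b}$ contains a monochromatic $K_{k,k}$, and let $t(k)=16\,BR(k)$ and $T(k)=3(24\,t(k))^2$. **Lemma.** Let $\Gamma$ be a finite abelian group and let $k$ be a positive integer. Then there exists an integer $\beta=\beta(k,|\Gamma|)\ge 2$, depending only on $k$ and $|\Gamma|$, such that the following holds. Let $(G,\gamma)$ be a $\Gamma$-labelled graph with $A\subseteq V(G)$ such that (I) there is no $Y\subseteq V(G)$ with $|Y|<12\,T(k)\,|\Gamma|$ intersecting every zero $A$-path; (II) $(G-A,\gamma)$ contains a $\beta$-wall $W'$, inducing a tangle $\mathcal T=\mathcal T_{W'}$ of $G-A$, such that the $\mathcal T$-large 3-block $(B,\gamma)$ of $(G-A,\gamma)$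 is $\Gamma$-bipartite; and (III) for every $(C,D)\in\mathcal T$, $(G[A\cup V(C)],\gamma)$ contains no zero $A$-path and $(G[A\cup (V(D)\setminus V(C))],\gamma)$ contains a zero $A$-path. Then $(G,\gamma)$ contains $k$ pairwise (vertex-)disjoint zero $A$-paths. -/

import Mathlib

open scoped Graph

namespace Graph

variable {α ε Γ : Type*}

/-! ### Walks, paths and cycles in a (multi)graph -/

/-- Walks in a multigraph, recorded with their edges. -/
inductive Walk (G : Graph α ε) : α → α → Type _
  | nil {u : α} (hu : u ∈ V(G)) : Walk G u u
  | cons {u v w : α} (e : ε) (h : G.IsLink e u v) (p : Walk G v w) : Walk G u w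

namespace Walk

variable {G : Graph α ε}

/-- The list of vertices of a walk, in order. -/
def support : ∀ {u v : α}, G.Walk u v → List α
  | u, _, nil _ => [u]
  | u, _, cons _ _ p => u :: p.support

/-- The list of edges of a walk, in order. -/
def edges : ∀ {u v : α}, G.Walk u v → List ε
  | _, _, nil _ => []
  | _, _, cons e _ p => e :: p.edges

/-- The weight of a walk: the sum of the labels of its edges. -/
def weight [AddCommGroup Γ] (γ : ε → Γ) {u v : α} (p : G.Walk u v) : Γ :=
  (p.edges.map γ).sum

/-- A path is a walk without repeated vertices. -/
def IsPath {u v : α} (p : G.Walk u v) : Prop :=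
  p.support.Nodup

/-- A cycle is a nontrivial closed walk without repeated edges, and without repeated vertices apart
from its two equal ends. Two distinct parallel edges form a cycle. -/
def IsCycle {u : α} (p : G.Walk u u) : Prop :=
  p.edges ≠ [] ∧ p.edges.Nodup ∧ p.support.tail.Nodup

/-- An `A`-path is a nontrivial path whose intersection with `A` consists exactly of its ends. -/
def IsSetPath {u v : α} (p : G.Walk u v) (A : Set α) : Prop :=
  p.IsPath ∧ p.edges ≠ [] ∧ ∀ x ∈ p.support, x ∈ A ↔ x = u ∨ x = v

/-- A zero `A`-path is an `A`-path of weight `0`. -/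
def IsZeroSetPath [AddCommGroup Γ] (γ : ε → Γ) {u v : α} (p : G.Walk u v) (A : Set α) : Prop :=
  p.IsSetPath A ∧ p.weight γ = 0

lemma start_mem_support {u v : α} (p : G.Walk u v) : u ∈ p.support := by
  cases p <;> simp [support]

lemma end_mem_support {u v : α} (p : G.Walk u v) : v ∈ p.support := by
  induction p with
  | nil _ => simp [support]
  | cons _ _ _ ih => simp [support, ih]

end Walk

/-- `(G, γ)` contains a zero `A`-path. -/
def HasZeroSetPath [AddCommGroup Γ] (G : Graph α ε) (γ : ε → Γ) (A : Set α) : Prop :=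
  ∃ (u v : α) (p : G.Walk u v), p.IsZeroSetPath γ A

/-- The vertex set `Y` intersects every zero `A`-path of `(G, γ)`. -/
def HitsZeroSetPaths [AddCommGroup Γ] (G : Graph α ε) (γ : ε → Γ) (A Y : Set α) : Prop :=
  ∀ (u v : α) (p : G.Walk u v), p.IsZeroSetPath γ A → ∃ y ∈ Y, y ∈ p.support

/-- `(G, γ)` contains `k` pairwise vertex-disjoint zero `A`-paths. -/
def HasDisjointZeroSetPaths [AddCommGroup Γ] (G : Graph α ε) (γ : ε → Γ) (A : Set α) (k : ℕ) :
    Prop :=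
  ∃ (u v : Fin k → α) (P : ∀ i, G.Walk (u i) (v i)),
    (∀ i, (P i).IsZeroSetPath γ A) ∧
    ∀ i j, i ≠ j → List.Disjoint (P i).support (P j).support

/-- A labelled graph is `Γ`-bipartite if every cycle has weight `0`. -/
def IsGroupBipartite [AddCommGroup Γ] (G : Graph α ε) (γ : ε → Γ) : Prop :=
  ∀ (u : α) (p : G.Walk u u), p.IsCycle → p.weight γ = 0

/-! ### Separations and 3-blocks -/

/-- A separation of `G` is an ordered pair of subgraphs whose union is `G`. -/
structure IsSeparation (G C D : Graph α ε) : Prop where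
  left_le : C ≤ G
  right_le : D ≤ G
  vertexSet_union : V(C) ∪ V(D) = V(G)
  edgeSet_union : E(C) ∪ E(D) = E(G)

/-- No set of at most two vertices of `G` disconnects two vertices of `B`. -/
def IsTwoInseparable (G : Graph α ε) (B : Set α) : Prop :=
  ∀ X ⊆ V(G), X.encard ≤ 2 → ∀ u ∈ B \ X, ∀ v ∈ B \ X, Nonempty ((G.deleteVerts X).Walk u v)

/-- A 3-block of `G` is a maximal set of at least three vertices no two of which are disconnected
by a set of at most two vertices. -/
def IsThreeBlock (G : Graph α ε) (B : Set α) : Prop :=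
  Maximal (fun S : Set α => S ⊆ V(G) ∧ 3 ≤ S.encard ∧ G.IsTwoInseparable S) B

/-- The labelled (multi)graph on the vertex set `B` which has, for all `u, v ∈ B` and `a : Γ`, one
edge between `u` and `v` with label `a` exactly if `(G, γ)` contains a `B`-path of weight `a` with
ends `u` and `v`. That edge is the pair `(s(u, v), a)`, so its label is its second component. -/
def blockGraph [AddCommGroup Γ] (G : Graph α ε) (γ : ε → Γ) (B : Set α) :
    Graph α (Sym2 α × Γ) where
  vertexSet := B
  IsLink e x y := e.1 = s(x, y) ∧
    ∃ (u v : α) (p : G.Walk u v), s(u, v) = s(x, y) ∧ p.IsSetPath B ∧ p.weight γ = e.2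
  isLink_symm := by
    intro e _
    refine ⟨fun x y h => ?_⟩
    rw [Sym2.eq_swap (a := y)]
    exact h
  eq_or_eq_of_isLink_of_isLink := by
    rintro e x y v w ⟨h, -⟩ ⟨h', -⟩
    rw [h, Sym2.eq_iff] at h'
    tauto
  left_mem_of_isLink := by
    rintro e x y ⟨-, u, v, p, huv, ⟨-, -, hp⟩, -⟩
    have hu := (hp u p.start_mem_support).2 (Or.inl rfl)
    have hv := (hp v p.end_mem_support).2 (Or.inr rfl)
    rw [Sym2.eq_iff] at huv
    rcases huv with ⟨rfl, -⟩ | ⟨-, rfl⟩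
    · exact hu
    · exact hv

/-! ### Walls -/

/-- The vertices of the elementary `r × s`-wall: those of the `(r+1) × (2s+2)`-grid
(`(i, j)` is in row `i` and column `j`, counted from `1`), except the two that have degree `1` once
the edges between consecutive rows are thinned out as in `WallEdge`. -/
def wallVertices (r s : ℕ) : Set (ℕ × ℕ) :=
  {x | (1 ≤ x.1 ∧ x.1 ≤ r + 1) ∧ (1 ≤ x.2 ∧ x.2 ≤ 2 * s + 2) ∧
    x ≠ (1, 2 * s + 2) ∧ x ≠ (r + 1, if Odd r then 2 * s + 2 else 1)}

/-- The edges of the elementary `r × s`-wall, each written once, from its left end to its right end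
or from its upper end to its lower end: all horizontal edges of the grid, and the edges between
rows `i` and `i + 1` in the columns `j` of the same parity as `i`. -/
def WallEdge (r s : ℕ) (x y : ℕ × ℕ) : Prop :=
  x ∈ wallVertices r s ∧ y ∈ wallVertices r s ∧
    ((y.1 = x.1 ∧ y.2 = x.2 + 1) ∨ (y.1 = x.1 + 1 ∧ y.2 = x.2 ∧ x.1 % 2 = x.2 % 2))

/-- An `r × s`-wall in `G`: a subgraph of `G` that is a subdivision of the elementary
`r × s`-wall. It is given by the branch vertices and by the paths of `G` that replace the edges;
these paths may meet only in common ends. (The values of `branch` outside `wallVertices r s` are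
irrelevant.) -/
structure Wall (G : Graph α ε) (r s : ℕ) where
  branch : ℕ × ℕ → α
  link : ∀ {x y : ℕ × ℕ}, WallEdge r s x y → G.Walk (branch x) (branch y)
  branch_injOn : Set.InjOn branch (wallVertices r s)
  link_isPath : ∀ {x y : ℕ × ℕ} (h : WallEdge r s x y), (link h).IsPath
  /-- A replacement path contains no branch vertices except its ends. -/
  branch_mem_link : ∀ {x y : ℕ × ℕ} (h : WallEdge r s x y), ∀ b ∈ wallVertices r s,
    branch b ∈ (link h).support → b = x ∨ b = y
  /-- Different replacement paths meet only in branch vertices. -/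
  link_inter : ∀ {x y x' y' : ℕ × ℕ} (h : WallEdge r s x y) (h' : WallEdge r s x' y'),
    (x, y) ≠ (x', y') → ∀ z, z ∈ (link h).support → z ∈ (link h').support →
      ∃ b ∈ wallVertices r s, z = branch b

namespace Wall

variable {G : Graph α ε} {r s : ℕ}

/-- The subgraph `D` of `G` contains the `i`-th horizontal path of the wall. -/
def HorizontalPathIn (W : G.Wall r s) (i : ℕ) (D : Graph α ε) : Prop :=
  ∀ (j : ℕ) (h : WallEdge r s (i, j) (i, j + 1)),
    (∀ x ∈ (W.link h).support, x ∈ V(D)) ∧ ∀ e ∈ (W.link h).edges, e ∈ E(D)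

/-- The tangle induced by an `r`-wall `W` in `G`: all separations `(C, D)` of `G` of order at most
`r` for which `D` contains a horizontal path of `W`. -/
def tangle (W : G.Wall r r) : Set (Graph α ε × Graph α ε) :=
  {S | G.IsSeparation S.1 S.2 ∧ (V(S.1) ∩ V(S.2)).encard ≤ r ∧
    ∃ i, 1 ≤ i ∧ i ≤ r + 1 ∧ W.HorizontalPathIn i S.2}

end Wall

/-- `B` is the `𝒯`-large 3-block of `G`: the 3-block which is not contained in any `𝒯`-small side
(for a tangle `𝒯` of order at least `3` there is exactly one). -/
def IsLargeThreeBlock (G : Graph α ε) (𝒯 : Set (Graph α ε × Graph α ε)) (B : Set α) : Prop :=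
  G.IsThreeBlock B ∧ ∀ C D, (C, D) ∈ 𝒯 → ¬ B ⊆ V(C)

end Graph

/-! ### Bipartite Ramsey numbers -/

/-- Every red-blue colouring of the edges of `K_{b,b}` contains a monochromatic `K_{k,k}`. -/
def BipartiteRamseyProp (k b : ℕ) : Prop :=
  ∀ c : Fin b → Fin b → Bool, ∃ (col : Bool) (S T : Finset (Fin b)),
    S.card = k ∧ T.card = k ∧ ∀ x ∈ S, ∀ y ∈ T, c x y = col

/-- The set of which `bipartiteRamsey k` is the minimum is not empty. -/
lemma exists_bipartiteRamseyProp (k : ℕ) : ∃ b, BipartiteRamseyProp k b := by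
  classical
  refine ⟨2 * k + 2 ^ (2 * k) * k, fun c => ?_⟩
  let f : Fin (2 * k + 2 ^ (2 * k) * k) → (Fin (2 * k) → Bool) :=
    fun y i => c (Fin.castAdd _ i) y
  obtain ⟨g, hg⟩ := Fintype.exists_le_card_fiber_of_mul_le_card f (n := k) (by simp)
  obtain ⟨col, hcol⟩ := Fintype.exists_le_card_fiber_of_mul_le_card g (n := k) (by simp)
  obtain ⟨T, hT, hTk⟩ := Finset.exists_subset_card_eq hg
  obtain ⟨S, hS, hSk⟩ := Finset.exists_subset_card_eq hcol
  refine ⟨col, S.map (Fin.castAddEmb _), T, by simpa using hSk, hTk, ?_⟩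
  intro x hx y hy
  obtain ⟨i, hi, rfl⟩ := Finset.mem_map.1 hx
  have h1 : f y = g := by simpa using hT hy
  have h2 : g i = col := by simpa using hS hi
  rw [← h2, ← h1]
  rfl

/-- The bipartite Ramsey number: the least `b` such that every red-blue colouring of the edges of
`K_{b,b}` contains a monochromatic `K_{k,k}`. -/
noncomputable def bipartiteRamsey (k : ℕ) : ℕ :=
  sInf {b | BipartiteRamseyProp k b}

/-- `T(k) = 3 (24 t)²` with `t = 16 BR(k)`. -/
noncomputable def hittingParameter (k : ℕ) : ℕ :=
  3 * (24 * (16 * bipartiteRamsey k)) ^ 2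

/-! The group labels can be eliminated. As the labelled 3-block is bipartite, its labels come from a
potential: there is φ with 2φ = 0 such that every `B`-path of `G - A` from u to v has weight φ u + φ
v (`IsThreeBlock.exists_potential`). Hence the weight of a path of `G - A` between vertices of `B`
depends only on its ends. Call a path from `A` to its first vertex in `B` a start, and let its type
be its weight plus φ of its end b. Every zero `A`-path meets `B`, and its two end segments are
starts of opposite types. Conversely, two compatible starts of opposite types, joined by any path of
`G - A` that avoids their inner vertices, form a zero `A`-path. What remains is to link k starts of
some type t disjointly to k starts of type -t.

The linking takes place in the torso of `B`. Choosing a vertex of `B` in each row of the wall gives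
a set U that few torso vertices cannot split evenly (`Wall.Transversal.spread`). A start does little
harm to the torso: its inner vertices outside `A` are attached to at most two vertices of `B`, one
of which is b, so it destroys at most one torso edge, from b to some f (`Start.blocks_iff`).

The core is a duality of Menger type, `SimpleGraph.exists_packable_or_hitting`. For each type,
either 95k starts are packable, which means that their ends cannot be separated from most of U by
fewer vertices even after the pairs b f are deleted, or at most 475k vertices cut all starts off
from U. Since the deleted edges depend on the chosen starts, Menger's theorem does not apply
directly; tight sets are uncrossed by submodularity of the boundary instead.

If t and -t are both packable, the starts are thinned out until they are compatible, and Menger's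
theorem links k of them to k others (`hasDisjointZeroSetPaths_of_packable`). Otherwise the union of
the cutting sets over all types has at most 475k|Γ| vertices and meets every zero `A`-path: by
`Wall.not_boundary_subset_of_initialOf`, a zero `A`-path avoiding it would have two starts that are
not cut off, so both of its types would be packable. Such a small set contradicts (I), because 475k
< 12 T(k). -/

namespace SimpleGraph

/-! ### Menger's theorem for vertex sets. -/

variable {V : Type*}

/-- A walk from `A` to `B` contains a path from `A` to `B` that meets `A` and `B` only in its
ends. -/
lemma exists_minimal_path_between {G : SimpleGraph V} {A B : Set V} {a b : V} (p : G.Walk a b)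
    (ha : a ∈ A) (hb : b ∈ B) :
    ∃ (a' b' : V) (q : G.Walk a' b'), a' ∈ A ∧ b' ∈ B ∧ q.IsPath ∧ q.support ⊆ p.support ∧
      q.edges ⊆ p.edges ∧
      (∀ v ∈ q.support, v ∈ A → v = a') ∧ (∀ v ∈ q.support, v ∈ B → v = b') := by
  classical
  induction hn : p.length using Nat.strong_induction_on generalizing a b p with
  | _ n ih =>
  subst hn
  by_cases h1 : ∀ v ∈ p.support, v ∈ A → v = a
  · by_cases h2 : ∀ v ∈ p.support, v ∈ B → v = b
    · exact ⟨a, b, p.bypass, ha, hb, p.bypass_isPath, p.support_bypass_subset_support,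
        p.edges_bypass_subset_edges,
        fun v hv => h1 v (p.support_bypass_subset_support hv),
        fun v hv => h2 v (p.support_bypass_subset_support hv)⟩
    · push Not at h2
      obtain ⟨v, hv, hvB, hvb⟩ := h2
      obtain ⟨a', b', q, h⟩ := ih _ (p.length_takeUntil_lt_length hv hvb) (p.takeUntil v hv) ha hvB rfl
      exact ⟨a', b', q, h.1, h.2.1, h.2.2.1,
        fun x hx => p.support_takeUntil_subset_support hv (h.2.2.2.1 hx),
        fun x hx => p.edges_takeUntil_subset_edges hv (h.2.2.2.2.1 hx), h.2.2.2.2.2⟩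
  · push Not at h1
    obtain ⟨v, hv, hvA, hva⟩ := h1
    have hlt : (p.dropUntil v hv).length < p.length := by
      have h3 := congrArg Walk.length (p.take_spec hv)
      rw [Walk.length_append] at h3
      have h4 : (p.takeUntil v hv).length ≠ 0 := fun h0 => hva (Walk.eq_of_length_eq_zero h0).symm
      omega
    obtain ⟨a', b', q, h⟩ := ih _ hlt (p.dropUntil v hv) hvA hb rfl
    exact ⟨a', b', q, h.1, h.2.1, h.2.2.1,
      fun x hx => p.support_dropUntil_subset_support hv (h.2.2.2.1 hx),
      fun x hx => p.edges_dropUntil_subset_edges hv (h.2.2.2.2.1 hx), h.2.2.2.2.2⟩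

/-- `Z` meets every walk of `G` from `A` to `B`. -/
def Separates (G : SimpleGraph V) (A B Z : Finset V) : Prop :=
  ∀ a ∈ A, ∀ b ∈ B, ∀ p : G.Walk a b, ∃ z ∈ Z, z ∈ p.support

/-- `G` contains `k` pairwise disjoint paths from `A` to `B`, each meeting `A` and `B` only in its
ends. -/
def Linked (G : SimpleGraph V) (A B : Finset V) (k : ℕ) : Prop :=
  ∃ (f g : Fin k → V) (P : ∀ i, G.Walk (f i) (g i)),
    (∀ i, f i ∈ A ∧ g i ∈ B ∧ (P i).IsPath ∧ (∀ v ∈ (P i).support, v ∈ A → v = f i) ∧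
      ∀ v ∈ (P i).support, v ∈ B → v = g i) ∧
    ∀ i j, i ≠ j → List.Disjoint (P i).support (P j).support

lemma Linked.mono {G G' : SimpleGraph V} (h : G' ≤ G) {A B : Finset V} {k : ℕ}
    (hl : G'.Linked A B k) : G.Linked A B k := by
  obtain ⟨f, g, P, h1, h2⟩ := hl
  refine ⟨f, g, fun i => (P i).mapLe h, fun i => ?_, fun i j hij => ?_⟩
  · simpa using h1 i
  · simpa using h2 i j hij

lemma Separates.symm {G : SimpleGraph V} {A B Z : Finset V} (h : G.Separates A B Z) :
    G.Separates B A Z := by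
  intro b hb a ha p
  obtain ⟨z, hz, hzp⟩ := h a ha b hb p.reverse
  exact ⟨z, hz, by simpa using hzp⟩

lemma exists_walk_deleteEdge {G : SimpleGraph V} {x y u v : V} (p : G.Walk u v)
    (he : s(x, y) ∉ p.edges) :
    ∃ q : (G.deleteEdges {s(x, y)}).Walk u v, q.support = p.support :=
  ⟨p.toDeleteEdge _ he, by simp [Walk.toDeleteEdge, Walk.toDeleteEdges]⟩

/-- A path uses the edge only once, so the parts before and after it survive its deletion; the two
cases are the directions of traversal. -/
lemma exists_split_at_edge {G : SimpleGraph V} {x y u v : V} (p : G.Walk u v) (hp : p.IsPath)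
    (he : s(x, y) ∈ p.edges) :
    (∃ (q : (G.deleteEdges {s(x, y)}).Walk u x) (r : (G.deleteEdges {s(x, y)}).Walk y v),
      q.support ⊆ p.support ∧ r.support ⊆ p.support) ∨
    ∃ (q : (G.deleteEdges {s(x, y)}).Walk u y) (r : (G.deleteEdges {s(x, y)}).Walk x v),
      q.support ⊆ p.support ∧ r.support ⊆ p.support := by
  induction p with
  | nil => simp at he
  | @cons u w v h p ih =>
    rw [Walk.cons_isPath_iff] at hp
    by_cases h0 : s(x, y) = s(u, w)
    · have hn : s(x, y) ∉ p.edges := fun h' => hp.2 (by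
        rw [h0] at h'; exact p.fst_mem_support_of_mem_edges h')
      obtain ⟨r, hr⟩ := exists_walk_deleteEdge p hn
      rw [Sym2.eq_iff] at h0
      rcases h0 with ⟨rfl, rfl⟩ | ⟨rfl, rfl⟩
      · exact Or.inl ⟨Walk.nil, r, by simp, by simp [hr]⟩
      · exact Or.inr ⟨Walk.nil, r, by simp, by simp [hr]⟩
    · have he' : s(x, y) ∈ p.edges := by
        simp only [Walk.edges_cons, List.mem_cons] at he
        exact he.resolve_left h0
      have hadj : (G.deleteEdges {s(x, y)}).Adj u w := by
        rw [deleteEdges_adj]; exact ⟨h, fun h' => h0 (by simpa using h'.symm)⟩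
      rcases ih hp.1 he' with ⟨q, r, hq, hr⟩ | ⟨q, r, hq, hr⟩
      · refine Or.inl ⟨q.cons hadj, r, ?_, fun z hz => by simp [hr hz]⟩
        intro z hz
        simp only [Walk.support_cons, List.mem_cons] at hz ⊢
        exact hz.imp_right (fun h => hq h)
      · refine Or.inr ⟨q.cons hadj, r, ?_, fun z hz => by simp [hr hz]⟩
        intro z hz
        simp only [Walk.support_cons, List.mem_cons] at hz ⊢
        exact hz.imp_right (fun h => hq h)

/-- Shortening a walk to a minimal path does not enlarge its support, so disjointness is preserved.
-/
lemma linked_of_walks {G : SimpleGraph V} {A B : Finset V} {k : ℕ} (f g : Fin k → V)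
    (P : ∀ i, G.Walk (f i) (g i)) (hf : ∀ i, f i ∈ A) (hg : ∀ i, g i ∈ B)
    (hP : ∀ i j, i ≠ j → List.Disjoint (P i).support (P j).support) : G.Linked A B k := by
  have h := fun i => exists_minimal_path_between (P i) (A := ↑A) (B := ↑B) (hf i) (hg i)
  choose f' g' Q h1 h2 h3 h4 h5 h6 h7 using h
  exact ⟨f', g', Q, fun i => ⟨h1 i, h2 i, h3 i, h6 i, h7 i⟩,
    fun i j hij v hv hv' => hP i j hij (h4 i hv) (h4 j hv')⟩

/-- The two systems are joined at the vertices of `S` and along the edge xy. Since `S` separates `A`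
from `B` in `G'`, paths of the two systems cannot meet anywhere else. -/
lemma Linked.glue [DecidableEq V] {G G' : SimpleGraph V} (hG : G' ≤ G) {A B S : Finset V} {k : ℕ}
    {x y : V} (hxy : G.Adj x y) (hxS : x ∉ S) (hyS : y ∉ S) (hk : S.card + 1 = k)
    (hS : G'.Separates A B S) (h1 : G'.Linked A (insert x S) k)
    (h2 : G'.Linked (insert y S) B k) : G.Linked A B k := by
  obtain ⟨f, g, P, hP, hPd⟩ := h1
  obtain ⟨f', g', P', hP', hPd'⟩ := h2
  have hginj : Function.Injective g := by
    intro i j hij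
    by_contra hne
    exact hPd i j hne (P i).end_mem_support (by rw [hij]; exact (P j).end_mem_support)
  have hfinj : Function.Injective f' := by
    intro i j hij
    by_contra hne
    exact hPd' i j hne (P' i).start_mem_support (by rw [hij]; exact (P' j).start_mem_support)
  -- The k disjoint paths have distinct starts in a set of |S| + 1 = k vertices, so they use all of
  -- it.
  have hfsurj : ∀ s ∈ insert y S, ∃ j, f' j = s := by
    have him : Finset.univ.image f' = insert y S := by
      apply Finset.eq_of_subset_of_card_le
      · intro s hs
        obtain ⟨j, -, rfl⟩ := Finset.mem_image.1 hs
        exact (hP' j).1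
      · rw [Finset.card_image_of_injective _ hfinj, Finset.card_insert_of_notMem hyS]
        simp [hk]
    intro s hs
    rw [← him] at hs
    obtain ⟨j, -, hj⟩ := Finset.mem_image.1 hs
    exact ⟨j, hj⟩
  have key : ∀ i, ∃ (j : Fin k) (W : G.Walk (f i) (g' j)),
      (∀ v ∈ W.support, v ∈ (P i).support ∨ v ∈ (P' j).support) ∧
      ((g i = x ∧ f' j = y) ∨ (g i ≠ x ∧ f' j = g i)) := by
    intro i
    by_cases hi : g i = x
    · obtain ⟨j, hj⟩ := hfsurj y (Finset.mem_insert_self _ _)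
      refine ⟨j, ((P i).mapLe hG).append
        (Walk.cons (by rw [hi, hj]; exact hxy) ((P' j).mapLe hG)), ?_, Or.inl ⟨hi, hj⟩⟩
      intro v hv
      rw [Walk.mem_support_append_iff] at hv
      rcases hv with hv | hv
      · left; simpa using hv
      · rw [Walk.support_cons, List.mem_cons] at hv
        rcases hv with rfl | hv
        · left; exact (P i).end_mem_support
        · right; simpa using hv
    · have := (hP i).2.1
      rw [Finset.mem_insert] at this
      obtain ⟨j, hj⟩ := hfsurj (g i) (Finset.mem_insert_of_mem (this.resolve_left hi))
      refine ⟨j, ((P i).mapLe hG).append (((P' j).mapLe hG).copy hj rfl), ?_, Or.inr ⟨hi, hj⟩⟩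
      intro v hv
      rw [Walk.mem_support_append_iff] at hv
      rcases hv with hv | hv
      · left; simpa using hv
      · right; simpa using hv
  choose π W hW hπ using key
  have hπinj : Function.Injective π := by
    intro i i' h
    apply hginj
    rcases hπ i with ⟨a, b⟩ | ⟨a, b⟩ <;> rcases hπ i' with ⟨a', b'⟩ | ⟨a', b'⟩
    · rw [a, a']
    · exfalso
      rw [← h, b] at b'
      have := (hP i').2.1
      rw [← b', Finset.mem_insert] at this
      rcases this with rfl | h3
      · exact hxy.ne rfl
      · exact hyS h3
    · exfalso
      rw [h, b'] at b
      have := (hP i).2.1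
      rw [← b, Finset.mem_insert] at this
      rcases this with rfl | h3
      · exact hxy.ne rfl
      · exact hyS h3
    · rw [← b, ← b', h]
  -- A crossing at v yields a walk of `G'` from `A` to `B`, which must meet `S`. Each path meets `S`
  -- only in its end, so v is the vertex at which the two paths were joined.
  have cross : ∀ i i', i ≠ i' → ∀ v, v ∈ (P i).support → v ∈ (P' (π i')).support → False := by
    intro i i' hne v hv hv'
    have hend : f' (π i') = g i → g i ∈ S → False := by
      intro h3 h4
      rcases hπ i with ⟨a, b⟩ | ⟨a, b⟩
      · rw [a] at h4; exact hxS h4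
      · exact hne (hπinj (hfinj (b.trans h3.symm)))
    obtain ⟨z, hz, hzp⟩ := hS (f i) (hP i).1 (g' (π i')) (hP' _).2.1
      (((P i).takeUntil v hv).append ((P' (π i')).dropUntil v hv'))
    rw [Walk.mem_support_append_iff] at hzp
    rcases hzp with hzp | hzp
    · have hz1 : z = g i := (hP i).2.2.2.2 z ((P i).support_takeUntil_subset_support hv hzp)
        (Finset.mem_insert_of_mem hz)
      have hvg : v = g i := by
        by_contra hne'
        rw [hz1] at hzp
        exact Walk.endpoint_notMem_support_takeUntil (hP i).2.2.1 hv (Ne.symm hne') hzp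
      rw [hz1] at hz
      refine hend ?_ hz
      rw [← hvg]
      exact ((hP' _).2.2.2.1 v hv' (Finset.mem_insert_of_mem (hvg ▸ hz))).symm
    · have hz1 : z = f' (π i') := (hP' _).2.2.2.1 z
        ((P' _).support_dropUntil_subset_support hv' hzp) (Finset.mem_insert_of_mem hz)
      have hvg : v = f' (π i') := by
        by_contra hne'
        have h5 := (hP' (π i')).2.2.1
        rw [← (P' (π i')).take_spec hv'] at h5
        rw [hz1] at hzp
        exact h5.ne_of_mem_support_of_append (Ne.symm hne') (Walk.start_mem_support _) hzp rfl
      rw [hz1, ← hvg] at hz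
      have := (hP i).2.2.2.2 v hv (Finset.mem_insert_of_mem hz)
      rw [this] at hz
      exact hend (hvg.symm.trans this) hz
  refine linked_of_walks f (g' ∘ π) W (fun i => (hP i).1) (fun i => (hP' _).2.1) ?_
  intro i i' hne v hv hv'
  rcases hW i v hv with h3 | h3 <;> rcases hW i' v hv' with h4 | h4
  · exact hPd i i' hne h3 h4
  · exact cross i i' hne v h3 h4
  · exact cross i' i hne.symm v h4 h3
  · exact hPd' _ _ (hπinj.ne hne) h3 h4

/-- If a walk in `G` avoiding `S` reaches `x` from `A` in `G - xy` and `y` reaches `B`, every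
`A`-`(S + x)` separator of `G - xy` separates `A` from `B` in `G`. -/
lemma Separates.of_deleteEdge [DecidableEq V] {G : SimpleGraph V} {A B S Z : Finset V} {x y b : V}
    (hS : (G.deleteEdges {s(x, y)}).Separates A B S)
    (r : (G.deleteEdges {s(x, y)}).Walk y b) (hb : b ∈ B) (hr : ∀ v ∈ r.support, v ∉ S) (hxS : x ∉ S)
    (hP : G.Separates A B (insert x S))
    (hZ : (G.deleteEdges {s(x, y)}).Separates A (insert x S) Z) : G.Separates A B Z := by
  intro a ha b' hb' p
  obtain ⟨z, hz, hzp⟩ := hP a ha b' hb' p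
  obtain ⟨a', c, q, ha', hc, hq, hqs, -, -, hqc⟩ :=
    exists_minimal_path_between (A := ↑A) (B := ↑(insert x S)) (p.takeUntil z hzp) ha hz
  have hqp : q.support ⊆ p.support := fun v hv => p.support_takeUntil_subset_support hzp (hqs hv)
  by_cases he : s(x, y) ∈ q.edges
  -- The path q meets S + x only in its last vertex, so if it uses xy it ends at x. Then y is
  -- reached from `A` without xy, and r continues to `B` off `S`.
  · exfalso
    have hx : x = c := hqc x (q.fst_mem_support_of_mem_edges he) (by simp)
    obtain ⟨t, ht⟩ : ∃ t : (G.deleteEdges {s(x, y)}).Walk a' y, t.support ⊆ q.support := by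
      subst hx
      rcases exists_split_at_edge q hq he with ⟨q1, r1, h1, h2⟩ | ⟨q1, r1, h1, h2⟩
      · refine ⟨q1.append r1.reverse, fun v hv => ?_⟩
        rw [Walk.mem_support_append_iff, Walk.support_reverse, List.mem_reverse] at hv
        exact hv.elim (fun h => h1 h) (fun h => h2 h)
      · exact ⟨q1, h1⟩
    obtain ⟨w, hw, hwt⟩ := hS a' ha' b hb (t.append r)
    rw [Walk.mem_support_append_iff] at hwt
    rcases hwt with hwt | hwt
    · have := hqc w (ht hwt) (by simp [hw])
      exact hxS (by rw [hx, ← this]; exact hw)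
    · exact hr w hwt hw
  · obtain ⟨q', hq'⟩ := exists_walk_deleteEdge q he
    obtain ⟨w, hw, hwq⟩ := hZ a' ha' c hc q'
    exact ⟨w, hw, hqp (hq' ▸ hwq)⟩

/-- **Menger's theorem** for two sets of vertices of a finite graph. -/
theorem linked_of_forall_separates [Finite V] (G : SimpleGraph V) (A B : Finset V) (k : ℕ)
    (h : ∀ Z : Finset V, G.Separates A B Z → k ≤ Z.card) : G.Linked A B k := by
  classical
  induction G using WellFoundedLT.induction generalizing A B k with
  | _ G ih =>
  by_cases hG : G = ⊥
  · have hsep : G.Separates A B (A ∩ B) := by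
      intro a ha b hb p
      cases p with
      | nil => exact ⟨a, by simp [ha, hb], by simp⟩
      | cons h' _ => rw [hG] at h'; exact absurd h' (by simp)
    obtain ⟨T, hT, hTk⟩ := Finset.exists_subset_card_eq (h _ hsep)
    let e := T.equivFinOfCardEq hTk
    refine linked_of_walks (fun i => (e.symm i : V)) (fun i => (e.symm i : V))
      (fun i => Walk.nil) (fun i => ?_) (fun i => ?_) ?_
    · exact (Finset.mem_inter.1 (hT (e.symm i).2)).1
    · exact (Finset.mem_inter.1 (hT (e.symm i).2)).2
    · intro i j hij v hv hv'
      simp only [Walk.support_nil, List.mem_singleton] at hv hv'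
      exact hij (e.symm.injective (Subtype.ext (hv.symm.trans hv')))
  · obtain ⟨x, y, hxy⟩ : ∃ x y, G.Adj x y := by
      by_contra hcon
      push Not at hcon
      exact hG (by ext u v; simp [hcon u v])
    have hlt : ∀ {x y}, G.Adj x y → G.deleteEdges {s(x, y)} < G := by
      intro x y hxy
      refine lt_of_le_of_ne (deleteEdges_le _) fun h' => ?_
      have : (G.deleteEdges {s(x, y)}).Adj x y := by rw [h']; exact hxy
      rw [deleteEdges_adj] at this
      exact this.2 rfl
    by_cases hsm : ∀ Z : Finset V, (G.deleteEdges {s(x, y)}).Separates A B Z → k ≤ Z.card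
    · exact (ih _ (hlt hxy) A B k hsm).mono (deleteEdges_le _)
    push Not at hsm
    obtain ⟨S, hS, hSk⟩ := hsm
    obtain ⟨a, ha, b, hb, p, hp⟩ : ∃ a ∈ A, ∃ b ∈ B, ∃ p : G.Walk a b, ∀ z ∈ p.support, z ∉ S := by
      by_contra hcon
      push Not at hcon
      refine absurd (h S fun a ha b hb p => ?_) (by omega)
      obtain ⟨z, hz, hz'⟩ := hcon a ha b hb p
      exact ⟨z, hz', hz⟩
    have hpb : ∀ z ∈ p.bypass.support, z ∉ S := fun z hz => hp z (p.support_bypass_subset_support hz)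
    have he : s(x, y) ∈ p.bypass.edges := by
      by_contra he
      obtain ⟨q, hq⟩ := exists_walk_deleteEdge _ he
      obtain ⟨z, hz, hzq⟩ := hS a ha b hb q
      exact hpb z (hq ▸ hzq) hz
    -- Here x is the end of the edge on the side of `A`. Both S + x and S + y separate in `G`, which
    -- forces |S| + 1 = k, and induction links `A` to the former and the latter to `B`.
    have main : ∀ x y, G.Adj x y → (G.deleteEdges {s(x, y)}).Separates A B S →
        (∃ (q : (G.deleteEdges {s(x, y)}).Walk a x) (r : (G.deleteEdges {s(x, y)}).Walk y b),
          q.support ⊆ p.bypass.support ∧ r.support ⊆ p.bypass.support) → G.Linked A B k := by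
      rintro x y hxy hS ⟨q, r, hq, hr⟩
      have hxS : x ∉ S := hpb x (hq q.end_mem_support)
      have hyS : y ∉ S := hpb y (hr r.start_mem_support)
      have hsepx : ∀ c ∈ s(x, y), G.Separates A B (insert c S) := by
        intro c hc a' ha' b' hb' p'
        by_cases he : s(x, y) ∈ p'.edges
        · rcases Sym2.mem_iff.1 hc with rfl | rfl
          · exact ⟨c, by simp, p'.fst_mem_support_of_mem_edges he⟩
          · exact ⟨c, by simp, p'.snd_mem_support_of_mem_edges he⟩
        · obtain ⟨q', hq'⟩ := exists_walk_deleteEdge p' he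
          obtain ⟨z, hz, hzq⟩ := hS a' ha' b' hb' q'
          exact ⟨z, by simp [hz], hq' ▸ hzq⟩
      have hk : S.card + 1 = k := by
        have h1 := h _ (hsepx x (by simp))
        rw [Finset.card_insert_of_notMem hxS] at h1
        omega
      refine Linked.glue (deleteEdges_le _) hxy hxS hyS hk hS
        (ih _ (hlt hxy) _ _ _ fun Z hZ => h Z ?_) (ih _ (hlt hxy) _ _ _ fun Z hZ => h Z ?_)
      · exact Separates.of_deleteEdge hS r hb (fun v hv => hpb v (hr hv)) hxS
          (hsepx x (by simp)) hZ
      · have hq' : ∀ v ∈ q.reverse.support, v ∉ S := by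
          intro v hv
          rw [Walk.support_reverse, List.mem_reverse] at hv
          exact hpb v (hq hv)
        have hsw : G.deleteEdges {s(x, y)} = G.deleteEdges {s(y, x)} := by rw [Sym2.eq_swap]
        generalize q.reverse = q' at hq'
        rw [hsw] at hS hZ
        revert q'
        rw [hsw]
        intro q' hq'
        exact (Separates.of_deleteEdge hS.symm q' ha hq' hyS
          (hsepx y (by simp)).symm hZ.symm).symm
    rcases exists_split_at_edge _ p.bypass_isPath he with h1 | h1
    · exact main x y hxy hS h1
    · rw [Sym2.eq_swap] at h1 hS
      exact main y x hxy.symm hS h1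

end SimpleGraph

/-! ### Vertex boundaries: submodularity, small sets and independence. -/

namespace SimpleGraph

section Boundary

variable {V : Type*} [DecidableEq V]

/-- `C` contains fewer than half of the vertices of `U`. -/
def Small (U C : Finset V) : Prop := 2 * (C ∩ U).card < U.card

lemma Small.mono {U C D : Finset V} (h : Small U D) (hC : C ⊆ D) : Small U C := by
  have := Finset.card_le_card (Finset.inter_subset_inter_right hC (u := U))
  unfold Small at *
  omega

variable [Fintype V]

open scoped Classical in
/-- The vertices of `C` with a neighbour outside `C`. -/
noncomputable def boundary (G : SimpleGraph V) (C : Finset V) : Finset V :=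
  C.filter fun v => ∃ w, w ∉ C ∧ G.Adj v w

lemma mem_boundary {G : SimpleGraph V} {C : Finset V} {v : V} :
    v ∈ G.boundary C ↔ v ∈ C ∧ ∃ w, w ∉ C ∧ G.Adj v w := by
  simp [boundary]

lemma boundary_subset (G : SimpleGraph V) (C : Finset V) : G.boundary C ⊆ C :=
  fun _ hv => (mem_boundary.1 hv).1

lemma boundary_mono {G G' : SimpleGraph V} (h : G ≤ G') (C : Finset V) :
    G.boundary C ⊆ G'.boundary C := by
  intro v hv
  obtain ⟨h1, w, h2, h3⟩ := mem_boundary.1 hv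
  exact mem_boundary.2 ⟨h1, w, h2, h h3⟩

/-- Submodularity of the size of the boundary, for sets in possibly different graphs. -/
lemma card_boundary_union_add_inter {G₁ G₂ G₃ G₄ : SimpleGraph V} {C D : Finset V}
    (h₁ : G₃ ≤ G₁) (h₂ : G₃ ≤ G₂)
    (h : ∀ v ∈ C, v ∈ D → ∀ w, G₄.Adj v w → (w ∉ C ∨ w ∉ D) →
      (w ∉ C ∧ G₁.Adj v w) ∨ (w ∉ D ∧ G₂.Adj v w)) :
    (G₃.boundary (C ∪ D)).card + (G₄.boundary (C ∩ D)).card ≤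
      (G₁.boundary C).card + (G₂.boundary D).card := by
  rw [← Finset.card_union_add_card_inter, ← Finset.card_union_add_card_inter (G₁.boundary C)]
  refine add_le_add (Finset.card_le_card ?_) (Finset.card_le_card ?_)
  · intro v hv
    rw [Finset.mem_union] at hv ⊢
    rcases hv with hv | hv
    · obtain ⟨hv, w, hw, hvw⟩ := mem_boundary.1 hv
      simp only [Finset.mem_union, not_or] at hv hw
      exact hv.imp (fun h => mem_boundary.2 ⟨h, w, hw.1, h₁ hvw⟩)
        (fun h => mem_boundary.2 ⟨h, w, hw.2, h₂ hvw⟩)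
    · obtain ⟨hv, w, hw, hvw⟩ := mem_boundary.1 hv
      rw [Finset.mem_inter] at hv hw
      rcases h v hv.1 hv.2 w hvw (by tauto) with h' | h'
      · exact Or.inl (mem_boundary.2 ⟨hv.1, w, h'⟩)
      · exact Or.inr (mem_boundary.2 ⟨hv.2, w, h'⟩)
  · intro v hv
    obtain ⟨hv3, hv4⟩ := Finset.mem_inter.1 hv
    obtain ⟨-, w, hw, hvw⟩ := mem_boundary.1 hv3
    have hv4 := Finset.mem_inter.1 (boundary_subset _ _ hv4)
    simp only [Finset.mem_union, not_or] at hw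
    exact Finset.mem_inter.2 ⟨mem_boundary.2 ⟨hv4.1, w, hw.1, h₁ hvw⟩,
      mem_boundary.2 ⟨hv4.2, w, hw.2, h₂ hvw⟩⟩

lemma card_boundary_union_add_inter_self (G : SimpleGraph V) (C D : Finset V) :
    (G.boundary (C ∪ D)).card + (G.boundary (C ∩ D)).card ≤
      (G.boundary C).card + (G.boundary D).card :=
  card_boundary_union_add_inter le_rfl le_rfl fun _ _ _ _ hvw hw =>
    hw.imp (fun h => ⟨h, hvw⟩) (fun h => ⟨h, hvw⟩)

lemma card_boundary_union_le (G : SimpleGraph V) (C D : Finset V) :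
    (G.boundary (C ∪ D)).card ≤ (G.boundary C).card + D.card := by
  have h1 := card_boundary_union_add_inter_self G C D
  have h2 := Finset.card_le_card (G.boundary_subset D)
  omega

/-- Each boundary vertex that is lost is charged to a deleted edge from it to the outside of `C`.
Such an edge has only one end in `C`, so it is charged once. -/
lemma card_boundary_le_deleteEdges (G : SimpleGraph V) (E : Finset (Sym2 V)) (C : Finset V) :
    (G.boundary C).card ≤ ((G.deleteEdges (E : Set (Sym2 V))).boundary C).card + E.card := by
  classical
  have h : G.boundary C ⊆ (G.deleteEdges (E : Set (Sym2 V))).boundary C ∪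
      C.filter fun v => ∃ w, w ∉ C ∧ s(v, w) ∈ E := by
    intro v hv
    obtain ⟨hv, w, hw, hvw⟩ := mem_boundary.1 hv
    by_cases he : s(v, w) ∈ E
    · exact Finset.mem_union_right _ (Finset.mem_filter.2 ⟨hv, w, hw, he⟩)
    · refine Finset.mem_union_left _ (mem_boundary.2 ⟨hv, w, hw, ?_⟩)
      rw [deleteEdges_adj]
      exact ⟨hvw, by simpa using he⟩
  refine (Finset.card_le_card h).trans ((Finset.card_union_le _ _).trans ?_)
  gcongr
  have h2 : ∀ v, ∃ e, v ∈ C.filter (fun v => ∃ w, w ∉ C ∧ s(v, w) ∈ E) →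
      e ∈ E ∧ ∃ w, w ∉ C ∧ e = s(v, w) := by
    intro v
    by_cases hv : v ∈ C.filter (fun v => ∃ w, w ∉ C ∧ s(v, w) ∈ E)
    · obtain ⟨-, w, hw, he⟩ := Finset.mem_filter.1 hv
      exact ⟨s(v, w), fun _ => ⟨he, w, hw, rfl⟩⟩
    · exact ⟨s(v, v), fun h => absurd h hv⟩
  choose e he using h2
  refine Finset.card_le_card_of_injOn e (fun v hv => (he v hv).1) ?_
  intro v hv v' hv' hvv
  obtain ⟨-, w, hw, h3⟩ := he v hv
  obtain ⟨-, w', hw', h4⟩ := he v' hv'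
  have hvC := (Finset.mem_filter.1 hv).1
  have hvC' := (Finset.mem_filter.1 hv').1
  rw [h3, h4, Sym2.eq_iff] at hvv
  rcases hvv with ⟨h, -⟩ | ⟨h, -⟩
  · exact h
  · exact absurd (h ▸ hvC) hw'

/-- No set with a small boundary splits `U` evenly. -/
structure Spread (F : SimpleGraph V) (U : Finset V) (h : ℕ) : Prop where
  dichotomy : ∀ C : Finset V, (F.boundary C).card ≤ h → (C ∩ U).card ≤ h ∨ (U \ C).card ≤ h
  card_gt : 4 * h < U.card

variable {F : SimpleGraph V} {U : Finset V} {h : ℕ}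

lemma Spread.small_of_card (sp : F.Spread U h) {C : Finset V} (hC : C.card ≤ h) : Small U C := by
  have := Finset.card_le_card (Finset.inter_subset_left (s₁ := C) (s₂ := U))
  have := sp.card_gt
  unfold Small
  omega

/-- The other alternative of the dichotomy would leave more than half of `U` inside `C`. So there is
a gap between h and half of `U`. -/
lemma Spread.card_inter_le (sp : F.Spread U h) {C : Finset V} (hC : Small U C)
    (hb : (F.boundary C).card ≤ h) : (C ∩ U).card ≤ h := by
  rcases sp.dichotomy C hb with h1 | h1
  · exact h1
  · have h2 := Finset.card_sdiff_add_card_inter U C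
    rw [Finset.inter_comm] at h2
    have := sp.card_gt
    unfold Small at hC
    omega

lemma Spread.card_sdiff_le (sp : F.Spread U h) {C : Finset V} (hC : ¬ Small U C)
    (hb : (F.boundary C).card ≤ h) : (U \ C).card ≤ h := by
  rcases sp.dichotomy C hb with h1 | h1
  · have := sp.card_gt
    unfold Small at hC
    omega
  · exact h1

/-- By the gap each set contains at most h vertices of `U`, and |U| > 4h. This allows witnesses to
be united repeatedly without ceasing to be small. -/
lemma Spread.small_union (sp : F.Spread U h) {C D : Finset V} (hC : Small U C) (hD : Small U D)
    (hbC : (F.boundary C).card ≤ h) (hbD : (F.boundary D).card ≤ h) : Small U (C ∪ D) := by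
  have h1 := sp.card_inter_le hC hbC
  have h2 := sp.card_inter_le hD hbD
  have h3 := Finset.card_union_le (C ∩ U) (D ∩ U)
  rw [← Finset.union_inter_distrib_right] at h3
  have := sp.card_gt
  unfold Small
  omega

/-- Every small set that contains `C₀` and `I` has at least `p + |I|` boundary vertices. -/
def IndepOver (G : SimpleGraph V) (U C₀ : Finset V) (p : ℕ) (I : Finset V) : Prop :=
  ∀ Y, Small U Y → C₀ ⊆ Y → I ⊆ Y → p + I.card ≤ (G.boundary Y).card

lemma IndepOver.of_le {G G' : SimpleGraph V} (hG : G ≤ G') {C₀ : Finset V} {p : ℕ} {I : Finset V}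
    (hI : G.IndepOver U C₀ p I) : G'.IndepOver U C₀ p I :=
  fun Y h1 h2 h3 => (hI Y h1 h2 h3).trans (Finset.card_le_card (boundary_mono hG Y))

lemma card_boundary_le {E : Finset (Sym2 V)} {q : ℕ} (hE : E.card ≤ q)
    {C : Finset V} {m : ℕ} (hC : ((F.deleteEdges (E : Set (Sym2 V))).boundary C).card ≤ m)
    (hh : m + q ≤ h) : (F.boundary C).card ≤ h := by
  have := card_boundary_le_deleteEdges F E C
  omega

/-- Adding `I \ J` to a violating set for `J` costs at most one boundary vertex per element and
keeps the set small, so it would violate independence of `I`. -/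
lemma IndepOver.subset (sp : F.Spread U h) {E : Finset (Sym2 V)} {q : ℕ} (hE : E.card ≤ q)
    {C₀ : Finset V} {p : ℕ} {I J : Finset V}
    (hI : (F.deleteEdges (E : Set (Sym2 V))).IndepOver U C₀ p I) (hh : p + I.card + q ≤ h)
    (hJ : J ⊆ I) : (F.deleteEdges (E : Set (Sym2 V))).IndepOver U C₀ p J := by
  intro Y hY h0 hJY
  by_contra hcon
  push Not at hcon
  have hJI := Finset.card_le_card hJ
  have hsm : Small U (Y ∪ (I \ J)) := by
    refine sp.small_union hY (sp.small_of_card ?_) (card_boundary_le hE (m := p + I.card)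
      (by omega) hh) ((Finset.card_le_card (boundary_subset _ _)).trans ?_)
    all_goals exact (Finset.card_le_card Finset.sdiff_subset).trans (by omega)
  have h1 := hI _ hsm (h0.trans Finset.subset_union_left) (by
    intro v hv
    by_cases hvJ : v ∈ J
    · exact Finset.mem_union_left _ (hJY hvJ)
    · exact Finset.mem_union_right _ (Finset.mem_sdiff.2 ⟨hv, hvJ⟩))
  have h2 := card_boundary_union_le (F.deleteEdges (E : Set (Sym2 V))) Y (I \ J)
  rw [Finset.card_sdiff_of_subset hJ] at h2
  omega

/-- The exchange argument: either `S` contains an independent set of size `m`, or `S` is contained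
in a small set with few boundary vertices. -/
lemma exists_indepOver (sp : F.Spread U h) {E : Finset (Sym2 V)} {q : ℕ} (hE : E.card ≤ q)
    {C₀ : Finset V} {p m : ℕ} (hh : p + m + q ≤ h) (hC₀ : Small U C₀)
    (hb : ((F.deleteEdges (E : Set (Sym2 V))).boundary C₀).card ≤ p)
    (h₀ : (F.deleteEdges (E : Set (Sym2 V))).IndepOver U C₀ p ∅) (S : Finset V) :
    (∃ I ⊆ S, I.card = m ∧ (F.deleteEdges (E : Set (Sym2 V))).IndepOver U C₀ p I) ∨
      ∃ Y, Small U Y ∧ C₀ ⊆ Y ∧ S ⊆ Y ∧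
        ((F.deleteEdges (E : Set (Sym2 V))).boundary Y).card < p + m := by
  classical
  set G := F.deleteEdges (E : Set (Sym2 V)) with hG
  let 𝒮 := S.powerset.filter fun I => G.IndepOver U C₀ p I ∧ I.card ≤ m
  have hne : 𝒮.Nonempty := ⟨∅, by simp [𝒮, h₀]⟩
  obtain ⟨I, hI, hmax⟩ := Finset.exists_max_image 𝒮 Finset.card hne
  obtain ⟨hIS, hIi, hIm⟩ := by simpa [𝒮] using hI
  rcases hIm.eq_or_lt with hIm | hIm
  · exact Or.inl ⟨I, hIS, hIm, hIi⟩
  right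
  -- As `I` is maximal, each x lies in a tight set: one containing `C₀` and `I` with at most p + |I|
  -- boundary vertices.
  have step : ∀ x ∈ S, ∃ Y, Small U Y ∧ C₀ ⊆ Y ∧ I ⊆ Y ∧ x ∈ Y ∧ (G.boundary Y).card ≤ p + I.card := by
    intro x hx
    have hbase : Small U (C₀ ∪ I) := sp.small_union hC₀ (sp.small_of_card (by omega))
      (card_boundary_le hE hb (by omega)) ((Finset.card_le_card (boundary_subset _ _)).trans (by omega))
    by_cases hxI : x ∈ I
    · exact ⟨C₀ ∪ I, hbase, Finset.subset_union_left, Finset.subset_union_right,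
        Finset.mem_union_right _ hxI, (card_boundary_union_le G C₀ I).trans (by omega)⟩
    · have hni : ¬ G.IndepOver U C₀ p (insert x I) := by
        intro hi
        have := hmax (insert x I) (by
          simp only [𝒮, Finset.mem_filter, Finset.mem_powerset]
          refine ⟨Finset.insert_subset hx hIS, hi, ?_⟩
          rw [Finset.card_insert_of_notMem hxI]; omega)
        rw [Finset.card_insert_of_notMem hxI] at this
        omega
      unfold IndepOver at hni
      push Not at hni
      obtain ⟨Y, h1, h2, h3, h4⟩ := hni
      rw [Finset.card_insert_of_notMem hxI] at h4
      exact ⟨Y, h1, h2, fun v hv => h3 (Finset.mem_insert_of_mem hv),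
        h3 (Finset.mem_insert_self _ _), by omega⟩
  -- Tight sets are closed under union: the intersection of two still contains `C₀` and `I`, so it
  -- has at least p + |I| boundary vertices, and submodularity bounds the union.
  have main : ∀ S' ⊆ S, ∃ Y, Small U Y ∧ C₀ ⊆ Y ∧ I ⊆ Y ∧ S' ⊆ Y ∧
      (G.boundary Y).card ≤ p + I.card := by
    intro S'
    induction S' using Finset.induction_on with
    | empty =>
      intro _
      exact ⟨C₀ ∪ I, sp.small_union hC₀ (sp.small_of_card (by omega))
        (card_boundary_le hE hb (by omega))
        ((Finset.card_le_card (boundary_subset _ _)).trans (by omega)),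
        Finset.subset_union_left, Finset.subset_union_right, by simp,
        (card_boundary_union_le G C₀ I).trans (by omega)⟩
    | insert x S' hx ih =>
      intro hS'
      obtain ⟨Y, h1, h2, h3, h4, h5⟩ := ih fun v hv => hS' (Finset.mem_insert_of_mem hv)
      obtain ⟨X, k1, k2, k3, k4, k5⟩ := step x (hS' (Finset.mem_insert_self _ _))
      have h6 := hIi (Y ∩ X) (h1.mono Finset.inter_subset_left) (Finset.subset_inter h2 k2)
        (Finset.subset_inter h3 k3)
      have h7 := card_boundary_union_add_inter_self G Y X
      refine ⟨Y ∪ X, sp.small_union h1 k1 (card_boundary_le hE h5 (by omega))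
        (card_boundary_le hE k5 (by omega)), h2.trans Finset.subset_union_left,
        h3.trans Finset.subset_union_left, ?_, by omega⟩
      exact Finset.insert_subset (Finset.mem_union_right _ k4) (h4.trans Finset.subset_union_left)
  obtain ⟨Y, h1, h2, -, h4, h5⟩ := main S subset_rfl
  exact ⟨Y, h1, h2, h4, by omega⟩

end Boundary

end SimpleGraph

/-! ### The duality between packable families of starts and hitting sets. -/

namespace SimpleGraph

section Packing

variable {V ι : Type*} [DecidableEq V]

/-- The pairs `b j`, `f j` for `j ∈ J`. -/
def pairs (b f : ι → V) (J : Finset ι) : Finset (Sym2 V) :=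
  J.image fun j => s(b j, f j)

lemma card_pairs_le (b f : ι → V) (J : Finset ι) : (pairs b f J).card ≤ J.card :=
  Finset.card_image_le

lemma mem_pairs {b f : ι → V} {J : Finset ι} {e : Sym2 V} :
    e ∈ pairs b f J ↔ ∃ j ∈ J, s(b j, f j) = e := by
  simp [pairs]

variable (F : SimpleGraph V)

lemma deleteEdges_pairs_adj {b f : ι → V} {J : Finset ι} {v w : V} :
    (F.deleteEdges (pairs b f J : Set (Sym2 V))).Adj v w ↔
      F.Adj v w ∧ ∀ j ∈ J, s(b j, f j) ≠ s(v, w) := by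
  rw [deleteEdges_adj, Finset.mem_coe, mem_pairs]
  simp

lemma deleteEdges_pairs_anti {b f : ι → V} {J K : Finset ι} (h : J ⊆ K) :
    F.deleteEdges (pairs b f K : Set (Sym2 V)) ≤ F.deleteEdges (pairs b f J : Set (Sym2 V)) :=
  deleteEdges_anti (Finset.coe_subset.2 (Finset.image_subset_image h))

variable [Fintype V]

/-- The starts `j ∈ J` have distinct `a j`, and in the graph without the edges `b j f j` the
vertices `b j` are not separated from most of `U` by fewer than `|J|` vertices. -/
def Packable (U : Finset V) (a b f : ι → V) (J : Finset ι) : Prop :=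
  Set.InjOn a J ∧ ∀ C, Small U C → J.image b ⊆ C →
    J.card ≤ ((F.deleteEdges (pairs b f J : Set (Sym2 V))).boundary C).card

variable {F} {U : Finset V} {h : ℕ} {a b f : ι → V}

/-- Test the condition on the set of ends itself: it has at least |J| boundary vertices, hence at
least |J| elements. -/
lemma Packable.injOn (sp : F.Spread U h) {J : Finset ι} (hJ : F.Packable U a b f J)
    (hh : J.card ≤ h) : Set.InjOn b J := by
  refine Finset.card_image_iff.1 (le_antisymm Finset.card_image_le ?_)
  exact (hJ.2 _ (sp.small_of_card (Finset.card_image_le.trans hh)) subset_rfl).trans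
    (Finset.card_le_card (boundary_subset _ _))

/-- With all pairs of `J` deleted this is heredity of independence; restoring the pairs outside `K`
only enlarges boundaries. -/
lemma Packable.subset [DecidableEq ι] (sp : F.Spread U h) {J K : Finset ι}
    (hJ : F.Packable U a b f J) (hh : 2 * J.card ≤ h) (hK : K ⊆ J) : F.Packable U a b f K := by
  refine ⟨hJ.1.mono (Finset.coe_subset.2 hK), fun C hC hb => ?_⟩
  have hle : ((F.deleteEdges (pairs b f J : Set (Sym2 V))).boundary C).card ≤
      ((F.deleteEdges (pairs b f K : Set (Sym2 V))).boundary C).card :=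
    Finset.card_le_card (boundary_mono (deleteEdges_pairs_anti F hK) C)
  refine le_trans ?_ hle
  have hind : (F.deleteEdges (pairs b f J : Set (Sym2 V))).IndepOver U ∅ 0 (J.image b) := by
    intro Y hY _ hYJ
    rw [zero_add]
    exact Finset.card_image_le.trans (hJ.2 Y hY hYJ)
  have := hind.subset sp (card_pairs_le b f J)
    (by have := Finset.card_image_le (s := J) (f := b); omega) (Finset.image_subset_image hK)
    C hC (by simp) hb
  rwa [zero_add, Finset.card_image_of_injOn
    ((hJ.injOn sp (by omega)).mono (Finset.coe_subset.2 hK))] at this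

/-- A largest small set among those with at most `p` boundary vertices that contain `b(J)`. -/
lemma exists_maximal_boundary_le (sp : F.Spread U h) (J : Finset ι) (hJ : J.card ≤ h) :
    ∃ C₀, Small U C₀ ∧ J.image b ⊆ C₀ ∧
      ((F.deleteEdges (pairs b f J : Set (Sym2 V))).boundary C₀).card ≤ J.card ∧
      ∀ C, Small U C → C₀ ⊆ C →
        ((F.deleteEdges (pairs b f J : Set (Sym2 V))).boundary C).card ≤ J.card → C = C₀ := by
  classical
  let 𝒮 := (Finset.univ : Finset (Finset V)).filter fun C => Small U C ∧ J.image b ⊆ C ∧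
    ((F.deleteEdges (pairs b f J : Set (Sym2 V))).boundary C).card ≤ J.card
  have hne : 𝒮.Nonempty := by
    refine ⟨J.image b, ?_⟩
    simp only [𝒮, Finset.mem_filter, Finset.mem_univ, true_and]
    exact ⟨sp.small_of_card (Finset.card_image_le.trans hJ), subset_rfl,
      (Finset.card_le_card (boundary_subset _ _)).trans Finset.card_image_le⟩
  obtain ⟨C₀, hC₀, hmax⟩ := Finset.exists_max_image 𝒮 Finset.card hne
  simp only [𝒮, Finset.mem_filter, Finset.mem_univ, true_and] at hC₀ hmax
  refine ⟨C₀, hC₀.1, hC₀.2.1, hC₀.2.2, fun C h1 h2 h3 => ?_⟩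
  exact (Finset.eq_of_subset_of_card_le h2 (hmax C ⟨h1, hC₀.2.1.trans h2, h3⟩)).symm

variable [DecidableEq ι]

/-- If `J + x` is not packable, this is witnessed by a set that contains `C₀`. -/
lemma exists_witness (sp : F.Spread U h) {J : Finset ι} (hJ : F.Packable U a b f J)
    (hh : 2 * J.card + 1 ≤ h) {C₀ : Finset V} (hC₀ : Small U C₀) (hbC₀ : J.image b ⊆ C₀)
    (hC₀' : ((F.deleteEdges (pairs b f J : Set (Sym2 V))).boundary C₀).card ≤ J.card)
    {x : ι} (hxa : a x ∉ J.image a) (hxb : b x ∉ C₀)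
    (hx : ¬ F.Packable U a b f (insert x J)) :
    ∃ C, Small U C ∧ C₀ ⊆ C ∧ b x ∈ C ∧
      ((F.deleteEdges (pairs b f (insert x J) : Set (Sym2 V))).boundary C).card ≤ J.card := by
  have hxJ : x ∉ J := fun h => hxa (Finset.mem_image_of_mem _ h)
  have hinj : Set.InjOn a (insert x J : Finset ι) := by
    rw [Finset.coe_insert, Set.injOn_insert (by simpa using hxJ)]
    exact ⟨hJ.1, by simpa using hxa⟩
  obtain ⟨C, hC, hbC, hCc⟩ : ∃ C, Small U C ∧ (insert x J).image b ⊆ C ∧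
      ((F.deleteEdges (pairs b f (insert x J) : Set (Sym2 V))).boundary C).card < J.card + 1 := by
    by_contra hcon
    push Not at hcon
    refine hx ⟨hinj, fun C h1 h2 => ?_⟩
    rw [Finset.card_insert_of_notMem hxJ]
    exact hcon C h1 h2
  have hbx : b x ∈ C := hbC (Finset.mem_image_of_mem _ (Finset.mem_insert_self _ _))
  have hbJ : J.image b ⊆ C :=
    (Finset.image_subset_image (Finset.subset_insert _ _)).trans hbC
  have hcard : (pairs b f (insert x J)).card ≤ J.card + 1 :=
    (card_pairs_le _ _ _).trans (Finset.card_insert_le _ _)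
  -- The two graphs differ at most in the pair of x. As `b x` is not in `C₀`, that pair is no edge
  -- from C ∩ C₀ into `C₀`, so submodularity holds across the graphs. Packability of `J` gives the
  -- intersection at least |J| boundary vertices, which leaves at most |J| for the union.
  have h1 := card_boundary_union_add_inter
    (G₁ := F.deleteEdges (pairs b f (insert x J) : Set (Sym2 V)))
    (G₂ := F.deleteEdges (pairs b f J : Set (Sym2 V)))
    (G₃ := F.deleteEdges (pairs b f (insert x J) : Set (Sym2 V)))
    (G₄ := F.deleteEdges (pairs b f J : Set (Sym2 V))) (C := C) (D := C₀) le_rfl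
    (deleteEdges_pairs_anti F (Finset.subset_insert _ _)) (by
      intro v hv hv0 w hvw hw
      by_cases hw0 : w ∈ C₀
      · refine Or.inl ⟨hw.resolve_right (by simpa using hw0), ?_⟩
        rw [deleteEdges_pairs_adj] at hvw ⊢
        refine ⟨hvw.1, fun j hj => ?_⟩
        rcases Finset.mem_insert.1 hj with rfl | hj
        · intro he
          rw [Sym2.eq_iff] at he
          rcases he with ⟨he, -⟩ | ⟨he, -⟩
          · exact hxb (he ▸ hv0)
          · exact hxb (he ▸ hw0)
        · exact hvw.2 j hj
      · exact Or.inr ⟨hw0, hvw⟩)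
  have h2 := hJ.2 (C ∩ C₀) (hC.mono Finset.inter_subset_left) (Finset.subset_inter hbJ hbC₀)
  refine ⟨C ∪ C₀, sp.small_union hC hC₀ (card_boundary_le hcard (m := J.card) (by omega) (by omega))
    (card_boundary_le (card_pairs_le _ _ _) hC₀' (by omega)), Finset.subset_union_right,
    Finset.mem_union_left _ hbx, by omega⟩

/-- Witnesses `C s` for the starts `x s`, independent over `C₀`, of which none leaves through the
boundary of `C₀`, are bounded in number by the boundary of `C₀`. -/
lemma card_le_of_witnesses (sp : F.Spread U h) {J : Finset ι} (hJ : F.Packable U a b f J)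
    {C₀ : Finset V} (hC₀ : Small U C₀) (hbC₀ : J.image b ⊆ C₀)
    (hC₀' : ((F.deleteEdges (pairs b f J : Set (Sym2 V))).boundary C₀).card ≤ J.card)
    (hmax : ∀ C, Small U C → C₀ ⊆ C →
        ((F.deleteEdges (pairs b f J : Set (Sym2 V))).boundary C).card ≤ J.card → C = C₀)
    {I : Finset V} (hI : (F.deleteEdges (pairs b f J : Set (Sym2 V))).IndepOver U C₀ J.card I)
    (hh : 2 * J.card + I.card + 1 ≤ h) {x : V → ι} (hx : ∀ s ∈ I, b (x s) = s)
    (hIC : ∀ s ∈ I, s ∉ C₀)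
    {C : V → Finset V} (hC : ∀ s ∈ I, Small U (C s) ∧ C₀ ⊆ C s ∧ s ∈ C s ∧
      ((F.deleteEdges (pairs b f (insert (x s) J) : Set (Sym2 V))).boundary (C s)).card ≤ J.card)
    (hlive : ∀ s ∈ I, ∀ D, Small U D → C₀ ⊆ D → s ∈ D →
      ¬ (F.deleteEdges (pairs b f (insert (x s) J) : Set (Sym2 V))).boundary D ⊆
        (F.deleteEdges (pairs b f J : Set (Sym2 V))).boundary C₀) :
    I.card ≤ J.card := by
  set G := F.deleteEdges (pairs b f J : Set (Sym2 V)) with hG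
  let G' : V → SimpleGraph V := fun s => F.deleteEdges (pairs b f (insert (x s) J) : Set (Sym2 V))
  have hG'G : ∀ s, G' s ≤ G := fun s => deleteEdges_pairs_anti F (Finset.subset_insert _ _)
  have hadj : ∀ s ∈ I, ∀ v w, G.Adj v w → s(s, f (x s)) ≠ s(v, w) → (G' s).Adj v w := by
    intro s hs v w hvw hne
    rw [deleteEdges_pairs_adj] at hvw ⊢
    refine ⟨hvw.1, fun j hj => ?_⟩
    rcases Finset.mem_insert.1 hj with rfl | hj
    · rw [hx s hs]; exact hne
    · exact hvw.2 j hj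
  have hbG : ∀ s ∈ I, (G.boundary (C s)).card ≤ J.card + 1 := by
    intro s hs
    obtain ⟨-, -, hsC, hc⟩ := hC s hs
    have h1 : G.boundary (C s) ⊆ insert s ((G' s).boundary (C s)) := by
      intro v hv
      obtain ⟨hv, w, hw, hvw⟩ := mem_boundary.1 hv
      by_cases he : s(s, f (x s)) = s(v, w)
      · rw [Sym2.eq_iff] at he
        rcases he with ⟨rfl, -⟩ | ⟨rfl, -⟩
        · exact Finset.mem_insert_self _ _
        · exact absurd hsC hw
      · exact Finset.mem_insert_of_mem (mem_boundary.2 ⟨hv, w, hw, hadj s hs v w hvw he⟩)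
    have h2 := Finset.card_le_card h1
    have h3 := Finset.card_insert_le s ((G' s).boundary (C s))
    change ((G' s).boundary (C s)).card ≤ _ at hc
    omega
  have hpair : ∀ s ∈ I, ∀ t ∈ I, s ≠ t → G.IndepOver U C₀ J.card {s, t} := by
    intro s hs t ht _
    exact hI.subset sp (card_pairs_le _ _ _) (by omega)
      (Finset.insert_subset hs (Finset.singleton_subset_iff.2 ht))
  -- In `G` the set `C s` has at most |J| + 1 boundary vertices, too few for a set that contains two
  -- independent vertices.
  have hnot : ∀ s ∈ I, ∀ t ∈ I, s ≠ t → t ∉ C s := by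
    intro s hs t ht hst htC
    obtain ⟨h1, h2, h3, -⟩ := hC s hs
    have h4 := hpair s hs t ht hst (C s) h1 h2
      (Finset.insert_subset h3 (Finset.singleton_subset_iff.2 htC))
    rw [Finset.card_pair hst] at h4
    have := hbG s hs
    omega
  have hcard : ∀ s, (pairs b f (insert (x s) J)).card ≤ J.card + 1 := fun s =>
    (card_pairs_le _ _ _).trans (Finset.card_insert_le _ _)
  -- The union has at least |J| + 2 boundary vertices in `G`, and only s and t can be lost with the
  -- two pairs. Submodularity then leaves at most |J| for the intersection, and `C₀` is maximal.
  have hinter : ∀ s ∈ I, ∀ t ∈ I, s ≠ t → C s ∩ C t = C₀ := by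
    intro s hs t ht hst
    obtain ⟨s1, s2, s3, s4⟩ := hC s hs
    obtain ⟨t1, t2, t3, t4⟩ := hC t ht
    have h1 := card_boundary_union_add_inter (G₁ := G' s) (G₂ := G' t) (G₃ := G' s ⊓ G' t)
      (G₄ := G) (C := C s) (D := C t) inf_le_left inf_le_right (by
        intro v hvs hvt w hvw hw
        by_cases hws : w ∈ C s
        · have hwt : w ∉ C t := hw.resolve_left (by simpa using hws)
          refine Or.inr ⟨hwt, hadj t ht v w hvw fun he => ?_⟩
          rw [Sym2.eq_iff] at he
          rcases he with ⟨rfl, -⟩ | ⟨rfl, -⟩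
          · exact hnot s hs _ ht hst hvs
          · exact hwt t3
        · refine Or.inl ⟨hws, hadj s hs v w hvw fun he => ?_⟩
          rw [Sym2.eq_iff] at he
          rcases he with ⟨rfl, -⟩ | ⟨rfl, -⟩
          · exact hnot t ht _ hs hst.symm hvt
          · exact hws s3)
    have hsm : Small U (C s ∪ C t) := sp.small_union s1 t1
      (card_boundary_le (hcard s) s4 (by omega)) (card_boundary_le (hcard t) t4 (by omega))
    have h2 := hpair s hs t ht hst _ hsm (s2.trans Finset.subset_union_left)
      (Finset.insert_subset (Finset.mem_union_left _ s3)
        (Finset.singleton_subset_iff.2 (Finset.mem_union_right _ t3)))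
    rw [Finset.card_pair hst] at h2
    have h3 : G.boundary (C s ∪ C t) ⊆ insert s (insert t ((G' s ⊓ G' t).boundary (C s ∪ C t))) := by
      intro v hv
      obtain ⟨hv, w, hw, hvw⟩ := mem_boundary.1 hv
      simp only [Finset.mem_union, not_or] at hw
      by_cases hes : s(s, f (x s)) = s(v, w)
      · rw [Sym2.eq_iff] at hes
        rcases hes with ⟨rfl, -⟩ | ⟨rfl, -⟩
        · exact Finset.mem_insert_self _ _
        · exact absurd s3 hw.1
      by_cases het : s(t, f (x t)) = s(v, w)
      · rw [Sym2.eq_iff] at het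
        rcases het with ⟨rfl, -⟩ | ⟨rfl, -⟩
        · exact Finset.mem_insert_of_mem (Finset.mem_insert_self _ _)
        · exact absurd t3 hw.2
      refine Finset.mem_insert_of_mem (Finset.mem_insert_of_mem (mem_boundary.2
        ⟨hv, w, by simp [hw], hadj s hs v w hvw hes, hadj t ht v w hvw het⟩))
    have h4 := (Finset.card_le_card h3).trans (Finset.card_insert_le _ _)
    have h5 := Finset.card_insert_le t ((G' s ⊓ G' t).boundary (C s ∪ C t))
    refine hmax _ (s1.mono Finset.inter_subset_left) (Finset.subset_inter s2 t2) ?_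
    change ((G' s).boundary (C s)).card ≤ _ at s4
    change ((G' t).boundary (C t)).card ≤ _ at t4
    omega
  -- If the boundary of `C s` contained that of `C₀`, the two would coincide by their sizes, against
  -- `hlive`.
  have hpick : ∀ s, ∃ v, s ∈ I → v ∈ G.boundary C₀ ∧ v ∉ (G' s).boundary (C s) := by
    intro s
    by_cases hs : s ∈ I
    · obtain ⟨s1, s2, s3, s4⟩ := hC s hs
      by_contra hcon
      push Not at hcon
      have hsub : G.boundary C₀ ⊆ (G' s).boundary (C s) := fun v hv => (hcon v).2 hv
      have := Finset.eq_of_subset_of_card_le hsub (s4.trans (hJ.2 C₀ hC₀ hbC₀))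
      exact hlive s hs (C s) s1 s2 s3 this.ge
    · exact ⟨s, fun h => absurd h hs⟩
  choose v hv using hpick
  refine (Finset.card_le_card_of_injOn v (fun s hs => (hv s hs).1) ?_).trans hC₀'
  intro s hs t ht hst
  by_contra hne
  -- Since `v s` is no longer a boundary vertex, all its neighbours outside `C₀` lie in `C s`. If `v
  -- s = v t`, they would lie in C s ∩ C t = C₀, which is absurd; so v is injective.
  have hmem : ∀ s ∈ I, ∀ w, w ∉ C₀ → G.Adj (v s) w → w ∈ C s := by
    intro s hs w hw hvw
    obtain ⟨s1, s2, s3, s4⟩ := hC s hs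
    by_contra hws
    have hv0 : v s ∈ C₀ := boundary_subset _ _ (hv s hs).1
    refine (hv s hs).2 (mem_boundary.2 ⟨s2 hv0, w, hws, hadj s hs _ w hvw fun he => ?_⟩)
    rw [Sym2.eq_iff] at he
    rcases he with ⟨he, -⟩ | ⟨he, -⟩
    · exact hIC s hs (he ▸ hv0)
    · exact hws (he ▸ s3)
  obtain ⟨-, w, hw, hvw⟩ := mem_boundary.1 (hv s hs).1
  have h1 := hmem s hs w hw hvw
  have h2 := hmem t ht w hw (by rw [← hst]; exact hvw)
  exact hw (hinter s hs t ht hne ▸ Finset.mem_inter.2 ⟨h1, h2⟩)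

/-- Either `N` starts are packable, or a set of at most `5 N` vertices cuts off every start. -/
theorem exists_packable_or_hitting (sp : F.Spread U h) (a b f : ι → V) {N : ℕ} (hN : 5 * N ≤ h) :
    (∃ J : Finset ι, J.card = N ∧ F.Packable U a b f J) ∨
      ∃ Z : Finset V, Z.card ≤ 5 * N ∧ ∀ x, a x ∉ Z → ∃ C, Small U C ∧ b x ∈ C ∧
        (F.deleteEdges {s(b x, f x)}).boundary C ⊆ Z := by
  classical
  by_contra hcon
  push Not at hcon
  obtain ⟨hno, hcut⟩ := hcon
  have h0 : ∃ J : Finset ι, J.card = 0 ∧ F.Packable U a b f J :=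
    ⟨∅, rfl, by simp [Packable]⟩
  have hmaxp := Nat.findGreatest_spec (P := fun p => ∃ J : Finset ι, J.card = p ∧
    F.Packable U a b f J) (n := N) (Nat.zero_le _) h0
  have hle := Nat.findGreatest_le (P := fun p => ∃ J : Finset ι, J.card = p ∧
    F.Packable U a b f J) N
  have hgt := fun k => Nat.findGreatest_is_greatest (P := fun p => ∃ J : Finset ι, J.card = p ∧
    F.Packable U a b f J) (k := k) (n := N)
  set p := Nat.findGreatest (fun p => ∃ J : Finset ι, J.card = p ∧ F.Packable U a b f J) N with hp
  obtain ⟨J, hJp, hJ⟩ := hmaxp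
  have hpN : p < N := lt_of_le_of_ne hle fun h => hno J (hJp.trans h) hJ
  have hnot : ∀ x, a x ∉ J.image a → ¬ F.Packable U a b f (insert x J) := by
    intro x hx hpk
    refine hgt (p + 1) (by omega) (by omega) ⟨_, ?_, hpk⟩
    rw [Finset.card_insert_of_notMem fun h => hx (Finset.mem_image_of_mem _ h), hJp]
  obtain ⟨C₀, hC₀, hbC₀, hC₀', hmax⟩ :=
    exists_maximal_boundary_le (b := b) (f := f) sp J (by omega)
  have hwit := fun x hxa hxb => exists_witness sp hJ (by omega) hC₀ hbC₀ hC₀' (x := x) hxa hxb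
    (hnot x hxa)
  set G := F.deleteEdges (pairs b f J : Set (Sym2 V)) with hG
  -- A start that is not live is cut off by `a(J)` or by the boundary of `C₀`, up to vertices of
  -- `b(J)`. The ends of live starts contain no |J| + 1 independent vertices, so the exchange
  -- argument captures them all in one set `Y`.
  let live : ι → Prop := fun x => a x ∉ J.image a ∧ b x ∉ C₀ ∧ ∀ D, Small U D → C₀ ⊆ D → b x ∈ D →
      ¬ (F.deleteEdges (pairs b f (insert x J) : Set (Sym2 V))).boundary D ⊆ G.boundary C₀
  have hind : G.IndepOver U C₀ J.card ∅ := by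
    intro Y hY h1 _
    simpa using hJ.2 Y hY (hbC₀.trans h1)
  obtain ⟨Y, hY, hY0, hYS, hYb⟩ : ∃ Y, Small U Y ∧ C₀ ⊆ Y ∧ (∀ x, live x → b x ∈ Y) ∧
      (G.boundary Y).card < J.card + (J.card + 1) := by
    rcases exists_indepOver sp (card_pairs_le b f J) (m := J.card + 1) (by omega) hC₀ hC₀' hind
      (Finset.univ.filter fun s => ∃ x, live x ∧ b x = s) with ⟨I, hIS, hIc, hI⟩ | ⟨Y, h1, h2, h3, h4⟩
    · exfalso
      have hx : ∀ s, ∃ x, s ∈ I → live x ∧ b x = s := by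
        intro s
        by_cases hs : s ∈ I
        · obtain ⟨-, x, hx⟩ := Finset.mem_filter.1 (hIS hs)
          exact ⟨x, fun _ => hx⟩
        · by_cases hne : Nonempty ι
          · exact ⟨hne.some, fun h => absurd h hs⟩
          · obtain ⟨s', hs'⟩ : I.Nonempty := by rw [← Finset.card_pos]; omega
            obtain ⟨-, x, hx⟩ := Finset.mem_filter.1 (hIS hs')
            exact ⟨x, fun h => absurd h hs⟩
      choose x hx using hx
      have hC : ∀ s, ∃ C : Finset V, s ∈ I → Small U C ∧ C₀ ⊆ C ∧ s ∈ C ∧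
          ((F.deleteEdges (pairs b f (insert (x s) J) : Set (Sym2 V))).boundary C).card
            ≤ J.card := by
        intro s
        by_cases hs : s ∈ I
        · obtain ⟨⟨l1, l2, -⟩, l4⟩ := hx s hs
          obtain ⟨C, hC⟩ := hwit (x s) l1 l2
          exact ⟨C, fun _ => by rwa [l4] at hC⟩
        · exact ⟨∅, fun h => absurd h hs⟩
      choose C hC using hC
      have := card_le_of_witnesses sp hJ hC₀ hbC₀ hC₀' hmax hI (by omega) (fun s hs => (hx s hs).2)
        (fun s hs => (hx s hs).2 ▸ (hx s hs).1.2.1) hC (by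
          intro s hs D h1 h2 h3
          exact (hx s hs).1.2.2 D h1 h2 ((hx s hs).2.symm ▸ h3))
      omega
    · exact ⟨Y, h1, h2, fun x hx => h3 (by simpa using ⟨x, hx, rfl⟩), h4⟩
  have hcJ : (J.image a).card ≤ p := Finset.card_image_le.trans hJp.le
  have hcJ' : (J.image b).card ≤ p := Finset.card_image_le.trans hJp.le
  -- The first three sets have at most p = |J| elements each and the boundary of `Y` has at most 2p:
  -- in total 5p ≤ 5N.
  obtain ⟨x, hxZ, hxc⟩ := hcut (J.image a ∪ (J.image b ∪ (G.boundary C₀ ∪ G.boundary Y))) (by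
    have h1 := Finset.card_union_le (J.image a) (J.image b ∪ (G.boundary C₀ ∪ G.boundary Y))
    have h2 := Finset.card_union_le (J.image b) (G.boundary C₀ ∪ G.boundary Y)
    have h3 := Finset.card_union_le (G.boundary C₀) (G.boundary Y)
    omega)
  simp only [Finset.mem_union, not_or] at hxZ
  -- Restoring the pairs of `J` adds only vertices `b j` to the boundary, because `b j` lies in C₀ ⊆
  -- D. This is why `b(J)` belongs to the hitting set.
  have htrans : ∀ D, C₀ ⊆ D → ∀ v, v ∈ (F.deleteEdges {s(b x, f x)}).boundary D →
      v ∈ (F.deleteEdges (pairs b f (insert x J) : Set (Sym2 V))).boundary D ∨ v ∈ J.image b := by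
    intro D hD v hv
    obtain ⟨hv, w, hw, hvw⟩ := mem_boundary.1 hv
    rw [deleteEdges_adj] at hvw
    by_cases he : ∃ j ∈ J, s(b j, f j) = s(v, w)
    · obtain ⟨j, hj, he⟩ := he
      right
      have hbj : b j ∈ J.image b := Finset.mem_image_of_mem _ hj
      rw [Sym2.eq_iff] at he
      rcases he with ⟨he, -⟩ | ⟨he, -⟩
      · exact he ▸ hbj
      · exact absurd (hD (hbC₀ (he ▸ hbj))) hw
    · left
      push Not at he
      refine mem_boundary.2 ⟨hv, w, hw, ?_⟩
      rw [deleteEdges_pairs_adj]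
      refine ⟨hvw.1, fun j hj => ?_⟩
      rcases Finset.mem_insert.1 hj with rfl | hj
      · intro h; exact hvw.2 (by simp [h])
      · exact he j hj
  have hmono : ∀ D, (F.deleteEdges (pairs b f (insert x J) : Set (Sym2 V))).boundary D ⊆
      G.boundary D := fun D => boundary_mono (deleteEdges_pairs_anti F (Finset.subset_insert _ _)) D
  by_cases hx0 : b x ∈ C₀
  · refine hxc C₀ hC₀ hx0 fun v hv => ?_
    simp only [Finset.mem_union]
    rcases htrans C₀ subset_rfl v hv with h1 | h1
    · exact Or.inr (Or.inr (Or.inl (hmono _ h1)))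
    · exact Or.inr (Or.inl h1)
  by_cases hlive : live x
  · refine hxc Y hY (hYS x hlive) fun v hv => ?_
    simp only [Finset.mem_union]
    rcases htrans Y hY0 v hv with h1 | h1
    · exact Or.inr (Or.inr (Or.inr (hmono _ h1)))
    · exact Or.inr (Or.inl h1)
  · simp only [live, not_and, not_forall, not_not] at hlive
    obtain ⟨D, h1, h2, h3, h4⟩ := hlive hxZ.1 hx0
    refine hxc D h1 h3 fun v hv => ?_
    simp only [Finset.mem_union]
    rcases htrans D h2 v hv with h5 | h5
    · exact Or.inr (Or.inr (Or.inl (h4 h5)))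
    · exact Or.inr (Or.inl h5)

end Packing

end SimpleGraph

/-! ### Linking independent sets. -/

namespace SimpleGraph

section Linking

variable {V : Type*} [DecidableEq V] [Fintype V]

open scoped Classical in
/-- `Z` together with the vertices that can be reached from `S` by walks avoiding `Z`. -/
noncomputable def reachAvoiding (G : SimpleGraph V) (S Z : Finset V) : Finset V :=
  Finset.univ.filter fun v => v ∈ Z ∨ ∃ s ∈ S, ∃ p : G.Walk s v, ∀ z ∈ p.support, z ∉ Z

lemma mem_reachAvoiding {G : SimpleGraph V} {S Z : Finset V} {v : V} :
    v ∈ G.reachAvoiding S Z ↔ v ∈ Z ∨ ∃ s ∈ S, ∃ p : G.Walk s v, ∀ z ∈ p.support, z ∉ Z := by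
  simp [reachAvoiding]

lemma subset_reachAvoiding (G : SimpleGraph V) (S Z : Finset V) : S ⊆ G.reachAvoiding S Z := by
  intro s hs
  by_cases hsZ : s ∈ Z
  · exact mem_reachAvoiding.2 (Or.inl hsZ)
  · exact mem_reachAvoiding.2 (Or.inr ⟨s, hs, Walk.nil, by simpa using hsZ⟩)

lemma boundary_reachAvoiding (G : SimpleGraph V) (S Z : Finset V) :
    G.boundary (G.reachAvoiding S Z) ⊆ Z := by
  intro v hv
  obtain ⟨hv, w, hw, hvw⟩ := mem_boundary.1 hv
  by_contra hvZ
  obtain ⟨s, hs, p, hp⟩ := (mem_reachAvoiding.1 hv).resolve_left hvZ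
  have hwZ : w ∉ Z := fun h => hw (mem_reachAvoiding.2 (Or.inl h))
  refine hw (mem_reachAvoiding.2 (Or.inr ⟨s, hs, p.concat hvw, fun z hz => ?_⟩))
  rw [Walk.support_concat, List.mem_append, List.mem_singleton] at hz
  rcases hz with hz | rfl
  · exact hp z hz
  · exact hwZ

variable {F : SimpleGraph V} {U : Finset V} {h : ℕ}

/-- Two independent sets of size `k` are linked by `k` disjoint paths. -/
lemma linked_of_indepOver (sp : F.Spread U h) {E : Finset (Sym2 V)} {k q : ℕ} (hE : E.card ≤ q)
    (hh : k + q ≤ h) {S T : Finset V} (hSk : S.card = k) (hTk : T.card = k)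
    (hS : (F.deleteEdges (E : Set (Sym2 V))).IndepOver U ∅ 0 S)
    (hT : (F.deleteEdges (E : Set (Sym2 V))).IndepOver U ∅ 0 T) :
    (F.deleteEdges (E : Set (Sym2 V))).Linked S T k := by
  set G := F.deleteEdges (E : Set (Sym2 V)) with hG
  refine linked_of_forall_separates G S T k fun Z hZ => ?_
  by_contra hcon
  push Not at hcon
  have hbd : ∀ R, (G.boundary (G.reachAvoiding R Z)).card ≤ k := fun R =>
    (Finset.card_le_card (boundary_reachAvoiding G R Z)).trans hcon.le
  -- By independence the set reachable from `R` is not small, since its boundary lies in `Z`; so it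
  -- misses at most h vertices of `U`. As |U| > 4h, the sets for `S` and `T` share a vertex outside
  -- `Z`, and so `Z` does not separate.
  have key : ∀ R : Finset V, R.card = k → G.IndepOver U ∅ 0 R →
      (U \ G.reachAvoiding R Z).card ≤ h := by
    intro R hRk hR
    refine sp.card_sdiff_le (fun hsm => ?_) (card_boundary_le hE (hbd R) hh)
    have h1 := hR _ hsm (by simp) (subset_reachAvoiding G R Z)
    have h2 := Finset.card_le_card (boundary_reachAvoiding G R Z)
    omega
  have h1 := key S hSk hS
  have h2 := key T hTk hT
  have hsub : U ⊆ ((U \ G.reachAvoiding S Z) ∪ (U \ G.reachAvoiding T Z)) ∪ Z := by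
    intro u hu
    by_contra hcon
    simp only [Finset.mem_union, Finset.mem_sdiff, hu, true_and, not_or, not_not] at hcon
    obtain ⟨⟨huS, huT⟩, huZ⟩ := hcon
    obtain ⟨s, hs, p, hp⟩ := (mem_reachAvoiding.1 huS).resolve_left huZ
    obtain ⟨t, ht, r, hr⟩ := (mem_reachAvoiding.1 huT).resolve_left huZ
    obtain ⟨z, hz, hzp⟩ := hZ s hs t ht (p.append r.reverse)
    rw [Walk.mem_support_append_iff, Walk.support_reverse, List.mem_reverse] at hzp
    exact hzp.elim (fun h => hp z h hz) (fun h => hr z h hz)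
  have h3 := Finset.card_le_card hsub
  have h4 := Finset.card_union_le ((U \ G.reachAvoiding S Z) ∪ (U \ G.reachAvoiding T Z)) Z
  have h5 := Finset.card_union_le (U \ G.reachAvoiding S Z) (U \ G.reachAvoiding T Z)
  have := sp.card_gt
  omega

/-- From a packable set of starts one can select `k` that stay independent after the deletion of
few further edges. -/
lemma Packable.exists_indepOver (sp : F.Spread U h) {ι : Type*} {a b f : ι → V}
    {J : Finset ι} (hJ : F.Packable U a b f J) {E : Finset (Sym2 V)} {k q : ℕ} (hE : E.card ≤ q)
    (hk : k + q ≤ J.card) (hh : k + (J.card + q) ≤ h) :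
    ∃ K ⊆ J, K.card = k ∧ (K.image b).card = k ∧
      (F.deleteEdges (pairs b f J ∪ E : Finset (Sym2 V))).IndepOver U ∅ 0 (K.image b) := by
  classical
  have hE' : (pairs b f J ∪ E).card ≤ J.card + q :=
    (Finset.card_union_le _ _).trans (add_le_add (card_pairs_le _ _ _) hE)
  rcases SimpleGraph.exists_indepOver sp hE' (C₀ := ∅) (p := 0) (m := k) (by omega)
    (sp.small_of_card (by simp)) (by simp [boundary]) (fun Y _ _ _ => by simp)
    (J.image b) with ⟨I, hI, hIk, hIi⟩ | ⟨Y, hY, -, hYb, hYc⟩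
  · obtain ⟨K, hKJ, hKI⟩ := Finset.subset_image_iff.1 hI
    have hinj : Set.InjOn b K :=
      (hJ.injOn sp (by omega)).mono hKJ
    have hKI' : K.image b = I := by
      ext; simp [← hKI]
    refine ⟨K, Finset.coe_subset.1 hKJ, ?_, ?_, ?_⟩
    · rw [← hIk, ← hKI', Finset.card_image_of_injOn hinj]
    · rw [hKI', hIk]
    · rwa [hKI']
  -- Restoring the edges of `E` leaves `Y` with fewer than k + q ≤ |J| boundary vertices, against
  -- packability.
  · exfalso
    have h1 := hJ.2 Y hY hYb
    have h2 := card_boundary_le_deleteEdges (F.deleteEdges (pairs b f J : Set (Sym2 V))) E Y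
    rw [deleteEdges_deleteEdges, ← Finset.coe_union] at h2
    omega

/-- Two packable families of starts contain `k` starts each that are linked. -/
theorem exists_linked (sp : F.Spread U h) {ι ι' : Type*} {a b f : ι → V} {a' b' f' : ι' → V}
    {J : Finset ι} {J' : Finset ι'} {k : ℕ} (hJ : F.Packable U a b f J)
    (hJ' : F.Packable U a' b' f' J') (hJk : J.card = 3 * k) (hJk' : J'.card = 2 * k)
    (hh : 6 * k ≤ h) :
    ∃ K ⊆ J, ∃ K' ⊆ J', (F.deleteEdges
      (pairs b f K ∪ pairs b' f' K' : Finset (Sym2 V))).Linked (K.image b) (K'.image b') k := by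
  classical
  -- `K` has to withstand the deletion of all 2k pairs of `J'`, but `K'` only that of the k pairs of
  -- `K`: hence the sizes 3k and 2k.
  obtain ⟨K, hK, hKc, hKb, hKi⟩ := hJ.exists_indepOver sp (E := pairs b' f' J') (k := k)
    (card_pairs_le _ _ _) (by omega) (by omega)
  obtain ⟨K', hK', hKc', hKb', hKi'⟩ := hJ'.exists_indepOver sp (E := pairs b f K) (k := k)
    (card_pairs_le _ _ _) (by omega) (by omega)
  refine ⟨K, hK, K', hK', ?_⟩
  have h1 : pairs b f K ∪ pairs b' f' K' ⊆ pairs b f J ∪ pairs b' f' J' :=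
    Finset.union_subset_union (Finset.image_subset_image hK) (Finset.image_subset_image hK')
  have h2 : pairs b f K ∪ pairs b' f' K' ⊆ pairs b' f' J' ∪ pairs b f K := by
    rw [Finset.union_comm]
    exact Finset.union_subset_union (Finset.image_subset_image hK') subset_rfl
  refine linked_of_indepOver sp (q := 2 * k) ?_ (by omega) hKb hKb'
    (hKi.of_le (deleteEdges_anti (Finset.coe_subset.2 h1)))
    (hKi'.of_le (deleteEdges_anti (Finset.coe_subset.2 h2)))
  have h3 := Finset.card_union_le (pairs b f K) (pairs b' f' K')
  have h4 := card_pairs_le b f K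
  have h5 := card_pairs_le b' f' K'
  omega

end Linking

end SimpleGraph

/-! ### Independent sets of sparse relations. -/

/-- A relation in which every element of `s` has at most `d` successors in `s` has an independent
set of size `m` in `s` if `s` has at least `(2 d + 1) m` elements. -/
lemma Finset.exists_independent_subset {ι : Type*} [DecidableEq ι] (r : ι → ι → Prop)
    [DecidableRel r] (d m : ℕ) (s : Finset ι) (hs : (2 * d + 1) * m ≤ s.card)
    (hr : ∀ i ∈ s, (s.filter (r i)).card ≤ d) :
    ∃ t ⊆ s, t.card = m ∧ ∀ i ∈ t, ∀ j ∈ t, i ≠ j → ¬ r i j := by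
  induction m generalizing s with
  | zero => exact ⟨∅, by simp, by simp, by simp⟩
  | succ m ih =>
    have hne : s.Nonempty := by
      rw [← Finset.card_pos]; nlinarith
    -- Out-degrees and in-degrees have the same sum, so some v has in-degree at most d. Discarding
    -- it with its neighbours costs at most 2d + 1 elements.
    obtain ⟨v, hv, hvd⟩ : ∃ v ∈ s, (s.filter fun i => r i v).card ≤ d := by
      by_contra hcon
      push Not at hcon
      have h1 : ∑ v ∈ s, (s.filter fun i => r i v).card = ∑ i ∈ s, (s.filter (r i)).card := by
        simp only [Finset.card_filter]
        rw [Finset.sum_comm]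
      have h2 := Finset.sum_le_sum hr
      have h3 := Finset.sum_lt_sum_of_nonempty hne hcon
      omega
    let s' := s.filter fun i => i ≠ v ∧ ¬ r i v ∧ ¬ r v i
    have hcover : s ⊆ s' ∪ ({v} ∪ ((s.filter fun i => r i v) ∪ s.filter (r v))) := by
      intro i hi
      simp only [s', Finset.mem_union, Finset.mem_filter, hi, true_and, Finset.mem_singleton]
      tauto
    have h1 := Finset.card_le_card hcover
    have h2 := Finset.card_union_le s' ({v} ∪ ((s.filter fun i => r i v) ∪ s.filter (r v)))
    have h3 := Finset.card_union_le {v} ((s.filter fun i => r i v) ∪ s.filter (r v))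
    have h4 := Finset.card_union_le (s.filter fun i => r i v) (s.filter (r v))
    have h5 := hr v hv
    rw [Finset.card_singleton] at h3
    have hs' : (2 * d + 1) * m ≤ s'.card := by
      rw [Nat.mul_succ] at hs
      omega
    obtain ⟨t, ht, htm, hti⟩ := ih s' hs' fun i hi =>
      (Finset.card_le_card (Finset.filter_subset_filter _ (Finset.filter_subset _ _))).trans
        (hr i (Finset.mem_filter.1 hi).1)
    have hvt : v ∉ t := fun h => (Finset.mem_filter.1 (ht h)).2.1 rfl
    refine ⟨insert v t, Finset.insert_subset hv (ht.trans (Finset.filter_subset _ _)), ?_, ?_⟩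
    · rw [Finset.card_insert_of_notMem hvt, htm]
    · intro i hi j hj hij
      rcases Finset.mem_insert.1 hi with hi' | hi' <;> rcases Finset.mem_insert.1 hj with hj' | hj'
      · exact absurd (hi'.trans hj'.symm) hij
      · exact hi' ▸ (Finset.mem_filter.1 (ht hj')).2.2.2
      · exact hj' ▸ (Finset.mem_filter.1 (ht hi')).2.2.1
      · exact hti i hi' j hj' hij

/-! ### Walks and `A`-paths in multigraphs. -/

namespace Graph

namespace Walk

variable {α ε Γ : Type*} {G H : Graph α ε} {u v w x y : α}

lemma start_mem_vertexSet (p : G.Walk u v) : u ∈ V(G) := by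
  cases p with
  | nil hu => exact hu
  | cons e h p => exact h.left_mem

lemma mem_vertexSet (p : G.Walk u v) (hx : x ∈ p.support) : x ∈ V(G) := by
  induction p with
  | nil hu =>
    rw [support, List.mem_singleton] at hx
    exact hx ▸ hu
  | cons e h p ih =>
    rw [support, List.mem_cons] at hx
    rcases hx with rfl | hx
    · exact h.left_mem
    · exact ih hx

lemma support_eq_cons (p : G.Walk u v) : p.support = u :: p.support.tail := by
  cases p <;> rfl

lemma support_nodup_iff_of_eq {p : G.Walk u v} {q : H.Walk x y} (h : p.support = q.support) :
    p.IsPath ↔ q.IsPath := by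
  rw [IsPath, IsPath, h]

/-- Concatenation of walks. -/
def append : ∀ {u v w : α}, G.Walk u v → G.Walk v w → G.Walk u w
  | _, _, _, nil _, q => q
  | _, _, _, cons e h p, q => cons e h (p.append q)

@[simp]
lemma edges_append (p : G.Walk u v) (q : G.Walk v w) :
    (p.append q).edges = p.edges ++ q.edges := by
  induction p with
  | nil _ => rfl
  | cons e h p ih => simp [append, edges, ih]

lemma support_append (p : G.Walk u v) (q : G.Walk v w) :
    (p.append q).support = p.support ++ q.support.tail := by
  induction p with
  | nil _ => rw [append, support, List.singleton_append, ← support_eq_cons]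
  | cons e h p ih => simp [append, support, ih]

lemma mem_support_append {p : G.Walk u v} {q : G.Walk v w} :
    x ∈ (p.append q).support ↔ x ∈ p.support ∨ x ∈ q.support := by
  rw [support_append, List.mem_append]
  nth_rw 2 [support_eq_cons q]
  rw [List.mem_cons]
  constructor
  · rintro (h | h) <;> simp [h]
  · rintro (h | rfl | h)
    · exact Or.inl h
    · exact Or.inl p.end_mem_support
    · exact Or.inr h

lemma append_assoc (p : G.Walk u v) (q : G.Walk v w) (r : G.Walk w x) :
    (p.append q).append r = p.append (q.append r) := by
  induction p with
  | nil _ => rfl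
  | cons e h p ih => simp [append, ih]

lemma mem_edgeSet (p : G.Walk u v) {e : ε} (he : e ∈ p.edges) : e ∈ E(G) := by
  induction p with
  | nil _ => simp [edges] at he
  | cons e' h p ih =>
    rw [edges, List.mem_cons] at he
    rcases he with rfl | he
    · exact h.edge_mem
    · exact ih he

lemma isPath_append {p : G.Walk u v} {q : G.Walk v w} :
    (p.append q).IsPath ↔ p.IsPath ∧ q.IsPath ∧ ∀ x ∈ p.support, x ∈ q.support → x = v := by
  unfold IsPath
  rw [support_append, List.nodup_append']
  have hq := support_eq_cons q
  constructor
  · rintro ⟨h1, h2, h3⟩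
    refine ⟨h1, ?_, fun x hx hxq => ?_⟩
    · rw [hq, List.nodup_cons]
      exact ⟨fun h => h3 p.end_mem_support h, h2⟩
    · rw [hq, List.mem_cons] at hxq
      exact hxq.resolve_right fun h => h3 hx h
  · rintro ⟨h1, h2, h3⟩
    rw [hq, List.nodup_cons] at h2
    refine ⟨h1, h2.2, fun x hx hxq => ?_⟩
    have := h3 x hx (by rw [hq]; exact List.mem_cons_of_mem _ hxq)
    exact h2.1 (this ▸ hxq)

/-- The reverse of a walk. -/
def reverse : ∀ {u v : α}, G.Walk u v → G.Walk v u
  | _, _, nil hu => nil hu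
  | _, _, cons e h p => p.reverse.append (cons e h.symm (nil h.left_mem))

@[simp]
lemma edges_reverse (p : G.Walk u v) : p.reverse.edges = p.edges.reverse := by
  induction p with
  | nil _ => rfl
  | cons e h p ih => simp [reverse, edges, ih]

@[simp]
lemma support_reverse (p : G.Walk u v) : p.reverse.support = p.support.reverse := by
  induction p with
  | nil _ => rfl
  | cons e h p ih => simp [reverse, support, support_append, ih]

lemma mem_support_reverse {p : G.Walk u v} : x ∈ p.reverse.support ↔ x ∈ p.support := by
  simp

lemma isPath_reverse {p : G.Walk u v} : p.reverse.IsPath ↔ p.IsPath := by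
  simp [IsPath]

section Weight

variable [AddCommGroup Γ] (γ : ε → Γ)

lemma weight_eq_of_edges_eq {p : G.Walk u v} {q : H.Walk x y} (h : p.edges = q.edges) :
    p.weight γ = q.weight γ := by
  rw [weight, weight, h]

@[simp]
lemma weight_append (p : G.Walk u v) (q : G.Walk v w) :
    (p.append q).weight γ = p.weight γ + q.weight γ := by
  simp [weight]

@[simp]
lemma weight_reverse (p : G.Walk u v) : p.reverse.weight γ = p.weight γ := by
  simp [weight, List.sum_reverse]

end Weight

/-- A walk may be regarded as a walk of another graph that contains its vertices and edges. -/
lemma exists_transfer (p : G.Walk u v) (hV : ∀ x ∈ p.support, x ∈ V(H))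
    (hE : ∀ e x y, x ∈ p.support → y ∈ p.support → G.IsLink e x y → H.IsLink e x y) :
    ∃ q : H.Walk u v, q.support = p.support ∧ q.edges = p.edges := by
  induction p with
  | nil hu => exact ⟨nil (hV _ (by simp [support])), rfl, rfl⟩
  | cons e h p ih =>
    obtain ⟨q, h1, h2⟩ := ih (fun x hx => hV x (List.mem_cons_of_mem _ hx))
      (fun e x y hx hy => hE e x y (List.mem_cons_of_mem _ hx) (List.mem_cons_of_mem _ hy))
    refine ⟨cons e (hE _ _ _ ?_ ?_ h) q, ?_, ?_⟩
    · simp [support]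
    · exact List.mem_cons_of_mem _ p.start_mem_support
    · simp [support, h1]
    · simp [edges, h2]

lemma exists_of_le (hGH : G ≤ H) (p : G.Walk u v) :
    ∃ q : H.Walk u v, q.support = p.support ∧ q.edges = p.edges :=
  p.exists_transfer (fun _ hx => hGH.vertexSet_mono (p.mem_vertexSet hx))
    fun _ _ _ _ _ h => h.mono hGH

lemma exists_induce {X : Set α} (p : G.Walk u v) (hX : ∀ x ∈ p.support, x ∈ X) :
    ∃ q : (G.induce X).Walk u v, q.support = p.support ∧ q.edges = p.edges :=
  p.exists_transfer hX fun _ _ _ hx hy h => ⟨h, hX _ hx, hX _ hy⟩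

lemma exists_deleteVerts {X : Set α} (p : G.Walk u v) (hX : ∀ x ∈ p.support, x ∉ X) :
    ∃ q : (G.deleteVerts X).Walk u v, q.support = p.support ∧ q.edges = p.edges :=
  p.exists_induce fun x hx => ⟨p.mem_vertexSet hx, hX x hx⟩

lemma notMem_of_deleteVerts {X : Set α} (p : (G.deleteVerts X).Walk u v) (hx : x ∈ p.support) :
    x ∉ X := by
  have := p.mem_vertexSet hx
  rw [vertexSet_deleteVerts] at this
  exact this.2

lemma exists_append_of_mem (p : G.Walk u v) (hx : x ∈ p.support) :
    ∃ (q : G.Walk u x) (r : G.Walk x v), p = q.append r := by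
  induction p with
  | nil hu =>
    rw [support, List.mem_singleton] at hx
    subst hx
    exact ⟨nil hu, nil hu, rfl⟩
  | @cons u w v e h p ih =>
    by_cases hxu : x = u
    · subst hxu
      exact ⟨nil h.left_mem, cons e h p, rfl⟩
    · rw [support, List.mem_cons] at hx
      obtain ⟨q, r, rfl⟩ := ih (hx.resolve_left hxu)
      exact ⟨cons e h q, r, rfl⟩

/-- A walk that meets `S` can be split at its first vertex in `S`. -/
lemma exists_first (p : G.Walk u v) {S : Set α} (hx : x ∈ p.support) (hxS : x ∈ S) :
    ∃ b ∈ S, ∃ (q : G.Walk u b) (r : G.Walk b v), p = q.append r ∧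
      ∀ y ∈ q.support, y ∈ S → y = b := by
  induction p with
  | nil hu =>
    rw [support, List.mem_singleton] at hx
    subst hx
    exact ⟨x, hxS, nil hu, nil hu, rfl, by simp [support]⟩
  | @cons u w v e h p ih =>
    by_cases hu : u ∈ S
    · exact ⟨u, hu, nil h.left_mem, cons e h p, rfl, by simp [support]⟩
    · rw [support, List.mem_cons] at hx
      obtain ⟨b, hb, q, r, rfl, hq⟩ := ih (hx.resolve_left fun h => hu (h ▸ hxS))
      refine ⟨b, hb, cons e h q, r, rfl, fun y hy hyS => ?_⟩
      rw [support, List.mem_cons] at hy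
      rcases hy with rfl | hy
      · exact absurd hyS hu
      · exact hq y hy hyS

/-- Every walk contains a path with the same ends. -/
lemma exists_isPath (p : G.Walk u v) :
    ∃ q : G.Walk u v, q.IsPath ∧ q.support ⊆ p.support := by
  induction p with
  | nil hu => exact ⟨nil hu, by simp [IsPath, support], by simp⟩
  | @cons u w v e h p ih =>
    obtain ⟨q, hq, hqp⟩ := ih
    by_cases hu : u ∈ q.support
    · obtain ⟨q1, q2, rfl⟩ := q.exists_append_of_mem hu
      exact ⟨q2, (isPath_append.1 hq).2.1, fun x hx =>
        List.mem_cons_of_mem _ (hqp (mem_support_append.2 (Or.inr hx)))⟩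
    · refine ⟨cons e h q, ?_, fun x hx => ?_⟩
      · rw [IsPath, support, List.nodup_cons]
        exact ⟨hu, hq⟩
      · rw [support, List.mem_cons] at hx ⊢
        exact hx.imp_right fun h => hqp h

lemma edges_ne_nil_of_ne (p : G.Walk u v) (huv : u ≠ v) : p.edges ≠ [] := by
  cases p with
  | nil hu => exact absurd rfl huv
  | cons e h p => simp [edges]

lemma IsPath.ne_of_edges_ne_nil {p : G.Walk u v} (hp : p.IsPath) (he : p.edges ≠ []) : u ≠ v := by
  rintro rfl
  cases p with
  | nil hu => simp [edges] at he
  | cons e h p =>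
    rw [IsPath, support, List.nodup_cons] at hp
    exact hp.1 p.end_mem_support

lemma isSetPath_iff {p : G.Walk u v} {A : Set α} :
    p.IsSetPath A ↔ p.IsPath ∧ u ≠ v ∧ u ∈ A ∧ v ∈ A ∧ ∀ x ∈ p.support, x ∈ A → x = u ∨ x = v := by
  constructor
  · rintro ⟨h1, h2, h3⟩
    exact ⟨h1, h1.ne_of_edges_ne_nil h2, (h3 u p.start_mem_support).2 (Or.inl rfl),
      (h3 v p.end_mem_support).2 (Or.inr rfl), fun x hx => (h3 x hx).1⟩
  · rintro ⟨h1, h2, h3, h4, h5⟩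
    refine ⟨h1, p.edges_ne_nil_of_ne h2, fun x hx => ⟨h5 x hx, ?_⟩⟩
    rintro (rfl | rfl) <;> assumption

lemma IsSetPath.reverse {p : G.Walk u v} {A : Set α} (h : p.IsSetPath A) :
    p.reverse.IsSetPath A := by
  rw [isSetPath_iff] at h ⊢
  obtain ⟨h1, h2, h3, h4, h5⟩ := h
  exact ⟨isPath_reverse.2 h1, h2.symm, h4, h3, fun x hx hxA =>
    (h5 x (mem_support_reverse.1 hx) hxA).symm⟩

lemma IsSetPath.of_support_edges {p : G.Walk u v} {q : H.Walk u v} {A : Set α}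
    (h : p.IsSetPath A) (hs : q.support = p.support) : q.IsSetPath A := by
  rw [isSetPath_iff] at h ⊢
  rwa [support_nodup_iff_of_eq hs, hs]

end Walk

end Graph

/-! ### Rows of a wall and the connectivity that the tangle provides. -/

namespace Graph

variable {α ε Γ : Type*}

/-- `x` and `y` are joined by a walk of `G` avoiding `Z`. -/
def Joined (G : Graph α ε) (Z : Set α) (x y : α) : Prop :=
  ∃ p : G.Walk x y, ∀ z ∈ p.support, z ∉ Z

namespace Joined

variable {G : Graph α ε} {Z : Set α} {x y z : α}

lemma refl (hx : x ∈ V(G)) (hxZ : x ∉ Z) : G.Joined Z x x :=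
  ⟨Walk.nil hx, by simpa [Walk.support] using hxZ⟩

lemma symm (h : G.Joined Z x y) : G.Joined Z y x := by
  obtain ⟨p, hp⟩ := h
  exact ⟨p.reverse, fun z hz => hp z (Walk.mem_support_reverse.1 hz)⟩

lemma trans (h : G.Joined Z x y) (h' : G.Joined Z y z) : G.Joined Z x z := by
  obtain ⟨p, hp⟩ := h
  obtain ⟨q, hq⟩ := h'
  exact ⟨p.append q, fun z hz => (Walk.mem_support_append.1 hz).elim (hp z) (hq z)⟩

lemma left_notMem (h : G.Joined Z x y) : x ∉ Z := by
  obtain ⟨p, hp⟩ := h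
  exact hp x p.start_mem_support

lemma left_mem (h : G.Joined Z x y) : x ∈ V(G) := by
  obtain ⟨p, hp⟩ := h
  exact p.start_mem_vertexSet

lemma right_mem (h : G.Joined Z x y) : y ∈ V(G) := h.symm.left_mem

lemma right_notMem (h : G.Joined Z x y) : y ∉ Z := h.symm.left_notMem

lemma step {e : ε} (h : G.Joined Z x y) (hl : G.IsLink e y z) (hz : z ∉ Z) : G.Joined Z x z := by
  refine h.trans ⟨Walk.cons e hl (Walk.nil hl.right_mem), fun w hw => ?_⟩
  simp only [Walk.support, List.mem_cons, List.not_mem_nil, or_false] at hw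
  rcases hw with rfl | rfl
  · exact h.right_notMem
  · exact hz

lemma of_mem_support {p : G.Walk x y} (hp : ∀ z ∈ p.support, z ∉ Z) (hz : z ∈ p.support) :
    G.Joined Z x z := by
  obtain ⟨q, r, rfl⟩ := p.exists_append_of_mem hz
  exact ⟨q, fun w hw => hp w (Walk.mem_support_append.2 (Or.inl hw))⟩

end Joined

/-- The inner vertices of an `A`-path lie together in `G - A`. -/
lemma Walk.IsSetPath.joined_deleteVerts {G : Graph α ε} {A Z : Set α} {u v x y : α} {p : G.Walk u v}
    (hp : p.IsSetPath A) (hZ : ∀ z ∈ p.support, z ∉ Z) (hx : x ∈ p.support) (hxA : x ∉ A)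
    (hy : y ∈ p.support) (hyA : y ∉ A) : (G.deleteVerts A).Joined Z x y := by
  have key : ∀ {x y : α} (q : G.Walk u x) (m : G.Walk x y) (r : G.Walk y v),
      p = q.append (m.append r) → x ∉ A → y ∉ A → (G.deleteVerts A).Joined Z x y := by
    intro x y q m r hpq hxA hyA
    rw [isSetPath_iff] at hp
    obtain ⟨h1, h2, h3, h4, h5⟩ := hp
    rw [hpq, isPath_append, isPath_append] at h1
    have hm : ∀ z ∈ m.support, z ∈ p.support := fun z hz => by
      rw [hpq]
      exact mem_support_append.2 (Or.inr (mem_support_append.2 (Or.inl hz)))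
    obtain ⟨m', hm', -⟩ := m.exists_deleteVerts (X := A) fun z hz hzA => by
      rcases h5 z (hm z hz) hzA with rfl | rfl
      · have := h1.2.2 z q.start_mem_support (mem_support_append.2 (Or.inl hz))
        exact hxA (this ▸ hzA)
      · have := h1.2.1.2.2 z hz r.end_mem_support
        exact hyA (this ▸ hzA)
    exact ⟨m', fun z hz => hZ z (hm z (hm' ▸ hz))⟩
  obtain ⟨q, r, hqr⟩ := p.exists_append_of_mem hx
  have hy' := hy
  rw [hqr, mem_support_append] at hy'
  rcases hy' with hy' | hy'
  · obtain ⟨q1, q2, rfl⟩ := q.exists_append_of_mem hy'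
    refine (key q1 q2 r ?_ hyA hxA).symm
    rw [hqr, Walk.append_assoc]
  · obtain ⟨r1, r2, rfl⟩ := r.exists_append_of_mem hy'
    exact key q r1 r2 hqr hxA hyA

/-- A zero `A`-path inside `A ∪ X` is a zero `A`-path of the subgraph induced on `A ∪ X`. -/
lemma hasZeroSetPath_induce [AddCommGroup Γ] {G : Graph α ε} {γ : ε → Γ} {A X : Set α} {u v : α}
    {p : G.Walk u v} (hp : p.IsZeroSetPath γ A) (hX : ∀ x ∈ p.support, x ∈ X) :
    (G.induce X).HasZeroSetPath γ A := by
  obtain ⟨q, hq, hqe⟩ := p.exists_induce hX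
  exact ⟨u, v, q, hp.1.of_support_edges hq, (Walk.weight_eq_of_edges_eq γ hqe).trans hp.2⟩

namespace Wall

variable {G : Graph α ε} {r s : ℕ}

/-- The vertex set of the `i`-th horizontal path of a wall. -/
def row (W : G.Wall r s) (i : ℕ) : Set α :=
  {x | ∃ (j : ℕ) (h : WallEdge r s (i, j) (i, j + 1)), x ∈ (W.link h).support}

lemma disjoint_row (W : G.Wall r s) {i i' : ℕ} (hi : i ≠ i') : Disjoint (W.row i) (W.row i') := by
  rw [Set.disjoint_left]
  rintro x ⟨j, h, hx⟩ ⟨j', h', hx'⟩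
  obtain ⟨b, hb, rfl⟩ := W.link_inter h h' (by simp [hi]) x hx hx'
  have h1 := W.branch_mem_link h b hb hx
  have h2 := W.branch_mem_link h' b hb hx'
  have h3 : b.1 = i := by rcases h1 with rfl | rfl <;> rfl
  have h4 : b.1 = i' := by rcases h2 with rfl | rfl <;> rfl
  exact hi (h3.symm.trans h4)

/-- The two deleted vertices of the grid lie in columns 1 and 2s + 2, so the columns between are
complete in every row. -/
lemma wallEdge_row {i j : ℕ} (hi : 1 ≤ i) (hi' : i ≤ r + 1) (hj : 2 ≤ j) (hj' : j ≤ 2 * s) :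
    WallEdge r s (i, j) (i, j + 1) := by
  have key : ∀ k, 2 ≤ k → k ≤ 2 * s + 1 → (i, k) ∈ wallVertices r s := by
    intro k h1 h2
    refine ⟨⟨hi, hi'⟩, ⟨by simp; omega, by simp; omega⟩, ?_, ?_⟩
    · simp; omega
    · simp only [ne_eq, Prod.mk.injEq, not_and]
      intro _
      split_ifs <;> omega
  exact ⟨key j hj (by omega), key (j + 1) (by omega) (by omega), Or.inl ⟨rfl, rfl⟩⟩

lemma row_nonempty (W : G.Wall r s) (hs : 1 ≤ s) {i : ℕ} (hi : 1 ≤ i) (hi' : i ≤ r + 1) :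
    (W.row i).Nonempty :=
  ⟨W.branch (i, 2), 2, wallEdge_row hi hi' le_rfl (by omega), Walk.start_mem_support _⟩

/-- Column 2 serves as base point because it is present in every row; only the link from column 1
has to be traversed backwards. -/
lemma joined_branch_of_mem_row (W : G.Wall r s) (hs : 1 ≤ s) {i : ℕ} (hi : 1 ≤ i) (hi' : i ≤ r + 1)
    {Z : Set α} (hZ : Disjoint (W.row i) Z) {x : α} (hx : x ∈ W.row i) :
    G.Joined Z (W.branch (i, 2)) x := by
  have hlink : ∀ j (h : WallEdge r s (i, j) (i, j + 1)), ∀ z ∈ (W.link h).support, z ∉ Z :=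
    fun j h z hz => Set.disjoint_left.1 hZ ⟨j, h, hz⟩
  have hbr : ∀ j, 2 ≤ j → j ≤ 2 * s + 1 → G.Joined Z (W.branch (i, 2)) (W.branch (i, j)) := by
    intro j h2
    induction j, h2 using Nat.le_induction with
    | base =>
      intro _
      have h := wallEdge_row (r := r) (s := s) hi hi' le_rfl (by omega)
      exact Joined.refl ((W.link h).start_mem_vertexSet) (hlink _ h _ (Walk.start_mem_support _))
    | succ j h2 ih =>
      intro h3
      have h := wallEdge_row (r := r) (s := s) hi hi' h2 (by omega)
      exact (ih (by omega)).trans ⟨W.link h, hlink _ h⟩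
  obtain ⟨j, h, hx⟩ := hx
  have hj1 : 1 ≤ j := h.1.2.1.1
  have hj2 : j + 1 ≤ 2 * s + 2 := h.2.1.2.1.2
  rcases hj1.eq_or_lt with rfl | hj1
  · have h1 := Joined.of_mem_support (p := (W.link h).reverse) (Z := Z) (z := x)
      (fun z hz => hlink _ h z (Walk.mem_support_reverse.1 hz)) (Walk.mem_support_reverse.2 hx)
    exact h1
  · exact (hbr j hj1 (by omega)).trans (Joined.of_mem_support (hlink _ h) hx)

lemma joined_of_mem_row (W : G.Wall r s) (hs : 1 ≤ s) {i : ℕ} (hi : 1 ≤ i) (hi' : i ≤ r + 1)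
    {Z : Set α} (hZ : Disjoint (W.row i) Z) {x y : α} (hx : x ∈ W.row i) (hy : y ∈ W.row i) :
    G.Joined Z x y :=
  (W.joined_branch_of_mem_row hs hi hi' hZ hx).symm.trans
    (W.joined_branch_of_mem_row hs hi hi' hZ hy)

/-- If `K` is a union of components of `G - Z` that misses a row, then `K` is on the small side of
the separation it defines. -/
lemma mem_tangle (W : G.Wall r r) {K Z : Set α} (hK : K ⊆ V(G)) (hZ : Z ⊆ V(G))
    (hZr : Z.encard ≤ r)
    (hKZ : ∀ e x y, x ∈ K → G.IsLink e x y → y ∉ Z → y ∈ K) {i : ℕ} (hi : 1 ≤ i) (hi' : i ≤ r + 1)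
    (hrow : Disjoint (W.row i) K) :
    (G.induce (K ∪ Z), G.induce (V(G) \ K)) ∈ W.tangle := by
  refine ⟨⟨induce_le (Set.union_subset hK hZ), induce_le Set.sdiff_subset, ?_, ?_⟩, ?_, i, hi, hi', ?_⟩
  · ext x
    simp only [vertexSet_induce, Set.mem_union, Set.mem_sdiff]
    constructor
    · rintro ((h | h) | h)
      exacts [hK h, hZ h, h.1]
    · tauto
  · ext e
    constructor
    · rintro (⟨x, y, h, -⟩ | ⟨x, y, h, -⟩) <;> exact h.edge_mem
    · intro he
      obtain ⟨x, y, h⟩ := exists_isLink_of_mem_edgeSet he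
      have h1 := hKZ e x y
      have h2 := hKZ e y x
      have h3 := h.left_mem
      have h4 := h.right_mem
      have h5 := h.symm
      by_cases hx : x ∈ K
      · exact Or.inl ⟨x, y, h, Or.inl hx, by_contra fun hy => hy (Or.inl (h1 hx h (fun hz => hy (Or.inr hz))))⟩
      · by_cases hy : y ∈ K
        · exact Or.inl ⟨x, y, h, by_contra fun hx => hx (Or.inl (h2 hy h5 (fun hz => hx (Or.inr hz)))), Or.inl hy⟩
        · exact Or.inr ⟨x, y, h, ⟨h3, hx⟩, h4, hy⟩
  · refine (Set.encard_le_encard ?_).trans hZr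
    simp only [vertexSet_induce]
    rintro x ⟨h1 | h1, h2⟩
    · exact absurd h1 h2.2
    · exact h1
  · intro j h
    have hsub : ∀ x ∈ (W.link h).support, x ∈ V(G) \ K := fun x hx =>
      ⟨(W.link h).mem_vertexSet hx, Set.disjoint_left.1 hrow ⟨j, h, hx⟩⟩
    refine ⟨hsub, fun e he => ?_⟩
    obtain ⟨q, -, hq⟩ := (W.link h).exists_induce hsub
    rw [← hq] at he
    exact q.mem_edgeSet he

section Tangle

/-- With respect to every separation in `𝒯`, the zero `A`-paths lie on the large side. -/
def _root_.Graph.Concentrated [AddCommGroup Γ] (G : Graph α ε) (γ : ε → Γ) (A : Set α)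
    (𝒯 : Set (Graph α ε × Graph α ε)) : Prop :=
  ∀ C D, (C, D) ∈ 𝒯 → ¬ (G.induce (A ∪ V(C))).HasZeroSetPath γ A ∧
    (G.induce (A ∪ (V(D) \ V(C)))).HasZeroSetPath γ A

variable [AddCommGroup Γ] {γ : ε → Γ} {A : Set α} {r : ℕ} (W : (G.deleteVerts A).Wall r r)

lemma closed_joined {H : Graph α ε} (Z : Set α) (x : α) (e : ε) (y z : α)
    (hy : y ∈ {y | H.Joined Z x y}) (hl : H.IsLink e y z) (hz : z ∉ Z) :
    z ∈ {y | H.Joined Z x y} :=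
  Joined.step hy hl hz

/-- A zero `A`-path that avoids a small set `Z` is joined in `(G - A) - Z` to every row that
avoids `Z`. -/
lemma exists_joined_row (hT : G.Concentrated γ A W.tangle) {u v : α} {p : G.Walk u v} (hp : p.IsZeroSetPath γ A) {Z : Set α}
    (hZ : Z ⊆ V(G.deleteVerts A)) (hZr : Z.encard ≤ r) (hpZ : ∀ z ∈ p.support, z ∉ Z) {x : α}
    (hx : x ∈ p.support) (hxA : x ∉ A) {i : ℕ} (hi : 1 ≤ i) (hi' : i ≤ r + 1) :
    ∃ y ∈ W.row i, (G.deleteVerts A).Joined Z x y := by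
  -- Otherwise the component of x in (G - A) - Z contains the whole path outside `A` and misses row
  -- i, so it lies on a small side that contains a zero `A`-path.
  by_contra hcon
  push Not at hcon
  refine (hT _ _ (W.mem_tangle (K := {y | (G.deleteVerts A).Joined Z x y})
    (fun y hy => hy.right_mem) hZ hZr (closed_joined Z x) hi hi' ?_)).1
    (hasZeroSetPath_induce hp fun z hz => ?_)
  · rw [Set.disjoint_left]
    exact hcon
  · by_cases hzA : z ∈ A
    · exact Or.inl hzA
    · exact Or.inr (Or.inl (hp.1.joined_deleteVerts hpZ hx hxA hz hzA))

/-- No separation of small order separates two rows that avoid the separator. -/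
lemma joined_of_mem_rows (hT : G.Concentrated γ A W.tangle) (hr : 1 ≤ r) {Z : Set α} (hZ : Z ⊆ V(G.deleteVerts A))
    (hZr : Z.encard ≤ r) {i j : ℕ} (hi : 1 ≤ i) (hi' : i ≤ r + 1) (hj : 1 ≤ j) (hj' : j ≤ r + 1)
    (hiZ : Disjoint (W.row i) Z) (hjZ : Disjoint (W.row j) Z) {x y : α} (hx : x ∈ W.row i)
    (hy : y ∈ W.row j) : (G.deleteVerts A).Joined Z x y := by
  by_contra hcon
  let K : Set α := {y | (G.deleteVerts A).Joined Z x y}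
  have h1 := W.mem_tangle (K := K) (Z := Z) (fun y hy => hy.right_mem) hZ hZr (closed_joined Z x)
    hj hj' (by
      rw [Set.disjoint_left]
      intro z hz hzK
      exact hcon (Joined.trans hzK (W.joined_of_mem_row hr hj hj' hjZ hz hy)))
  -- By `h1` the component `K` is on a small side, so (III) yields a zero `A`-path outside K ∪ Z. By
  -- `h2` the complement of `K` is a small side as well, and it contains that path.
  have h2 := W.mem_tangle (K := V(G.deleteVerts A) \ (K ∪ Z)) (Z := Z) Set.sdiff_subset hZ hZr (by
      rintro e a b ⟨ha, ha'⟩ hl hb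
      refine ⟨hl.right_mem, ?_⟩
      rintro (hb' | hb')
      · exact ha' (Or.inl (closed_joined Z x e b a hb' hl.symm fun h => ha' (Or.inr h)))
      · exact hb hb') hi hi' (by
      rw [Set.disjoint_left]
      rintro z hz ⟨-, hz'⟩
      exact hz' (Or.inl (W.joined_of_mem_row hr hi hi' hiZ hx hz)))
  obtain ⟨u, v, p, hp⟩ := (hT _ _ h1).2
  refine (hT _ _ h2).1 ?_
  have hsub : ∀ z ∈ p.support, z ∈ A ∪ V((G.deleteVerts A).induce
      (V(G.deleteVerts A) \ (K ∪ Z) ∪ Z)) := by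
    intro z hz
    rcases p.mem_vertexSet hz with h | ⟨⟨h3, h4⟩, h5⟩
    · exact Or.inl h
    · exact Or.inr (Or.inl ⟨h3, h5⟩)
  obtain ⟨q, hq, hqe⟩ := p.exists_transfer (H := G.induce (A ∪ V((G.deleteVerts A).induce
    (V(G.deleteVerts A) \ (K ∪ Z) ∪ Z)))) hsub
    fun e a b ha hb hl => ⟨hl.1, hsub a ha, hsub b hb⟩
  exact ⟨u, v, q, hp.1.of_support_edges hq, (Walk.weight_eq_of_edges_eq γ hqe).trans hp.2⟩

end Tangle

end Wall

end Graph

/-! ### Attachments of vertices to a 3-block. -/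

namespace Graph

variable {α ε : Type*} {H : Graph α ε} {B : Set α}

lemma joined_iff_nonempty_walk {X : Set α} {x y : α} :
    H.Joined X x y ↔ Nonempty ((H.deleteVerts X).Walk x y) := by
  constructor
  · rintro ⟨p, hp⟩
    obtain ⟨q, -⟩ := p.exists_deleteVerts hp
    exact ⟨q⟩
  · rintro ⟨q⟩
    obtain ⟨p, hp, -⟩ := q.exists_of_le deleteVerts_le
    exact ⟨p, fun z hz => q.notMem_of_deleteVerts (hp ▸ hz)⟩

lemma IsThreeBlock.subset (hB : H.IsThreeBlock B) : B ⊆ V(H) := hB.1.1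

lemma IsThreeBlock.joined (hB : H.IsThreeBlock B) {X : Set α} (hX : X.encard ≤ 2) {u v : α}
    (hu : u ∈ B) (hv : v ∈ B) (huX : u ∉ X) (hvX : v ∉ X) : H.Joined X u v := by
  have h := hB.1.2.2 (X ∩ V(H)) Set.inter_subset_right
    ((Set.encard_le_encard Set.inter_subset_left).trans hX) u ⟨hu, fun h => huX h.1⟩ v
    ⟨hv, fun h => hvX h.1⟩
  obtain ⟨p, hp⟩ := joined_iff_nonempty_walk.2 h
  exact ⟨p, fun z hz hzX => hp z hz ⟨hzX, p.mem_vertexSet hz⟩⟩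

/-- A vertex that cannot be separated from a 3-block by two vertices belongs to it. -/
lemma IsThreeBlock.mem_of_joined (hB : H.IsThreeBlock B) {c : α} (hc : c ∈ V(H))
    (h : ∀ X : Set α, X.encard ≤ 2 → c ∉ X → ∃ b ∈ B, H.Joined X c b) : c ∈ B := by
  refine hB.2 (y := insert c B) ⟨Set.insert_subset hc hB.subset,
    hB.1.2.1.trans (Set.encard_le_encard (Set.subset_insert _ _)), ?_⟩ (Set.subset_insert _ _)
    (Set.mem_insert _ _)
  rintro X - hX u ⟨hu, huX⟩ v ⟨hv, hvX⟩
  rw [← joined_iff_nonempty_walk]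
  have key : ∀ w ∈ insert c B, w ∉ X → ∃ b ∈ B, H.Joined X w b := by
    rintro w (rfl | hw) hwX
    · exact h X hX hwX
    · exact ⟨w, hw, Joined.refl (hB.subset hw) hwX⟩
  obtain ⟨b, hb, hub⟩ := key u hu huX
  obtain ⟨b', hb', hvb⟩ := key v hv hvX
  exact (hub.trans (hB.joined hX hb hb' hub.right_notMem hvb.right_notMem)).trans hvb.symm

/-- `v` is joined to the vertex `b` of `B` by a walk whose inner vertices are not in `B`. -/
def Attached (H : Graph α ε) (B : Set α) (v b : α) : Prop :=
  b ∈ B ∧ ∃ p : H.Walk v b, ∀ x ∈ p.support, x ∈ B → x = b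

/-- A vertex outside a 3-block is not the centre of a fan to three of its vertices. -/
lemma IsThreeBlock.mem_of_fan (hB : H.IsThreeBlock B) {c b₁ b₂ b₃ : α} (h₁ : b₁ ∈ B) (h₂ : b₂ ∈ B)
    (h₃ : b₃ ∈ B) (p₁ : H.Walk c b₁) (p₂ : H.Walk c b₂) (p₃ : H.Walk c b₃)
    (h₁₂ : ∀ x ∈ p₁.support, x ∈ p₂.support → x = c)
    (h₁₃ : ∀ x ∈ p₁.support, x ∈ p₃.support → x = c)
    (h₂₃ : ∀ x ∈ p₂.support, x ∈ p₃.support → x = c) : c ∈ B := by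
  refine hB.mem_of_joined p₁.start_mem_vertexSet fun X hX hcX => ?_
  by_contra hcon
  push Not at hcon
  -- The three legs share only c, which is not in `X`, so meeting all of them takes three vertices.
  have key : ∀ b ∈ B, ∀ p : H.Walk c b, ∃ x ∈ X, x ∈ p.support := by
    intro b hb p
    by_contra h
    push Not at h
    exact hcon b hb ⟨p, fun z hz hzX => h z hzX hz⟩
  obtain ⟨x, hx, hxp⟩ := key _ h₁ p₁
  obtain ⟨y, hy, hyp⟩ := key _ h₂ p₂
  obtain ⟨z, hz, hzp⟩ := key _ h₃ p₃
  have hne : ∀ w ∈ X, w ≠ c := fun w hw h => hcX (h ▸ hw)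
  have hxy : x ≠ y := fun h => hne x hx (h₁₂ x hxp (h ▸ hyp))
  have hxz : x ≠ z := fun h => hne x hx (h₁₃ x hxp (h ▸ hzp))
  have hyz : y ≠ z := fun h => hne y hy (h₂₃ y hyp (h ▸ hzp))
  have h3 : ({x, y, z} : Set α).encard = 3 := Set.encard_eq_three.2 ⟨x, y, z, hxy, hxz, hyz, rfl⟩
  have h4 : ({x, y, z} : Set α).encard ≤ X.encard := Set.encard_le_encard (by
    rintro w (rfl | rfl | rfl) <;> assumption)
  rw [h3] at h4
  exact absurd (h4.trans hX) (by decide)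

/-- A path to `b₃` that starts on the first leg of a path from `b₁` to `b₂` through `c₁` yields
a fan. -/
lemma IsThreeBlock.mem_of_tripod (hB : H.IsThreeBlock B) {c c₁ b₁ b₂ b₃ : α} (h₁ : b₁ ∈ B)
    (h₂ : b₂ ∈ B) (h₃ : b₃ ∈ B) (p₁ : H.Walk c₁ b₁) (p₂ : H.Walk c₁ b₂) (hp₁ : p₁.IsPath)
    (h₁₂ : ∀ x ∈ p₁.support, x ∈ p₂.support → x = c₁) (q : H.Walk b₃ c) (hc : c ∈ p₁.support)
    (hq₁ : ∀ x ∈ q.support, x ∈ p₁.support → x = c)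
    (hq₂ : ∀ x ∈ q.support, x ∈ p₂.support → x = c) : c ∈ B := by
  obtain ⟨u, w, rfl⟩ := p₁.exists_append_of_mem hc
  rw [Walk.isPath_append] at hp₁
  refine hB.mem_of_fan h₁ h₂ h₃ w (u.reverse.append p₂) q.reverse ?_ ?_ ?_
  · intro x hx hx'
    rw [Walk.mem_support_append, Walk.mem_support_reverse] at hx'
    rcases hx' with hx' | hx'
    · exact hp₁.2.2 x hx' hx
    · have := h₁₂ x (Walk.mem_support_append.2 (Or.inr hx)) hx'
      subst this
      exact hp₁.2.2 x u.start_mem_support hx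
  · intro x hx hx'
    exact hq₁ x (Walk.mem_support_reverse.1 hx') (Walk.mem_support_append.2 (Or.inr hx))
  · intro x hx hx'
    rw [Walk.mem_support_reverse] at hx'
    rw [Walk.mem_support_append, Walk.mem_support_reverse] at hx
    rcases hx with hx | hx
    · exact hq₁ x hx' (Walk.mem_support_append.2 (Or.inl hx))
    · exact hq₂ x hx' hx

/-- A vertex outside a 3-block is attached to at most two of its vertices. -/
theorem IsThreeBlock.eq_or_eq_of_attached (hB : H.IsThreeBlock B) {v b₁ b₂ b₃ : α}
    (h₁ : H.Attached B v b₁) (h₂ : H.Attached B v b₂) (h₃ : H.Attached B v b₃) :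
    b₁ = b₂ ∨ b₁ = b₃ ∨ b₂ = b₃ := by
  by_contra hcon
  push Not at hcon
  obtain ⟨h12, h13, h23⟩ := hcon
  obtain ⟨hb₁, p₁, hp₁⟩ := h₁
  obtain ⟨hb₂, p₂, hp₂⟩ := h₂
  obtain ⟨hb₃, p₃, hp₃⟩ := h₃
  obtain ⟨p₁', hpath₁, hsub₁⟩ := p₁.exists_isPath
  obtain ⟨p₂', hpath₂, hsub₂⟩ := p₂.exists_isPath
  replace hp₁ : ∀ x ∈ p₁'.support, x ∈ B → x = b₁ := fun x hx => hp₁ x (hsub₁ hx)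
  replace hp₂ : ∀ x ∈ p₂'.support, x ∈ B → x = b₂ := fun x hx => hp₂ x (hsub₂ hx)
  -- `c₁` is where the path from `b₂` first meets the path to `b₁`; the legs from `c₁` to `b₁` and
  -- `b₂` meet only there.
  obtain ⟨c₁, hc₁, q, r, hqr, hq⟩ := p₂'.reverse.exists_first (S := {x | x ∈ p₁'.support})
    (Walk.end_mem_support _) p₁'.start_mem_support
  have hqsub : ∀ x ∈ q.support, x ∈ p₂'.support := fun x hx => by
    rw [← Walk.mem_support_reverse, hqr]
    exact Walk.mem_support_append.2 (Or.inl hx)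
  have hqpath : q.IsPath := by
    have := Walk.isPath_reverse.2 hpath₂
    rw [hqr, Walk.isPath_append] at this
    exact this.1
  have hc₁B : c₁ ∉ B := fun h => h12 ((hp₁ c₁ hc₁ h).symm.trans (hp₂ c₁ (hqsub _ q.end_mem_support) h))
  obtain ⟨s, t, rfl⟩ := p₁'.exists_append_of_mem hc₁
  rw [Walk.isPath_append] at hpath₁
  have hsB : ∀ x ∈ s.support, x ∉ B := by
    intro x hx hxB
    have h1 := hp₁ x (Walk.mem_support_append.2 (Or.inl hx)) hxB
    subst h1
    have := hpath₁.2.2 x hx t.end_mem_support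
    exact hc₁B (this ▸ hxB)
  have ht : ∀ x ∈ t.support, x ∈ B → x = b₁ := fun x hx =>
    hp₁ x (Walk.mem_support_append.2 (Or.inr hx))
  have htq : ∀ x ∈ t.support, x ∈ q.reverse.support → x = c₁ := fun x hx hx' =>
    hq x (Walk.mem_support_reverse.1 hx') (Walk.mem_support_append.2 (Or.inr hx))
  -- Go from `b₃` back to v and on to `c₁`. The first vertex c on a leg is the centre of a fan, so
  -- it lies in `B`; but then it equals `b₃` and also the end of that leg.
  obtain ⟨c, hc, q₃, r₃, hqr₃, hq₃⟩ := ((s.reverse.append p₃).reverse).exists_first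
    (S := {x | x ∈ t.support ∨ x ∈ q.reverse.support}) (Walk.end_mem_support _)
    (Or.inl t.start_mem_support)
  have hq₃B : ∀ x ∈ q₃.support, x ∈ B → x = b₃ := by
    intro x hx hxB
    have h1 : x ∈ (s.reverse.append p₃).reverse.support := by
      rw [hqr₃]; exact Walk.mem_support_append.2 (Or.inl hx)
    rw [Walk.mem_support_reverse, Walk.mem_support_append, Walk.mem_support_reverse] at h1
    rcases h1 with h1 | h1
    · exact absurd hxB (hsB x h1)
    · exact hp₃ x h1 hxB
  have hqB : ∀ x ∈ q.reverse.support, x ∈ B → x = b₂ := fun x hx =>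
    hp₂ x (hqsub x (Walk.mem_support_reverse.1 hx))
  rcases hc with hc | hc
  · have hcB := hB.mem_of_tripod hb₁ hb₂ hb₃ t q.reverse hpath₁.2.1 htq q₃ hc
      (fun x hx hx' => hq₃ x hx (Or.inl hx')) (fun x hx hx' => hq₃ x hx (Or.inr hx'))
    exact h13 ((ht c hc hcB).symm.trans (hq₃B c q₃.end_mem_support hcB))
  · have hcB := hB.mem_of_tripod hb₂ hb₁ hb₃ q.reverse t (Walk.isPath_reverse.2 hqpath)
      (fun x hx hx' => htq x hx' hx) q₃ hc
      (fun x hx hx' => hq₃ x hx (Or.inr hx')) (fun x hx hx' => hq₃ x hx (Or.inl hx'))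
    exact h23 ((hqB c hc hcB).symm.trans (hq₃B c q₃.end_mem_support hcB))

end Graph

/-! ### Potentials for edge labels. -/

namespace SimpleGraph

variable {V Γ : Type*}

/-- This is the degenerate case of closing a path by an edge: no cycle arises, but one edge is
traversed twice. -/
lemma Walk.edges_eq_singleton_of_mem {F : SimpleGraph V} {u v : V} {q : F.Walk v u}
    (hq : q.IsPath) (h : s(u, v) ∈ q.edges) : q.edges = [s(u, v)] := by
  cases q with
  | nil => simp at h
  | @cons _ x _ h' q =>
    rw [Walk.cons_isPath_iff] at hq
    rw [Walk.edges_cons, List.mem_cons] at h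
    rcases h with h | h
    · have hx : u = x := by
        rw [Sym2.eq_iff] at h
        rcases h with ⟨rfl, rfl⟩ | ⟨rfl, -⟩
        · exact absurd rfl h'.ne
        · rfl
      subst hx
      rw [(Walk.isPath_iff_nil.1 hq.1).eq_nil]
      simp [Sym2.eq_swap]
    · exact absurd (q.snd_mem_support_of_mem_edges h) hq.2

section Potential

variable {F : SimpleGraph V} [AddCommGroup Γ] {L : Sym2 V → Γ}

/-- Each detour that `bypass` removes is a cycle or runs back and forth along one edge. The sum
vanishes by `hc` or by `hL`. -/
lemma Walk.sum_edges_bypass [DecidableEq V] (hL : ∀ e ∈ F.edgeSet, L e + L e = 0)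
    (hc : ∀ (u : V) (c : F.Walk u u), c.IsCycle → (c.edges.map L).sum = 0) {u v : V}
    (p : F.Walk u v) : (p.edges.map L).sum = (p.bypass.edges.map L).sum := by
  induction p with
  | nil => rfl
  | @cons u v w h p ih =>
    rw [Walk.edges_cons, List.map_cons, List.sum_cons, ih, Walk.bypass]
    split_ifs with hu
    · have hpath : (p.bypass.takeUntil u hu).IsPath := (p.bypass_isPath).takeUntil hu
      have key : L s(u, v) + ((p.bypass.takeUntil u hu).edges.map L).sum = 0 := by
        by_cases he : s(u, v) ∈ (p.bypass.takeUntil u hu).edges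
        · rw [Walk.edges_eq_singleton_of_mem hpath he]
          simpa using hL _ (F.mem_edgeSet.2 h)
        · simpa using hc u _ ((Walk.cons_isCycle_iff _ h).2 ⟨hpath, he⟩)
      conv_lhs => rw [← p.bypass.take_spec hu]
      rw [Walk.edges_append, List.map_append, List.sum_append, ← add_assoc, key, zero_add]
    · rw [Walk.edges_cons, List.map_cons, List.sum_cons]

lemma Walk.sum_edges_eq_zero (hL : ∀ e ∈ F.edgeSet, L e + L e = 0)
    (hc : ∀ (u : V) (c : F.Walk u u), c.IsCycle → (c.edges.map L).sum = 0) {u : V}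
    (p : F.Walk u u) : (p.edges.map L).sum = 0 := by
  classical
  rw [p.sum_edges_bypass hL hc, (Walk.isPath_iff_nil.1 p.bypass_isPath).eq_nil]
  rfl

/-- Labels of order two whose sums along cycles vanish are given by a potential. -/
lemma exists_potential (hL : ∀ e ∈ F.edgeSet, L e + L e = 0)
    (hc : ∀ (u : V) (c : F.Walk u u), c.IsCycle → (c.edges.map L).sum = 0) :
    ∃ φ : V → Γ, (∀ v, φ v + φ v = 0) ∧ ∀ u v, F.Adj u v → L s(u, v) = φ u + φ v := by
  have hw : ∀ v, Nonempty (F.Walk (F.connectedComponentMk v).out v) := fun v =>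
    ConnectedComponent.exact (Quot.out_eq (F.connectedComponentMk v))
  let w := fun v => (hw v).some
  have h2 : ∀ v, ((w v).edges.map L).sum + ((w v).edges.map L).sum = 0 := by
    intro v
    have key : ∀ l : List (Sym2 V), (∀ e ∈ l, e ∈ F.edgeSet) →
        (l.map L).sum + (l.map L).sum = 0 := by
      intro l hl
      induction l with
      | nil => simp
      | cons e l ih =>
        have h1 := hL e (hl e List.mem_cons_self)
        have h2 := ih fun e he => hl e (List.mem_cons_of_mem _ he)
        rw [List.map_cons, List.sum_cons, add_add_add_comm, h1, h2, add_zero]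
    exact key _ fun e he => (w v).edges_subset_edgeSet he
  -- The potential of v is the sum along a fixed walk from the representative of its component. Two
  -- such walks and the edge uv form a closed walk of sum zero.
  refine ⟨fun v => ((w v).edges.map L).sum, h2, fun u v huv => ?_⟩
  have hcomp : F.connectedComponentMk u = F.connectedComponentMk v :=
    ConnectedComponent.sound huv.reachable
  have h := Walk.sum_edges_eq_zero hL hc
    (((w u).append (Walk.cons huv Walk.nil)).append ((w v).reverse.copy rfl (by rw [hcomp])))
  simp only [Walk.edges_append, Walk.edges_copy, Walk.edges_reverse, List.map_append,
    List.map_reverse, List.sum_append, List.sum_reverse, Walk.edges_cons, Walk.edges_nil,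
    List.map_cons, List.map_nil, List.sum_cons, List.sum_nil, add_zero] at h
  have h3 := h2 u
  have h4 := h2 v
  change L s(u, v) = ((w u).edges.map L).sum + ((w v).edges.map L).sum
  generalize ((w u).edges.map L).sum = a at *
  generalize ((w v).edges.map L).sum = b at *
  have : L s(u, v) = (a + a) + (b + b) - (a + b) := by
    rw [eq_sub_iff_add_eq, h3, h4, add_zero, ← h]
    abel
  rw [this]
  abel

end Potential

/-- In a graph that two vertices do not disconnect, the ends of an edge are joined by two further
internally disjoint paths. -/
lemma exists_two_paths [Finite V] {F : SimpleGraph V} {S : Set V} (hS : 4 ≤ S.encard)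
    (hF : ∀ u v, F.Adj u v → u ∈ S)
    (hconn : ∀ X : Finset V, X.card ≤ 2 → ∀ x ∈ S, ∀ y ∈ S, x ∉ X → y ∉ X →
      ∃ p : F.Walk x y, ∀ z ∈ p.support, z ∉ X) {u v : V} (huv : F.Adj u v) :
    ∃ p q : F.Walk u v, p.IsPath ∧ q.IsPath ∧ s(u, v) ∉ p.edges ∧ s(u, v) ∉ q.edges ∧
      ∀ x ∈ p.support, x ∈ q.support → x = u ∨ x = v := by
  classical
  have := Fintype.ofFinite V
  -- Two disjoint paths of `F'` between the remaining neighbours of u and of v extend to the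
  -- required paths, since `F'` isolates u and v.
  let F' : SimpleGraph V := F.deleteIncidenceSet u ⊓ F.deleteIncidenceSet v
  have hF' : ∀ x y, F'.Adj x y ↔ F.Adj x y ∧ x ≠ u ∧ x ≠ v ∧ y ≠ u ∧ y ≠ v := by
    intro x y
    simp only [F', inf_adj, deleteIncidenceSet_adj]
    tauto
  have havoid : ∀ {x y : V} (p : F'.Walk x y), x ≠ u → x ≠ v →
      ∀ z ∈ p.support, z ≠ u ∧ z ≠ v := by
    intro x y p hx hx'
    induction p with
    | nil => simpa using ⟨hx, hx'⟩
    | cons h p ih =>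
      have h' := (hF' _ _).1 h
      intro z hz
      rw [Walk.support_cons, List.mem_cons] at hz
      rcases hz with rfl | hz
      · exact ⟨hx, hx'⟩
      · exact ih h'.2.2.2.1 h'.2.2.2.2 z hz
  -- Removing b and at most one vertex of `Z` does not separate a from w. The first step of the path
  -- leads to a neighbour other than b, and the rest stays in `F'`.
  have hreach : ∀ a b, (a = u ∧ b = v ∨ a = v ∧ b = u) → ∀ Z : Finset V, Z.card ≤ 1 →
      ∀ w ∈ S, w ∉ Z → w ≠ u → w ≠ v →
      ∃ x, F.Adj a x ∧ x ≠ b ∧ ∃ p : F'.Walk x w, ∀ z ∈ p.support, z ∉ Z := by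
    intro a b hab Z hZ w hw hwZ hwu hwv
    have hadj : F.Adj a b := by
      rcases hab with ⟨rfl, rfl⟩ | ⟨rfl, rfl⟩
      exacts [huv, huv.symm]
    obtain ⟨p, hp⟩ := hconn (insert b (Z.erase a)) ((Finset.card_insert_le _ _).trans
      (by have := Finset.card_erase_le (s := Z) (a := a); omega)) a (hF _ _ hadj) w hw
      (by simp [hadj.ne]) (by
        rw [Finset.mem_insert, Finset.mem_erase]
        rintro (rfl | h)
        · rcases hab with ⟨rfl, rfl⟩ | ⟨rfl, rfl⟩ <;> contradiction
        · exact hwZ h.2)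
    have hq := p.bypass_isPath
    have hqp : ∀ z ∈ p.bypass.support, z ∉ insert b (Z.erase a) := fun z hz =>
      hp z (p.support_bypass_subset_support hz)
    generalize p.bypass = q at hq hqp
    cases q with
    | nil => rcases hab with ⟨rfl, rfl⟩ | ⟨rfl, rfl⟩ <;> contradiction
    | @cons _ x _ h q =>
      rw [Walk.cons_isPath_iff] at hq
      have hq' : ∀ z ∈ q.support, z ≠ a ∧ z ≠ b ∧ z ∉ Z := by
        intro z hz
        have h1 : z ≠ a := fun h => hq.2 (h ▸ hz)
        have h2 := hqp z (List.mem_cons_of_mem _ hz)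
        rw [Finset.mem_insert, Finset.mem_erase] at h2
        tauto
      have hq'' : ∀ z ∈ q.support, z ≠ u ∧ z ≠ v := by
        intro z hz
        have := hq' z hz
        rcases hab with ⟨rfl, rfl⟩ | ⟨rfl, rfl⟩
        exacts [⟨this.1, this.2.1⟩, ⟨this.2.1, this.1⟩]
      refine ⟨x, h, (hq' x q.start_mem_support).2.1, q.transfer F' ?_, fun z hz => ?_⟩
      · intro e he
        induction e with
        | h y z =>
          have hy := hq'' y (q.fst_mem_support_of_mem_edges he)
          have hz := hq'' z (q.snd_mem_support_of_mem_edges he)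
          exact (hF' _ _).2 ⟨q.adj_of_mem_edges he, hy.1, hy.2, hz⟩
      · rw [Walk.support_transfer] at hz
        exact (hq' z hz).2.2
  have hmenger := F'.linked_of_forall_separates (Finset.univ.filter fun x => F.Adj u x ∧ x ≠ v)
    (Finset.univ.filter fun x => F.Adj v x ∧ x ≠ u) 2 (by
      intro Z hZ
      by_contra hcard
      have hcard' : Z.card ≤ 1 := by omega
      -- Here |S| ≥ 4 matters: some vertex remains besides u, v and the separator, and both
      -- neighbourhoods reach it.
      obtain ⟨w, hw, hwZ⟩ : ∃ w ∈ S, w ∉ ((insert u (insert v Z) : Finset V) : Set V) := by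
        by_contra h
        push Not at h
        have h1 := hS.trans (Set.encard_le_encard (t := ((insert u (insert v Z) : Finset V) : Set V)) h)
        rw [Set.encard_coe_eq_coe_finsetCard] at h1
        have h2 : (insert u (insert v Z)).card ≤ 3 :=
          (Finset.card_insert_le _ _).trans (by have := Finset.card_insert_le v Z; omega)
        have h3 : 4 ≤ (insert u (insert v Z)).card := by exact_mod_cast h1
        omega
      simp only [Finset.coe_insert, Set.mem_insert_iff, Finset.mem_coe, not_or] at hwZ
      obtain ⟨x, hx, hxv, p, hp⟩ := hreach u v (Or.inl ⟨rfl, rfl⟩) Z hcard' w hw hwZ.2.2 hwZ.1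
        hwZ.2.1
      obtain ⟨y, hy, hyu, q, hq⟩ := hreach v u (Or.inr ⟨rfl, rfl⟩) Z hcard' w hw hwZ.2.2 hwZ.1
        hwZ.2.1
      obtain ⟨z, hz, hzp⟩ := hZ x (by simp [hx, hxv]) y (by simp [hy, hyu]) (p.append q.reverse)
      rw [Walk.mem_support_append_iff, Walk.support_reverse, List.mem_reverse] at hzp
      exact hzp.elim (fun h => hp z h hz) (fun h => hq z h hz))
  obtain ⟨f, g, P, hP, hdisj⟩ := hmenger
  have hle : F' ≤ F := fun x y h => ((hF' x y).1 h).1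
  have key : ∀ i, ∃ p : F.Walk u v, p.IsPath ∧ s(u, v) ∉ p.edges ∧
      ∀ x ∈ p.support, x = u ∨ x = v ∨ x ∈ (P i).support := by
    intro i
    obtain ⟨hf, hg, hpath, -⟩ := hP i
    simp only [Finset.mem_filter, Finset.mem_univ, true_and] at hf hg
    have hav := havoid (P i) hf.1.ne' hf.2
    have hsupp : ((P i).mapLe hle).support = (P i).support := by simp
    refine ⟨Walk.cons hf.1 (((P i).mapLe hle).concat hg.1.symm), ?_, ?_, ?_⟩
    · rw [Walk.cons_isPath_iff, Walk.concat_isPath_iff, Walk.support_concat, hsupp]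
      refine ⟨⟨(Walk.isPath_mapLe hle).2 hpath, fun h => (hav v h).2 rfl⟩, ?_⟩
      simp only [List.mem_append, List.mem_singleton, not_or]
      exact ⟨fun h => (hav u h).1 rfl, huv.ne⟩
    · rw [Walk.edges_cons, Walk.edges_concat, List.concat_eq_append, List.mem_cons,
        List.mem_append, List.mem_singleton]
      rintro (h | h | h)
      · rw [Sym2.eq_iff] at h
        rcases h with ⟨-, h⟩ | ⟨h, -⟩
        · exact hf.2 h.symm
        · exact hf.1.ne h
      · have := Walk.fst_mem_support_of_mem_edges _ h
        rw [hsupp] at this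
        exact (hav u this).1 rfl
      · rw [Sym2.eq_iff] at h
        rcases h with ⟨h, -⟩ | ⟨h, -⟩
        · exact hg.2 h.symm
        · exact huv.ne h
    · intro x hx
      rw [Walk.support_cons, Walk.support_concat, hsupp, List.mem_cons,
        List.mem_append, List.mem_singleton] at hx
      tauto
  obtain ⟨p, hp, hpe, hps⟩ := key 0
  obtain ⟨q, hq, hqe, hqs⟩ := key 1
  refine ⟨p, q, hp, hq, hpe, hqe, fun x hx hx' => ?_⟩
  have h1 := hdisj 0 1 (by decide)
  rcases hps x hx with h | h | h
  · exact Or.inl h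
  · exact Or.inr h
  · rcases hqs x hx' with h' | h' | h'
    · exact Or.inl h'
    · exact Or.inr h'
    · exact absurd h' (h1 h)

/-- If all cycles of a graph have weight zero whichever of the possible labels is chosen for each
edge, and no two vertices disconnect the graph, then the labels are given by a potential. -/
lemma exists_potential_of_labels [Finite V] {Γ : Type*} [AddCommGroup Γ] {F : SimpleGraph V}
    {S : Set V} (hS : 4 ≤ S.encard) (hF : ∀ u v, F.Adj u v → u ∈ S)
    (hconn : ∀ X : Finset V, X.card ≤ 2 → ∀ x ∈ S, ∀ y ∈ S, x ∉ X → y ∉ X →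
      ∃ p : F.Walk x y, ∀ z ∈ p.support, z ∉ X) (Λ : Sym2 V → Set Γ)
    (hne : ∀ e ∈ F.edgeSet, (Λ e).Nonempty)
    (hc : ∀ L : Sym2 V → Γ, (∀ e ∈ F.edgeSet, L e ∈ Λ e) →
      ∀ (u : V) (c : F.Walk u u), c.IsCycle → (c.edges.map L).sum = 0) :
    ∃ φ : V → Γ, (∀ v, φ v + φ v = 0) ∧
      ∀ u v, F.Adj u v → ∀ g ∈ Λ s(u, v), g = φ u + φ v := by
  classical
  obtain ⟨L, hL⟩ : ∃ L : Sym2 V → Γ, ∀ e ∈ F.edgeSet, L e ∈ Λ e :=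
    ⟨fun e => if h : (Λ e).Nonempty then h.some else 0, fun e he => by
      simp only [hne e he, dif_pos]
      exact (hne e he).some_mem⟩
  -- Let P and Q be the sums along the two further paths. Then g + P, g + Q and P + Q all vanish, so
  -- g = -P = -Q is determined and 2g = -(P + Q) = 0.
  have key : ∀ u v, F.Adj u v → ∀ g ∈ Λ s(u, v), g + g = 0 ∧ g = L s(u, v) := by
    intro u v huv
    obtain ⟨p, q, hp, hq, hpe, hqe, hpq⟩ := exists_two_paths hS hF hconn huv
    have h1 : ∀ g ∈ Λ s(u, v), ∀ r : F.Walk u v, r.IsPath → s(u, v) ∉ r.edges →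
        g + (r.edges.map L).sum = 0 := by
      intro g hg r hr hre
      have h := hc (Function.update L s(u, v) g) (by
        intro e he
        by_cases h : e = s(u, v)
        · subst h
          simpa using hg
        · rw [Function.update_of_ne h]
          exact hL e he) v (Walk.cons huv.symm r)
          ((Walk.cons_isCycle_iff _ huv.symm).2 ⟨hr, by rwa [Sym2.eq_swap]⟩)
      rw [Walk.edges_cons, List.map_cons, List.sum_cons, Sym2.eq_swap, Function.update_self] at h
      rw [← h]
      congr 2
      refine List.map_congr_left fun e he => ?_
      rw [Function.update_of_ne]
      rintro rfl
      exact hre (by rwa [Sym2.eq_swap])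
    have h2 : (p.edges.map L).sum + (q.edges.map L).sum = 0 := by
      have hlen : 1 < p.length := by
        rcases p with _ | ⟨h, _ | ⟨h', p⟩⟩
        · exact absurd rfl huv.ne
        · simp at hpe
        · simp
      have h := hc L hL u (p.append q.reverse) (hp.isCycle_append hq.reverse (by
        intro x hx hx'
        have hx1 : x ≠ u := by
          rintro rfl
          have := hp.support_nodup
          rw [← p.cons_tail_support, List.nodup_cons] at this
          exact this.1 hx
        have hx2 : x ≠ v := by
          rintro rfl
          have := hq.reverse.support_nodup
          rw [← q.reverse.cons_tail_support, List.nodup_cons] at this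
          exact this.1 hx'
        rcases hpq x (List.mem_of_mem_tail hx) (by simpa using List.mem_of_mem_tail hx') with h | h
        exacts [hx1 h, hx2 h]) (Or.inl hlen))
      simpa [List.sum_reverse] using h
    have h3 : ∀ g ∈ Λ s(u, v), g = -(p.edges.map L).sum := fun g hg =>
      eq_neg_of_add_eq_zero_left (h1 g hg p hp hpe)
    have h4 : ∀ g ∈ Λ s(u, v), g = -(q.edges.map L).sum := fun g hg =>
      eq_neg_of_add_eq_zero_left (h1 g hg q hq hqe)
    refine fun g hg => ⟨?_, (h3 g hg).trans (h3 _ (hL _ huv)).symm⟩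
    nth_rw 1 [h3 g hg]
    rw [h4 g hg, ← neg_add, h2, neg_zero]
  have hL2 : ∀ e ∈ F.edgeSet, L e + L e = 0 := by
    intro e
    induction e with
    | h u v => exact fun he => (key u v he _ (hL _ he)).1
  obtain ⟨φ, h1, h2⟩ := exists_potential hL2 (hc L hL)
  exact ⟨φ, h1, fun u v huv g hg => (key u v huv g hg).2.trans (h2 u v huv)⟩

end SimpleGraph

/-! ### The torso and the potential of a bipartite 3-block. -/

namespace Graph

variable {α ε Γ : Type*} {H : Graph α ε} {B : Set α}

/-- The torso of `B`: two vertices of `B` are adjacent if they are the ends of a `B`-path. -/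
def torso (H : Graph α ε) (B : Set α) : SimpleGraph α where
  Adj x y := ∃ p : H.Walk x y, p.IsSetPath B
  symm := ⟨fun _ _ ⟨p, hp⟩ => ⟨p.reverse, hp.reverse⟩⟩
  loopless := ⟨fun _ ⟨_, hp⟩ => (Walk.isSetPath_iff.1 hp).2.1 rfl⟩

lemma torso_adj {x y : α} : (H.torso B).Adj x y ↔ ∃ p : H.Walk x y, p.IsSetPath B := Iff.rfl

lemma mem_of_torso_adj {x y : α} (h : (H.torso B).Adj x y) : x ∈ B := by
  obtain ⟨p, hp⟩ := h
  exact (Walk.isSetPath_iff.1 hp).2.2.1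

/-- A nontrivial path between vertices of `B` begins with a `B`-path. -/
lemma Walk.IsPath.exists_isSetPath_append {u v : α} {p : H.Walk u v} (hp : p.IsPath) (hu : u ∈ B)
    (hv : v ∈ B) (huv : u ≠ v) : ∃ (b : α) (q : H.Walk u b) (r : H.Walk b v),
      p = q.append r ∧ q.IsSetPath B ∧ r.IsPath ∧ r.edges.length < p.edges.length := by
  cases p with
  | nil => exact absurd rfl huv
  | cons e h p =>
    obtain ⟨b, hb, q, r, rfl, hq⟩ := p.exists_first p.end_mem_support hv
    rw [IsPath, support, List.nodup_cons] at hp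
    have hpath := isPath_append.1 hp.2
    have hu' : u ∉ q.support := fun h => hp.1 (mem_support_append.2 (Or.inl h))
    refine ⟨b, cons e h q, r, rfl, ?_, hpath.2.1, ?_⟩
    · rw [isSetPath_iff]
      refine ⟨?_, fun h => hu' (h ▸ q.end_mem_support), hu, hb, fun x hx hxB => ?_⟩
      · rw [IsPath, support, List.nodup_cons]
        exact ⟨hu', hpath.1⟩
      · rw [support, List.mem_cons] at hx
        exact hx.imp_right fun h => hq x h hxB
    · simp only [edges, edges_append, List.length_cons, List.length_append]
      omega

/-- Induction along a path between vertices of `B`, one `B`-path at a time. -/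
lemma Walk.IsPath.induction_isSetPath {motive : α → Prop} {u v : α} {p : H.Walk u v}
    (hp : p.IsPath) (hu : u ∈ B) (hv : v ∈ B)
    (step : ∀ x y (q : H.Walk x y), q.IsSetPath B → q.support ⊆ p.support → motive x → motive y)
    (h : motive u) : motive v := by
  induction hn : p.edges.length using Nat.strong_induction_on generalizing u p with
  | h n ih =>
    by_cases huv : u = v
    · exact huv ▸ h
    · obtain ⟨b, q, r, rfl, hq, hr, hlt⟩ := hp.exists_isSetPath_append hu hv huv
      refine ih _ (hn ▸ hlt) hr (isSetPath_iff.1 hq).2.2.2.1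
        (fun x y q' hq' hsub => step x y q' hq' fun z hz => mem_support_append.2 (Or.inr (hsub hz)))
        (step u b q hq (fun z hz => mem_support_append.2 (Or.inl hz)) h) rfl

/-- Cut the path at its vertices in `B`: each intermediate potential occurs twice and cancels
because 2φ = 0. -/
lemma Walk.IsPath.weight_eq_of_potential [AddCommGroup Γ] {γ : ε → Γ} {φ : α → Γ}
    (h2 : ∀ v, φ v + φ v = 0)
    (hφ : ∀ u v (p : H.Walk u v), p.IsSetPath B → p.weight γ = φ u + φ v) {u v : α}
    {p : H.Walk u v} (hp : p.IsPath) (hu : u ∈ B) (hv : v ∈ B) : p.weight γ = φ u + φ v := by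
  induction hn : p.edges.length using Nat.strong_induction_on generalizing u p with
  | h n ih =>
    by_cases huv : u = v
    · subst huv
      rw [h2]
      by_contra h
      exact hp.ne_of_edges_ne_nil (fun he => h (by rw [weight, he]; rfl)) rfl
    · obtain ⟨b, q, r, rfl, hq, hr, hlt⟩ := hp.exists_isSetPath_append hu hv huv
      rw [weight_append, hφ _ _ q hq, ih _ (hn ▸ hlt) hr (isSetPath_iff.1 hq).2.2.2.1 rfl]
      rw [add_assoc, ← add_assoc (φ b), h2, zero_add]

lemma Joined.exists_isPath {Z : Set α} {u v : α} (h : H.Joined Z u v) :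
    ∃ p : H.Walk u v, p.IsPath ∧ ∀ z ∈ p.support, z ∉ Z := by
  obtain ⟨p, hp⟩ := h
  obtain ⟨q, hq, hqp⟩ := p.exists_isPath
  exact ⟨q, hq, fun z hz => hp z (hqp hz)⟩

lemma Joined.exists_torso_walk {Z : Set α} {u v : α} (h : H.Joined Z u v) (hu : u ∈ B)
    (hv : v ∈ B) : ∃ p : (H.torso B).Walk u v, ∀ z ∈ p.support, z ∉ Z := by
  obtain ⟨p, hp, hpZ⟩ := h.exists_isPath
  refine hp.induction_isSetPath (motive := fun x => ∃ p : (H.torso B).Walk u x,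
    ∀ z ∈ p.support, z ∉ Z) hu hv ?_ ⟨SimpleGraph.Walk.nil, by simpa using h.left_notMem⟩
  rintro x y q hq hsub ⟨r, hr⟩
  refine ⟨r.concat (torso_adj.2 ⟨q, hq⟩), fun z hz => ?_⟩
  rw [SimpleGraph.Walk.support_concat, List.mem_append,
    List.mem_singleton] at hz
  rcases hz with hz | rfl
  · exact hr z hz
  · exact hpZ _ (hsub q.end_mem_support)

lemma exists_blockGraph_walk [AddCommGroup Γ] {γ : ε → Γ} {L : Sym2 α → Γ}
    (hL : ∀ e ∈ (H.torso B).edgeSet,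
      ∃ (u v : α) (p : H.Walk u v), s(u, v) = e ∧ p.IsSetPath B ∧ p.weight γ = L e)
    {u v : α} (p : (H.torso B).Walk u v) (hu : u ∈ B) :
    ∃ q : (H.blockGraph γ B).Walk u v, q.support = p.support ∧
      q.edges = p.edges.map fun e => (e, L e) := by
  induction p with
  | nil => exact ⟨Walk.nil hu, rfl, rfl⟩
  | @cons u v w h p ih =>
    obtain ⟨q, h1, h2⟩ := ih (mem_of_torso_adj h.symm)
    exact ⟨Walk.cons (s(u, v), L s(u, v)) ⟨rfl, hL _ h⟩ q, by simp [Walk.support, h1],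
      by simp [Walk.edges, h2]⟩

/-- The labels of a labelled 3-block that is `Γ`-bipartite are given by a potential. -/
theorem IsThreeBlock.exists_potential [Finite α] [AddCommGroup Γ] {γ : ε → Γ}
    (hB : H.IsThreeBlock B) (hcard : 4 ≤ B.encard)
    (hbip : (H.blockGraph γ B).IsGroupBipartite Prod.snd) :
    ∃ φ : α → Γ, (∀ v, φ v + φ v = 0) ∧
      ∀ u v (p : H.Walk u v), p.IsSetPath B → p.weight γ = φ u + φ v := by
  obtain ⟨φ, h1, h2⟩ := SimpleGraph.exists_potential_of_labels (F := H.torso B) hcard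
    (fun u v h => mem_of_torso_adj h)
    (fun X hX x hx y hy hxX hyX => (hB.joined (X := X)
      (by rw [Set.encard_coe_eq_coe_finsetCard]; exact_mod_cast hX) hx hy hxX hyX).exists_torso_walk
        hx hy)
    -- Every weight of a `B`-path with these ends is admitted as a label. Whichever labels are
    -- chosen, a torso cycle lifts to a cycle of the labelled 3-block.
    (fun e => {g | ∃ (u v : α) (p : H.Walk u v), s(u, v) = e ∧ p.IsSetPath B ∧ p.weight γ = g})
    (by
      intro e
      induction e with
      | h u v => exact fun ⟨p, hp⟩ => ⟨_, u, v, p, rfl, hp, rfl⟩)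
    (by
      intro L hL u c hc
      have hu : u ∈ B := by
        cases c with
        | nil => exact absurd rfl hc.ne_nil
        | cons h c => exact mem_of_torso_adj h
      obtain ⟨q, hq1, hq2⟩ := exists_blockGraph_walk hL c hu
      have h := hbip u q ⟨?_, ?_, ?_⟩
      · rw [Walk.weight, hq2, List.map_map] at h
        exact h
      · rw [hq2]
        cases c with
        | nil => exact absurd rfl hc.ne_nil
        | cons h c => simp
      · rw [hq2]
        exact hc.edges_nodup.map fun e e' h => (Prod.ext_iff.1 h).1
      · rw [hq1]
        exact hc.support_nodup)
  exact ⟨φ, h1, fun u v p hp => (h2 u v ⟨p, hp⟩ _ ⟨u, v, p, rfl, hp, rfl⟩)⟩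

end Graph

/-! ### The large 3-block meets all rows; transversals are spread. -/

lemma Set.encard_le_two_of_forall {α : Type*} {s : Set α}
    (h : ∀ a ∈ s, ∀ b ∈ s, ∀ c ∈ s, a = b ∨ a = c ∨ b = c) : s.encard ≤ 2 := by
  by_contra hcon
  have h3 : 3 ≤ s.encard := by
    have := Order.add_one_le_of_lt (not_le.1 hcon)
    exact this
  obtain ⟨t, ht, ht3⟩ := Set.exists_subset_encard_eq h3
  obtain ⟨a, b, c, hab, hac, hbc, rfl⟩ := Set.encard_eq_three.1 ht3
  rcases h a (ht (by simp)) b (ht (by simp)) c (ht (by simp)) with h | h | h <;> contradiction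

namespace SimpleGraph

lemma Walk.mem_of_boundary {V : Type*} [Fintype V] [DecidableEq V] {F : SimpleGraph V}
    {C : Finset V} {x y : V} (p : F.Walk x y) (hx : x ∈ C)
    (hp : ∀ z ∈ p.support, z ∉ F.boundary C) : y ∈ C := by
  induction p with
  | nil => exact hx
  | @cons u v w h p ih =>
    refine ih ?_ fun z hz => hp z (List.mem_cons_of_mem _ hz)
    by_contra hv
    exact hp u (List.mem_cons_self) (mem_boundary.2 ⟨hx, v, hv, h⟩)

end SimpleGraph

namespace Graph

variable {α ε Γ : Type*} {H : Graph α ε} {B : Set α}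

lemma IsThreeBlock.encard_attached_le (hB : H.IsThreeBlock B) (v : α) :
    {b | H.Attached B v b}.encard ≤ 2 :=
  Set.encard_le_two_of_forall fun _ ha _ hb _ hc => hB.eq_or_eq_of_attached ha hb hc

lemma Joined.attached {x y b : α} {e : ε} (h : H.Joined B x y) (hl : H.IsLink e y b) (hb : b ∈ B) :
    H.Attached B x b := by
  obtain ⟨p, hp⟩ := h
  refine ⟨hb, p.append (Walk.cons e hl (Walk.nil hl.right_mem)), fun z hz hzB => ?_⟩
  rw [Walk.mem_support_append] at hz
  rcases hz with hz | hz
  · exact absurd hzB (hp z hz)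
  · simp only [Walk.support, List.mem_cons, List.not_mem_nil, or_false] at hz
    rcases hz with rfl | rfl
    · exact absurd hzB (hp _ p.end_mem_support)
    · rfl

namespace Wall

variable {r : ℕ}

/-- The large 3-block meets every horizontal path of the wall. -/
lemma exists_mem_row_inter (W : H.Wall r r) (hr : 2 ≤ r) (hB : H.IsLargeThreeBlock W.tangle B)
    {i : ℕ} (hi : 1 ≤ i) (hi' : i ≤ r + 1) : ∃ x ∈ W.row i, x ∈ B := by
  by_contra hcon
  push Not at hcon
  have hdisj : Disjoint (W.row i) B := Set.disjoint_left.2 hcon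
  obtain ⟨x, hx⟩ := W.row_nonempty (by omega) hi hi'
  -- The component of H - B that contains the row has at most two attachments. They give a
  -- separation of order at most 2 ≤ r with `B` on the small side.
  let K : Set α := {y | H.Joined B x y}
  let N : Set α := {b | H.Attached B x b}
  refine hB.2 _ _ (W.mem_tangle (K := V(H) \ (K ∪ N)) (Z := N) Set.sdiff_subset
    (fun b hb => hB.1.subset hb.1) ((hB.1.encard_attached_le x).trans (by exact_mod_cast hr)) ?_
    hi hi' ?_) ?_
  · rintro e a b ⟨ha, haKN⟩ hl hb
    refine ⟨hl.right_mem, ?_⟩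
    rintro (hbK | hbN)
    · by_cases haB : a ∈ B
      · exact haKN (Or.inr (Joined.attached hbK hl.symm haB))
      · exact haKN (Or.inl (Joined.step hbK hl.symm haB))
    · exact hb hbN
  · rw [Set.disjoint_left]
    rintro z hz ⟨-, hz'⟩
    exact hz' (Or.inl (W.joined_of_mem_row (by omega) hi hi' hdisj hx hz))
  · intro b hb
    rw [vertexSet_induce]
    by_cases hbN : b ∈ N
    · exact Or.inr hbN
    · refine Or.inl ⟨hB.1.subset hb, ?_⟩
      rintro (h | h)
      · exact h.right_notMem hb
      · exact hbN h

/-- Rows are disjoint, so each vertex of `Z` spoils at most one of them. -/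
lemma exists_row_disjoint (W : H.Wall r r) {I : Finset ℕ} {Z : Finset α} (h : Z.card < I.card) :
    ∃ i ∈ I, Disjoint (W.row i) (Z : Set α) := by
  by_contra hcon
  push Not at hcon
  have : ∀ i ∈ I, ∃ z ∈ Z, z ∈ W.row i := fun i hi => by
    obtain ⟨z, hz, hz'⟩ := Set.not_disjoint_iff.1 (hcon i hi)
    exact ⟨z, hz', hz⟩
  obtain ⟨i₀, hi₀⟩ := Finset.card_pos.1 ((Nat.zero_le _).trans_lt h)
  have : Nonempty α := ⟨(this i₀ hi₀).choose⟩
  choose! f hf hf' using ‹∀ i ∈ I, ∃ z ∈ Z, z ∈ W.row i›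
  obtain ⟨i, hi, j, hj, hij, hfij⟩ := Finset.exists_ne_map_eq_of_card_lt_of_maps_to h hf
  exact Set.disjoint_left.1 (W.disjoint_row hij) (hf' i hi) (hfij ▸ hf' j hj)

/-- A choice of one vertex of `B` in each row, indexed by the rows. -/
structure Transversal (W : H.Wall r r) (B : Set α) where
  vertex : ℕ → α
  mem_row : ∀ i, 1 ≤ i → i ≤ r + 1 → vertex i ∈ W.row i
  mem : ∀ i, 1 ≤ i → i ≤ r + 1 → vertex i ∈ B

lemma nonempty_transversal (W : H.Wall r r) (hr : 2 ≤ r) (hB : H.IsLargeThreeBlock W.tangle B) :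
    Nonempty (W.Transversal B) := by
  have h : ∀ i, ∃ x, 1 ≤ i → i ≤ r + 1 → x ∈ W.row i ∧ x ∈ B := by
    intro i
    by_cases hi : 1 ≤ i ∧ i ≤ r + 1
    · obtain ⟨x, hx⟩ := W.exists_mem_row_inter hr hB hi.1 hi.2
      exact ⟨x, fun _ _ => hx⟩
    · obtain ⟨x, -⟩ := W.row_nonempty (i := 1) (by omega) le_rfl (by omega)
      exact ⟨x, fun h h' => absurd ⟨h, h'⟩ hi⟩
  choose f hf using h
  exact ⟨⟨f, fun i h h' => (hf i h h').1, fun i h h' => (hf i h h').2⟩⟩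

namespace Transversal

variable {W : H.Wall r r} (τ : W.Transversal B)

lemma injOn : Set.InjOn τ.vertex (Finset.Icc 1 (r + 1)) := by
  intro i hi j hj hij
  by_contra hne
  rw [Finset.mem_coe, Finset.mem_Icc] at hi hj
  exact Set.disjoint_left.1 (W.disjoint_row hne) (τ.mem_row i hi.1 hi.2)
    (hij ▸ τ.mem_row j hj.1 hj.2)

variable [DecidableEq α]

/-- The set of the vertices of a transversal. -/
def verts : Finset α := (Finset.Icc 1 (r + 1)).image τ.vertex

lemma card_verts : τ.verts.card = r + 1 := by
  rw [verts, Finset.card_image_of_injOn τ.injOn]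
  simp

lemma verts_subset {x : α} (hx : x ∈ τ.verts) : x ∈ B := by
  obtain ⟨i, hi, rfl⟩ := Finset.mem_image.1 hx
  rw [Finset.mem_Icc] at hi
  exact τ.mem i hi.1 hi.2

lemma le_encard (τ : W.Transversal B) : ((r + 1 : ℕ) : ℕ∞) ≤ B.encard := by
  have h : (τ.verts : Set α) ⊆ B := fun x hx => τ.verts_subset hx
  have h1 := Set.encard_le_encard h
  rwa [Set.encard_coe_eq_coe_finsetCard, card_verts] at h1

/-- More than `|Z|` vertices of the transversal include one whose row avoids `Z`. -/
lemma exists_mem_row_disjoint {S Z : Finset α} (hS : S ⊆ τ.verts) (h : Z.card < S.card) :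
    ∃ i, 1 ≤ i ∧ i ≤ r + 1 ∧ τ.vertex i ∈ S ∧ Disjoint (W.row i) (Z : Set α) := by
  have himage : S = ((Finset.Icc 1 (r + 1)).filter fun i => τ.vertex i ∈ S).image τ.vertex := by
    ext x
    simp only [Finset.mem_image, Finset.mem_filter]
    constructor
    · intro hx
      obtain ⟨i, hi, rfl⟩ := Finset.mem_image.1 (hS hx)
      exact ⟨i, ⟨hi, hx⟩, rfl⟩
    · rintro ⟨i, ⟨-, hi⟩, rfl⟩
      exact hi
  have hcard : Z.card < ((Finset.Icc 1 (r + 1)).filter fun i => τ.vertex i ∈ S).card :=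
    h.trans_le ((congrArg Finset.card himage).le.trans Finset.card_image_le)
  obtain ⟨i, hi, hiZ⟩ := W.exists_row_disjoint hcard
  rw [Finset.mem_filter, Finset.mem_Icc] at hi
  exact ⟨i, hi.1.1, hi.1.2, hi.2, hiZ⟩

end Transversal

/-- The transversal cannot be split evenly by few vertices of the torso. -/
lemma Transversal.spread [Fintype α] [DecidableEq α] [AddCommGroup Γ] {G : Graph α ε} {γ : ε → Γ}
    {A : Set α} {W : (G.deleteVerts A).Wall r r} (τ : W.Transversal B)
    (hT : G.Concentrated γ A W.tangle) (hB : (G.deleteVerts A).IsThreeBlock B) {h : ℕ} (hh : 4 * h ≤ r) :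
    ((G.deleteVerts A).torso B).Spread τ.verts h where
  -- With more than h transversal vertices on either side, each side has one whose row avoids the
  -- boundary of `C`. The tangle joins these rows off the boundary, yet a torso walk between them
  -- must meet it.
  dichotomy C hC := by
    by_contra hcon
    push Not at hcon
    obtain ⟨i, hi, hi', hiC, hiZ⟩ := τ.exists_mem_row_disjoint
      (S := C ∩ τ.verts) Finset.inter_subset_right (hC.trans_lt hcon.1)
    obtain ⟨j, hj, hj', hjC, hjZ⟩ := τ.exists_mem_row_disjoint
      (S := τ.verts \ C) Finset.sdiff_subset (hC.trans_lt hcon.2)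
    have hr : 1 ≤ r := by
      have := Finset.card_le_card (Finset.sdiff_subset (s := τ.verts) (t := C))
      rw [τ.card_verts] at this
      by_contra hr
      have h1 := Finset.card_le_card (Finset.inter_subset_right (s₁ := C) (s₂ := τ.verts))
      have h2 := Finset.card_sdiff_add_card_inter τ.verts C
      rw [τ.card_verts, Finset.inter_comm] at h2
      omega
    have hjoin := W.joined_of_mem_rows hT hr
      (Z := (((G.deleteVerts A).torso B).boundary C : Set α)) (fun x hx => by
        obtain ⟨-, y, -, hxy⟩ := SimpleGraph.mem_boundary.1 (Finset.mem_coe.1 hx)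
        exact hB.subset (mem_of_torso_adj hxy))
      (by rw [Set.encard_coe_eq_coe_finsetCard]; exact_mod_cast hC.trans (by omega)) hi hi' hj hj'
      hiZ hjZ (τ.mem_row i hi hi') (τ.mem_row j hj hj')
    obtain ⟨p, hp⟩ := hjoin.exists_torso_walk (τ.mem i hi hi') (τ.mem j hj hj')
    rw [Finset.mem_sdiff] at hjC
    exact hjC.2 (p.mem_of_boundary (Finset.mem_inter.1 hiC).1 fun z hz hz' => hp z hz hz')
  card_gt := by
    rw [τ.card_verts]
    omega

end Wall

end Graph

/-! ### Starts and their interference with the torso. -/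

namespace Graph

variable {α ε Γ : Type*}

lemma Walk.exists_attached {H : Graph α ε} {B : Set α} {x b : α} (p : H.Walk x b) (hb : b ∈ B) :
    ∃ b' ∈ p.support, H.Attached B x b' := by
  obtain ⟨b', hb', q, r, rfl, hq⟩ := p.exists_first p.end_mem_support hb
  exact ⟨b', Walk.mem_support_append.2 (Or.inl q.end_mem_support), hb', q, hq⟩

/-- An inner vertex of a `B`-path is attached to both ends. -/
lemma Walk.IsSetPath.attached {H : Graph α ε} {B : Set α} {x y z : α} {p : H.Walk x y}
    (hp : p.IsSetPath B) (hz : z ∈ p.support) (hzB : z ∉ B) :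
    H.Attached B z x ∧ H.Attached B z y := by
  have key : ∀ {x y : α} {p : H.Walk x y}, p.IsSetPath B → z ∈ p.support → H.Attached B z y := by
    intro x y p hp hz
    rw [isSetPath_iff] at hp
    obtain ⟨h1, h2, h3, h4, h5⟩ := hp
    obtain ⟨q, r, rfl⟩ := p.exists_append_of_mem hz
    refine ⟨h4, r, fun w hw hwB => ?_⟩
    rcases h5 w (mem_support_append.2 (Or.inr hw)) hwB with rfl | rfl
    · have := (isPath_append.1 h1).2.2 _ q.start_mem_support hw
      exact absurd (this ▸ h3) hzB
    · rfl
  exact ⟨key hp.reverse (mem_support_reverse.2 hz), key hp hz⟩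

/-- A path from `A` to `B` that meets these sets only in its ends. -/
structure Start (G : Graph α ε) (A B : Set α) where
  a : α
  b : α
  path : G.Walk a b
  isPath : path.IsPath
  mem_a : a ∈ A
  mem_b : b ∈ B
  eq_a : ∀ x ∈ path.support, x ∈ A → x = a
  eq_b : ∀ x ∈ path.support, x ∈ B → x = b

namespace Start

variable {G : Graph α ε} {A B : Set α} (Q : G.Start A B)

/-- The vertices of the path other than its end in `B`. -/
def inner : Set α := {x | x ∈ Q.path.support ∧ x ≠ Q.b}

/-- The end of the path in `B`, and the vertices of `B` that can be reached from the inner vertices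
of the path. -/
def att : Set α :=
  {c | c = Q.b ∨ ∃ x ∈ Q.inner, x ∉ A ∧ (G.deleteVerts A).Attached B x c}

/-- The vertex `f` of `B` is a neighbour of the end of the path in the torso, but only due to
paths that meet the inner vertices. -/
def Blocks (f : α) : Prop :=
  ((G.deleteVerts A).torso B).Adj Q.b f ∧
    ∀ p : (G.deleteVerts A).Walk Q.b f, p.IsSetPath B → ∃ x ∈ p.support, x ∈ Q.inner

lemma notMem_of_mem_inner {x : α} (hx : x ∈ Q.inner) : x ∉ B := fun h => hx.2 (Q.eq_b x hx.1 h)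

/-- The rest of the path from x serves: its only possible vertex in `A` would be the first vertex of
the path, which precedes x. -/
lemma attached_of_mem_inner {x : α} (hx : x ∈ Q.inner) (hxA : x ∉ A) :
    (G.deleteVerts A).Attached B x Q.b := by
  have h1 := Q.isPath
  have h2 := Q.eq_a
  have h3 := Q.eq_b
  obtain ⟨q, r, hqr⟩ := Q.path.exists_append_of_mem hx.1
  rw [hqr] at h1 h2 h3
  rw [Walk.isPath_append] at h1
  obtain ⟨r', hr', -⟩ := r.exists_deleteVerts (X := A) fun z hz hzA => by
    have := h2 z (Walk.mem_support_append.2 (Or.inr hz)) hzA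
    subst this
    have := h1.2.2 _ q.start_mem_support hz
    exact hxA (this ▸ hzA)
  exact ⟨Q.mem_b, r', fun z hz => h3 z (Walk.mem_support_append.2 (Or.inr (hr' ▸ hz)))⟩

lemma joined_of_mem_inner {x y : α} (hx : x ∈ Q.inner) (hxA : x ∉ A) (hy : y ∈ Q.inner)
    (hyA : y ∉ A) : (G.deleteVerts A).Joined B x y := by
  have key : ∀ {x y : α} (q : G.Walk Q.a x) (m : G.Walk x y) (r : G.Walk y Q.b),
      Q.path = q.append (m.append r) → x ∉ A → y ≠ Q.b → (G.deleteVerts A).Joined B x y := by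
    intro x y q m r hqr hxA hy
    have h1 := Q.isPath
    have h2 := Q.eq_a
    have h3 := Q.eq_b
    rw [hqr] at h1 h2 h3
    rw [Walk.isPath_append, Walk.isPath_append] at h1
    have hm : ∀ z ∈ m.support, z ∈ (q.append (m.append r)).support := fun z hz =>
      Walk.mem_support_append.2 (Or.inr (Walk.mem_support_append.2 (Or.inl hz)))
    obtain ⟨m', hm', -⟩ := m.exists_deleteVerts (X := A) fun z hz hzA => by
      have := h2 z (hm z hz) hzA
      subst this
      have := h1.2.2 _ q.start_mem_support (Walk.mem_support_append.2 (Or.inl hz))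
      exact hxA (this ▸ hzA)
    refine ⟨m', fun z hz hzB => hy ?_⟩
    rw [hm'] at hz
    have := h3 z (hm z hz) hzB
    subst this
    exact (h1.2.1.2.2 _ hz r.end_mem_support).symm
  obtain ⟨q, r, hqr⟩ := Q.path.exists_append_of_mem hx.1
  have hy' := hy.1
  rw [hqr, Walk.mem_support_append] at hy'
  rcases hy' with hy' | hy'
  · obtain ⟨q1, q2, rfl⟩ := q.exists_append_of_mem hy'
    exact (key q1 q2 r (by rw [hqr, Walk.append_assoc]) hyA hx.2).symm
  · obtain ⟨r1, r2, rfl⟩ := r.exists_append_of_mem hy'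
    exact key q r1 r2 hqr hxA hy.2

lemma b_mem_att : Q.b ∈ Q.att := Or.inl rfl

/-- The inner vertices outside `A` lie in one component of (G - A) - B, so they have the same
attachments, of which there are at most two. Without such vertices only `Q.b` remains. -/
lemma encard_att_le (hB : (G.deleteVerts A).IsThreeBlock B) : Q.att.encard ≤ 2 := by
  by_cases h : ∃ x ∈ Q.inner, x ∉ A
  · obtain ⟨x, hx, hxA⟩ := h
    refine (Set.encard_le_encard ?_).trans (hB.encard_attached_le x)
    rintro c (rfl | ⟨y, hy, hyA, hc, p, hp⟩)
    · exact Q.attached_of_mem_inner hx hxA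
    · obtain ⟨q, hq⟩ := Q.joined_of_mem_inner hx hxA hy hyA
      refine ⟨hc, q.append p, fun z hz hzB => ?_⟩
      rw [Walk.mem_support_append] at hz
      rcases hz with hz | hz
      · exact absurd hzB (hq z hz)
      · exact hp z hz hzB
  · push Not at h
    refine (Set.encard_le_encard (t := {Q.b}) ?_).trans (by simp)
    rintro c (rfl | ⟨y, hy, hyA, -⟩)
    · rfl
    · exact absurd (h y hy) hyA

/-- An inner vertex on a `B`-path of `G - A` attaches the path to the ends of the `B`-path. -/
lemma mem_att_of_mem_inner {u v x : α} {p : (G.deleteVerts A).Walk u v} (hp : p.IsSetPath B)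
    (hx : x ∈ p.support) (hxQ : x ∈ Q.inner) : u ∈ Q.att ∧ v ∈ Q.att := by
  have hxA := p.notMem_of_deleteVerts hx
  have h := hp.attached hx (Q.notMem_of_mem_inner hxQ)
  exact ⟨Or.inr ⟨x, hxQ, hxA, h.1⟩, Or.inr ⟨x, hxQ, hxA, h.2⟩⟩

lemma eq_or_eq_of_mem_att (hB : (G.deleteVerts A).IsThreeBlock B) {u v w : α} (hu : u ∈ Q.att)
    (hv : v ∈ Q.att) (hw : w ∈ Q.att) (huv : u ≠ v) : w = u ∨ w = v := by
  by_contra h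
  push Not at h
  have h3 : ({u, v, w} : Set α).encard = 3 :=
    Set.encard_eq_three.2 ⟨u, v, w, huv, h.1.symm, h.2.symm, rfl⟩
  have h4 : ({u, v, w} : Set α).encard ≤ Q.att.encard := Set.encard_le_encard (by
    rintro x (rfl | rfl | rfl) <;> assumption)
  rw [h3] at h4
  exact absurd (h4.trans (Q.encard_att_le hB)) (by decide)

/-- A blocked vertex is an attachment other than `Q.b`, and there is at most one of those. -/
lemma Blocks.eq {Q : G.Start A B} (hB : (G.deleteVerts A).IsThreeBlock B) {f f' : α}
    (h : Q.Blocks f) (h' : Q.Blocks f') : f = f' := by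
  have key : ∀ {f}, Q.Blocks f → f ∈ Q.att := by
    rintro f ⟨⟨p, hp⟩, hf⟩
    obtain ⟨x, hx, hxQ⟩ := hf p hp
    exact (Q.mem_att_of_mem_inner hp hx hxQ).2
  rcases Q.eq_or_eq_of_mem_att hB Q.b_mem_att (key h) (key h') h.1.ne with h1 | h1
  · exact absurd h1 h'.1.ne'
  · exact h1.symm

open scoped Classical in
/-- The vertex blocked by the path if there is one, and otherwise the end of the path in `B`. -/
noncomputable def f : α := if h : ∃ f, Q.Blocks f then h.choose else Q.b

/-- If nothing is blocked, `f` defaults to `Q.b` and the pair s(b, f) is a loop, which is no edge.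
So deleting this pair removes exactly the torso edge that the start destroys, if there is one. -/
lemma blocks_iff (hB : (G.deleteVerts A).IsThreeBlock B) {c : α} :
    Q.Blocks c ↔ c = Q.f ∧ c ≠ Q.b := by
  unfold f
  split_ifs with h
  · constructor
    · intro hc
      exact ⟨hc.eq hB h.choose_spec, hc.1.ne'⟩
    · rintro ⟨rfl, -⟩
      exact h.choose_spec
  · exact ⟨fun hc => absurd ⟨c, hc⟩ h, fun hc => absurd hc.1 hc.2⟩

/-- The weight of the path, corrected by the potential of its end. -/
def type [AddCommGroup Γ] (γ : ε → Γ) (φ : α → Γ) : Γ := Q.path.weight γ + φ Q.b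

/-- Neither of two starts interferes with the other one. -/
def Compatible (Q Q' : G.Start A B) : Prop :=
  Q.a ≠ Q'.a ∧ Q.b ∉ Q'.att ∧ Q'.b ∉ Q.att

lemma Compatible.symm {Q Q' : G.Start A B} (h : Q.Compatible Q') : Q'.Compatible Q :=
  ⟨h.1.symm, h.2.2, h.2.1⟩

/-- A common inner vertex in `A` would be the first vertex of both paths; a common one outside `A`
would make the end of one start an attachment of the other. -/
lemma Compatible.disjoint_inner {Q Q' : G.Start A B} (h : Q.Compatible Q') :
    Disjoint Q.inner Q'.inner := by
  rw [Set.disjoint_left]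
  intro x hx hx'
  by_cases hxA : x ∈ A
  · exact h.1 ((Q.eq_a x hx.1 hxA).symm.trans (Q'.eq_a x hx'.1 hxA))
  · exact h.2.1 (Or.inr ⟨x, hx', hxA, Q.attached_of_mem_inner hx hxA⟩)

end Start

/-- Every edge of the torso that is not one of the pairs `b`, `f` of a compatible family of starts is
realized by a path that avoids the inner vertices of the family. -/
lemma exists_isSetPath_avoiding {G : Graph α ε} {A B : Set α}
    (hB : (G.deleteVerts A).IsThreeBlock B) {𝒮 : Set (G.Start A B)}
    (h𝒮 : ∀ Q ∈ 𝒮, ∀ Q' ∈ 𝒮, Q ≠ Q' → Q.Compatible Q') {x y : α}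
    (hxy : ((G.deleteVerts A).torso B).Adj x y) (hne : ∀ Q ∈ 𝒮, s(Q.b, Q.f) ≠ s(x, y)) :
    ∃ p : (G.deleteVerts A).Walk x y, p.IsSetPath B ∧ ∀ z ∈ p.support, ∀ Q ∈ 𝒮, z ∉ Q.inner := by
  by_cases hQ : ∃ Q ∈ 𝒮, x ∈ Q.att ∧ y ∈ Q.att
  · obtain ⟨Q, hQ, hx, hy⟩ := hQ
    -- If x and y are attachments of `Q'`, then `Q'.b` is one of them. It would then be an
    -- attachment of `Q`, against compatibility.
    have huniq : ∀ Q' ∈ 𝒮, x ∈ Q'.att → y ∈ Q'.att → Q' = Q := by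
      intro Q' hQ' hx' hy'
      by_contra hQQ
      have hc := h𝒮 Q' hQ' Q hQ hQQ
      have h1 := Q'.eq_or_eq_of_mem_att hB hx' hy' Q'.b_mem_att hxy.ne
      rcases h1 with h1 | h1
      · exact hc.2.1 (h1 ▸ hx)
      · exact hc.2.1 (h1 ▸ hy)
    obtain ⟨p, hp, hpQ⟩ : ∃ p : (G.deleteVerts A).Walk x y, p.IsSetPath B ∧
        ∀ z ∈ p.support, z ∉ Q.inner := by
      -- One of x and y is `Q.b`. If all `B`-paths between them met the inner vertices, the other
      -- would be blocked and xy would be an excluded pair.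
      rcases Q.eq_or_eq_of_mem_att hB hx hy Q.b_mem_att hxy.ne with h1 | h1
      · subst h1
        by_contra hcon
        push Not at hcon
        have h2 := (Q.blocks_iff hB).1 ⟨hxy, hcon⟩
        exact hne Q hQ (by rw [h2.1])
      · subst h1
        by_contra hcon
        push Not at hcon
        have h2 := (Q.blocks_iff hB (c := x)).1 ⟨hxy.symm, fun p hp => by
          obtain ⟨z, hz, hzQ⟩ := hcon p.reverse hp.reverse
          exact ⟨z, Walk.mem_support_reverse.1 hz, hzQ⟩⟩
        exact hne Q hQ (by rw [← h2.1, Sym2.eq_swap])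
    refine ⟨p, hp, fun z hz Q' hQ' hzQ' => ?_⟩
    have h1 := Q'.mem_att_of_mem_inner hp hz hzQ'
    exact hpQ z hz (huniq Q' hQ' h1.1 h1.2 ▸ hzQ')
  · push Not at hQ
    obtain ⟨p, hp⟩ := hxy
    refine ⟨p, hp, fun z hz Q hQ' hzQ => ?_⟩
    have h1 := Q.mem_att_of_mem_inner hp hz hzQ
    exact hQ Q hQ' h1.1 h1.2

end Graph

/-! ### From linked starts to disjoint zero `A`-paths. -/

namespace Graph

variable {α ε Γ : Type*} {G : Graph α ε} {A B : Set α}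

/-- A walk in the torso that does not use the pairs `b`, `f` of a compatible family of starts is
realized by a path that avoids the inner vertices of the family. -/
lemma exists_isPath_avoiding (hB : (G.deleteVerts A).IsThreeBlock B) {𝒮 : Set (G.Start A B)}
    (h𝒮 : ∀ Q ∈ 𝒮, ∀ Q' ∈ 𝒮, Q ≠ Q' → Q.Compatible Q') {F : SimpleGraph α}
    (hF : ∀ x y, F.Adj x y →
      ((G.deleteVerts A).torso B).Adj x y ∧ ∀ Q ∈ 𝒮, s(Q.b, Q.f) ≠ s(x, y))
    {x y : α} (M : F.Walk x y) (hx : x ∈ B) :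
    ∃ p : (G.deleteVerts A).Walk x y, p.IsPath ∧ (∀ z ∈ p.support, ∀ Q ∈ 𝒮, z ∉ Q.inner) ∧
      ∀ z ∈ p.support, z ∈ M.support ∨ z ∉ B ∧ ∃ u ∈ M.support, ∃ v ∈ M.support, u ≠ v ∧
        (G.deleteVerts A).Attached B z u ∧ (G.deleteVerts A).Attached B z v := by
  -- For a vertex outside `B` two attachments on `M` are recorded, so that realizations of disjoint
  -- torso paths can be shown to be disjoint.
  have key : ∃ p : (G.deleteVerts A).Walk x y, (∀ z ∈ p.support, ∀ Q ∈ 𝒮, z ∉ Q.inner) ∧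
      ∀ z ∈ p.support, z ∈ M.support ∨ z ∉ B ∧ ∃ u ∈ M.support, ∃ v ∈ M.support, u ≠ v ∧
        (G.deleteVerts A).Attached B z u ∧ (G.deleteVerts A).Attached B z v := by
    induction M with
    | nil =>
      refine ⟨Walk.nil (hB.subset hx), fun z hz Q hQ hzQ => ?_, fun z hz => Or.inl hz⟩
      rw [Walk.support, List.mem_singleton] at hz
      subst hz
      exact Q.notMem_of_mem_inner hzQ hx
    | @cons x w y h M ih =>
      have hxw := hF _ _ h
      obtain ⟨q, hq, hqS⟩ := exists_isSetPath_avoiding hB h𝒮 hxw.1 hxw.2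
      obtain ⟨p, hp, hpM⟩ := ih (mem_of_torso_adj hxw.1.symm)
      refine ⟨q.append p, fun z hz => ?_, fun z hz => ?_⟩
      · rw [Walk.mem_support_append] at hz
        exact hz.elim (hqS z) (hp z)
      · rw [Walk.mem_support_append] at hz
        rcases hz with hz | hz
        · by_cases hzB : z ∈ B
          · left
            rcases (Walk.isSetPath_iff.1 hq).2.2.2.2 z hz hzB with rfl | rfl
            · exact List.mem_cons_self
            · exact List.mem_cons_of_mem _ M.start_mem_support
          · have := hq.attached hz hzB
            exact Or.inr ⟨hzB, x, List.mem_cons_self, w, List.mem_cons_of_mem _ M.start_mem_support,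
              h.ne, this⟩
        · rcases hpM z hz with h1 | ⟨h1, u, hu, v, hv, h2⟩
          · exact Or.inl (List.mem_cons_of_mem _ h1)
          · exact Or.inr ⟨h1, u, List.mem_cons_of_mem _ hu, v, List.mem_cons_of_mem _ hv, h2⟩
  obtain ⟨p, h1, h2⟩ := key
  obtain ⟨q, hq, hqp⟩ := p.exists_isPath
  exact ⟨q, hq, fun z hz => h1 z (hqp hz), fun z hz => h2 z (hqp hz)⟩

lemma mem_of_mem_torso_walk {H : Graph α ε} {F : SimpleGraph α} (hF : F ≤ H.torso B) {x y z : α}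
    (M : F.Walk x y) (hx : x ∈ B) (hz : z ∈ M.support) : z ∈ B := by
  induction M with
  | nil =>
    rw [SimpleGraph.Walk.support_nil, List.mem_singleton] at hz
    exact hz ▸ hx
  | cons h M ih =>
    rw [SimpleGraph.Walk.support_cons, List.mem_cons] at hz
    rcases hz with rfl | hz
    · exact hx
    · exact ih (mem_of_torso_adj (hF h).symm) hz

/-- Two compatible starts and a path of `G - A` between their ends form an `A`-path. -/
lemma exists_isZeroSetPath [AddCommGroup Γ] {γ : ε → Γ} {φ : α → Γ}
    (h2 : ∀ v, φ v + φ v = 0)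
    (hφ : ∀ u v (p : (G.deleteVerts A).Walk u v), p.IsSetPath B → p.weight γ = φ u + φ v)
    {Q Q' : G.Start A B} (hc : Q.Compatible Q') (ht : Q.type γ φ + Q'.type γ φ = 0)
    (m : (G.deleteVerts A).Walk Q.b Q'.b) (hm : m.IsPath)
    (hmQ : ∀ z ∈ m.support, z ∉ Q.inner ∧ z ∉ Q'.inner) :
    ∃ P : G.Walk Q.a Q'.a, P.IsZeroSetPath γ A ∧
      ∀ z ∈ P.support, z ∈ Q.inner ∨ z ∈ m.support ∨ z ∈ Q'.inner := by
  obtain ⟨m', hm', hme⟩ := m.exists_of_le deleteVerts_le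
  have hsupp : ∀ z ∈ (Q.path.append (m'.append Q'.path.reverse)).support,
      z ∈ Q.inner ∨ z ∈ m.support ∨ z ∈ Q'.inner := by
    intro z hz
    rw [Walk.mem_support_append, Walk.mem_support_append, Walk.mem_support_reverse, hm'] at hz
    by_cases h1 : z = Q.b
    · exact Or.inr (Or.inl (h1 ▸ m.start_mem_support))
    by_cases h2 : z = Q'.b
    · exact Or.inr (Or.inl (h2 ▸ m.end_mem_support))
    rcases hz with hz | hz | hz
    · exact Or.inl ⟨hz, h1⟩
    · exact Or.inr (Or.inl hz)
    · exact Or.inr (Or.inr ⟨hz, h2⟩)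
  refine ⟨Q.path.append (m'.append Q'.path.reverse), ⟨?_, ?_⟩, hsupp⟩
  · rw [Walk.isSetPath_iff]
    refine ⟨?_, hc.1, Q.mem_a, Q'.mem_a, fun x hx hxA => ?_⟩
    · rw [Walk.isPath_append, Walk.isPath_append, Walk.isPath_reverse,
        Walk.support_nodup_iff_of_eq hm']
      refine ⟨Q.isPath, ⟨hm, Q'.isPath, fun x hx hx' => ?_⟩, fun x hx hx' => ?_⟩
      · rw [hm'] at hx
        rw [Walk.mem_support_reverse] at hx'
        by_contra h
        exact (hmQ x hx).2 ⟨hx', h⟩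
      · by_contra h
        have hxQ : x ∈ Q.inner := ⟨hx, h⟩
        rw [Walk.mem_support_append, hm', Walk.mem_support_reverse] at hx'
        rcases hx' with hx' | hx'
        · exact (hmQ x hx').1 hxQ
        · by_cases hxb : x = Q'.b
          · exact Q.notMem_of_mem_inner hxQ (hxb ▸ Q'.mem_b)
          · exact Set.disjoint_left.1 hc.disjoint_inner hxQ ⟨hx', hxb⟩
    · rcases hsupp x hx with h | h | h
      · exact Or.inl (Q.eq_a x h.1 hxA)
      · exact absurd hxA (m.notMem_of_deleteVerts h)
      · exact Or.inr (Q'.eq_a x h.1 hxA)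
  -- The middle path has weight φ(Q.b) + φ(Q'.b), which is exactly the correction contained in the
  -- two types.
  · rw [Walk.weight_append, Walk.weight_append, Walk.weight_reverse,
      Walk.weight_eq_of_edges_eq γ hme, hm.weight_eq_of_potential h2 hφ Q.mem_b Q'.mem_b, ← ht]
    unfold Start.type
    abel

/-- Linked compatible starts of opposite types yield disjoint zero `A`-paths. -/
theorem hasDisjointZeroSetPaths_of_linked [AddCommGroup Γ] {γ : ε → Γ} {φ : α → Γ}
    (hB : (G.deleteVerts A).IsThreeBlock B) (h2 : ∀ v, φ v + φ v = 0)
    (hφ : ∀ u v (p : (G.deleteVerts A).Walk u v), p.IsSetPath B → p.weight γ = φ u + φ v)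
    {𝒮 𝒮₁ 𝒮₂ : Set (G.Start A B)} (hs₁ : 𝒮₁ ⊆ 𝒮) (hs₂ : 𝒮₂ ⊆ 𝒮)
    (h𝒮 : ∀ Q ∈ 𝒮, ∀ Q' ∈ 𝒮, Q ≠ Q' → Q.Compatible Q')
    (h₁₂ : ∀ Q ∈ 𝒮₁, ∀ Q' ∈ 𝒮₂, Q ≠ Q' ∧ Q.type γ φ + Q'.type γ φ = 0)
    {F : SimpleGraph α}
    (hF : ∀ x y, F.Adj x y →
      ((G.deleteVerts A).torso B).Adj x y ∧ ∀ Q ∈ 𝒮, s(Q.b, Q.f) ≠ s(x, y))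
    {S T : Finset α} (hS : ∀ b ∈ S, ∃ Q ∈ 𝒮₁, Q.b = b) (hT : ∀ b ∈ T, ∃ Q ∈ 𝒮₂, Q.b = b) {k : ℕ}
    (hl : F.Linked S T k) : G.HasDisjointZeroSetPaths γ A k := by
  obtain ⟨f, g, P, hP, hdisj⟩ := hl
  choose Q hQ hQb using fun i => hS (f i) (hP i).1
  choose Q' hQ' hQb' using fun i => hT (g i) (hP i).2.1
  have hfB : ∀ i, f i ∈ B := fun i => hQb i ▸ (Q i).mem_b
  have hm : ∀ i, ∃ m : (G.deleteVerts A).Walk (Q i).b (Q' i).b, m.IsPath ∧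
      (∀ z ∈ m.support, ∀ Q ∈ 𝒮, z ∉ Q.inner) ∧
      ∀ z ∈ m.support, z ∈ (P i).support ∨ z ∉ B ∧ ∃ u ∈ (P i).support, ∃ v ∈ (P i).support, u ≠ v ∧
        (G.deleteVerts A).Attached B z u ∧ (G.deleteVerts A).Attached B z v := by
    intro i
    rw [hQb, hQb']
    exact exists_isPath_avoiding hB h𝒮 hF (P i) (hfB i)
  choose m hmpath hmS hmP using hm
  have hR := fun i => exists_isZeroSetPath h2 hφ
    (h𝒮 _ (hs₁ (hQ i)) _ (hs₂ (hQ' i)) (h₁₂ _ (hQ i) _ (hQ' i)).1) (h₁₂ _ (hQ i) _ (hQ' i)).2 (m i)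
    (hmpath i) (fun z hz => ⟨hmS i z hz _ (hs₁ (hQ i)), hmS i z hz _ (hs₂ (hQ' i))⟩)
  choose R hR hRs using hR
  refine ⟨fun i => (Q i).a, fun i => (Q' i).a, R, hR, fun i j hij z hz hz' => ?_⟩
  have hPB : ∀ i, ∀ z ∈ (P i).support, z ∈ B := fun i z hz =>
    mem_of_mem_torso_walk (fun x y h => (hF x y h).1) (P i) (hfB i) hz
  have hst : ∀ i x, x = f i → x ∈ (P i).support := by
    rintro i x rfl
    exact (P i).start_mem_support
  have hend : ∀ i x, x = g i → x ∈ (P i).support := by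
    rintro i x rfl
    exact (P i).end_mem_support
  have hQne : Q i ≠ Q j := fun h => hdisj i j hij (P i).start_mem_support
    (hst j _ ((hQb i).symm.trans ((congrArg Start.b h).trans (hQb j))))
  have hQne' : Q' i ≠ Q' j := fun h => hdisj i j hij (P i).end_mem_support
    (hend j _ ((hQb' i).symm.trans ((congrArg Start.b h).trans (hQb' j))))
  have hinner : ∀ Q₁ ∈ 𝒮, ∀ Q₂ ∈ 𝒮, Q₁ ≠ Q₂ → z ∈ Q₁.inner → z ∉ Q₂.inner :=
    fun Q₁ h₁ Q₂ h₂ hne h => Set.disjoint_left.1 (h𝒮 Q₁ h₁ Q₂ h₂ hne).disjoint_inner h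
  -- A common vertex outside `B` would be attached to two vertices of one torso path and to a vertex
  -- of the other, hence to three vertices of `B`.
  have hmm : ∀ z ∈ (m i).support, z ∉ (m j).support := by
    intro z hz hz'
    have hd := hdisj i j hij
    rcases hmP i z hz with h | ⟨hzB, u, hu, v, hv, huv, hzu, hzv⟩
    · rcases hmP j z hz' with h' | ⟨hzB', -⟩
      · exact hd h h'
      · exact hzB' (hPB i z h)
    · rcases hmP j z hz' with h' | ⟨-, u', hu', v', hv', -, hzu', -⟩
      · exact hzB (hPB j z h')
      · rcases hB.eq_or_eq_of_attached hzu hzv hzu' with h | h | h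
        · exact huv h
        · exact hd hu (h ▸ hu')
        · exact hd hv (h ▸ hu')
  rcases hRs i z hz with h | h | h <;> rcases hRs j z hz' with h' | h' | h'
  · exact hinner _ (hs₁ (hQ i)) _ (hs₁ (hQ j)) hQne h h'
  · exact hmS j z h' _ (hs₁ (hQ i)) h
  · exact hinner _ (hs₁ (hQ i)) _ (hs₂ (hQ' j)) (h₁₂ _ (hQ i) _ (hQ' j)).1 h h'
  · exact hmS i z h _ (hs₁ (hQ j)) h'
  · exact hmm z h h'
  · exact hmS i z h _ (hs₂ (hQ' j)) h'
  · exact hinner _ (hs₁ (hQ j)) _ (hs₂ (hQ' i)) (h₁₂ _ (hQ j) _ (hQ' i)).1 h' h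
  · exact hmS j z h' _ (hs₂ (hQ' i)) h
  · exact hinner _ (hs₂ (hQ' i)) _ (hs₂ (hQ' j)) hQne' h h'

end Graph

/-! ### The starts contained in a zero `A`-path. -/

namespace Graph

variable {α ε Γ : Type*} {G : Graph α ε} {A B : Set α}

namespace Walk

lemma append_nil {u v : α} (p : G.Walk u v) (hv : v ∈ V(G)) : p.append (nil hv) = p := by
  induction p with
  | nil _ => rfl
  | cons e h p ih => rw [append, ih]

lemma reverse_append {u v w : α} (p : G.Walk u v) (q : G.Walk v w) :
    (p.append q).reverse = q.reverse.append p.reverse := by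
  induction p with
  | nil hu => rw [append, reverse, append_nil]
  | cons e h p ih => rw [append, reverse, reverse, ih, append_assoc]

end Walk

/-- The start is the first part of an `A`-path, up to its first vertex in `B`. -/
def Start.InitialOf (Q : G.Start A B) {u v : α} (P : G.Walk u v) : Prop :=
  (∀ z ∈ Q.path.support, z ∈ P.support) ∧ ∀ y ∈ P.support, y ∈ B →
    ∃ m : (G.deleteVerts A).Walk Q.b y, m.IsPath ∧ ∀ z ∈ m.support, z ∈ P.support ∧ z ∉ Q.inner

/-- The remainder r meets q only in b, so it leads from b to every later vertex of `B` off the inner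
vertices, and off `A` since only its last vertex lies there. -/
lemma exists_initialOf [AddCommGroup Γ] (γ : ε → Γ) (φ : α → Γ) {u b v : α} {q : G.Walk u b}
    {r : G.Walk b v} (hP : (q.append r).IsSetPath A) (hAB : Disjoint A B) (hb : b ∈ B)
    (hq : ∀ y ∈ q.support, y ∈ B → y = b) :
    ∃ Q : G.Start A B, Q.InitialOf (q.append r) ∧ Q.type γ φ = q.weight γ + φ b := by
  rw [Walk.isSetPath_iff, Walk.isPath_append] at hP
  obtain ⟨⟨h1, h2, h3⟩, huv, hu, hv, hA⟩ := hP
  have hbA : b ∉ A := fun h => Set.disjoint_left.1 hAB h hb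
  have hqA : ∀ x ∈ q.support, x ∈ A → x = u := by
    intro x hx hxA
    refine (hA x (Walk.mem_support_append.2 (Or.inl hx)) hxA).resolve_right ?_
    rintro rfl
    exact hbA (h3 x hx r.end_mem_support ▸ hxA)
  refine ⟨⟨u, b, q, h1, hu, hb, hqA, hq⟩,
    ⟨fun z hz => Walk.mem_support_append.2 (Or.inl hz), fun y hy hyB => ?_⟩, rfl⟩
  have hyr : y ∈ r.support := by
    rw [Walk.mem_support_append] at hy
    rcases hy with hy | hy
    · rw [hq y hy hyB]
      exact r.start_mem_support
    · exact hy
  obtain ⟨m, r', rfl⟩ := r.exists_append_of_mem hyr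
  rw [Walk.isPath_append] at h2
  have hm : ∀ z ∈ m.support, z ∈ (m.append r').support := fun z hz =>
    Walk.mem_support_append.2 (Or.inl hz)
  obtain ⟨m', hm', -⟩ := m.exists_deleteVerts (X := A) fun z hz hzA => by
    rcases hA z (Walk.mem_support_append.2 (Or.inr (hm z hz))) hzA with rfl | rfl
    · exact hbA (h3 z q.start_mem_support (hm z hz) ▸ hzA)
    · have := h2.2.2 z hz r'.end_mem_support
      subst this
      exact Set.disjoint_left.1 hAB hzA hyB
  refine ⟨m', (Walk.support_nodup_iff_of_eq hm').2 h2.1, fun z hz => ?_⟩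
  rw [hm'] at hz
  exact ⟨Walk.mem_support_append.2 (Or.inr (hm z hz)), fun h => h.2 (h3 z h.1 (hm z hz))⟩

/-- A zero `A`-path through `B` has two starts of opposite types. -/
lemma exists_two_initialOf [AddCommGroup Γ] {γ : ε → Γ} {φ : α → Γ} (h2 : ∀ v, φ v + φ v = 0)
    (hφ : ∀ u v (p : (G.deleteVerts A).Walk u v), p.IsSetPath B → p.weight γ = φ u + φ v)
    (hAB : Disjoint A B) {u v x : α} {P : G.Walk u v} (hP : P.IsZeroSetPath γ A)
    (hx : x ∈ P.support) (hxB : x ∈ B) : ∃ Q Q' : G.Start A B,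
      Q.InitialOf P ∧ Q'.InitialOf P ∧ Q.type γ φ + Q'.type γ φ = 0 := by
  obtain ⟨b, hb, q, r, rfl, hq⟩ := P.exists_first hx hxB
  -- `q'` is the end segment from the other side; possibly b' = b. The middle part m has weight φ b'
  -- + φ b, so the two types add up to the weight of `P`.
  obtain ⟨b', hb', q', m, hr, hq'⟩ := r.reverse.exists_first (Walk.end_mem_support _) hb
  obtain ⟨Q, hQ, hQt⟩ := exists_initialOf γ φ hP.1 hAB hb hq
  have hrev : (q.append r).reverse = q'.append (m.append q.reverse) := by
    rw [Walk.reverse_append, hr, Walk.append_assoc]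
  have hP' := hP.1.reverse
  rw [hrev] at hP'
  obtain ⟨Q', hQ', hQt'⟩ := exists_initialOf γ φ hP' hAB hb' hq'
  rw [← hrev] at hQ'
  refine ⟨Q, Q', hQ, ⟨fun z hz => Walk.mem_support_reverse.1 (hQ'.1 z hz), fun y hy hyB => ?_⟩, ?_⟩
  · obtain ⟨m, hm, hmP⟩ := hQ'.2 y (Walk.mem_support_reverse.2 hy) hyB
    exact ⟨m, hm, fun z hz => ⟨Walk.mem_support_reverse.1 (hmP z hz).1, (hmP z hz).2⟩⟩
  · have hpath := Walk.isPath_append.1 (Walk.isSetPath_iff.1 hP.1).1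
    have hrpath := Walk.isPath_reverse.2 hpath.2.1
    rw [hr, Walk.isPath_append] at hrpath
    have hmr : ∀ z ∈ m.support, z ∈ r.support := fun z hz => by
      rw [← Walk.mem_support_reverse, hr]
      exact Walk.mem_support_append.2 (Or.inr hz)
    obtain ⟨m', hm', hme⟩ := m.exists_deleteVerts (X := A) fun z hz hzA => by
      rcases (Walk.isSetPath_iff.1 hP.1).2.2.2.2 z
        (Walk.mem_support_append.2 (Or.inr (hmr z hz))) hzA with rfl | rfl
      · have := hpath.2.2 z q.start_mem_support (hmr z hz)
        subst this
        exact Set.disjoint_left.1 hAB hzA hb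
      · have := hrpath.2.2 z q'.start_mem_support hz
        subst this
        exact Set.disjoint_left.1 hAB hzA hb'
    have hmw := Walk.IsPath.weight_eq_of_potential h2 hφ
      ((Walk.support_nodup_iff_of_eq hm').2 hrpath.2.1) hb' hb
    rw [Walk.weight_eq_of_edges_eq γ hme] at hmw
    have hw := hP.2
    rw [Walk.weight_append, ← Walk.weight_reverse γ r, hr, Walk.weight_append, hmw] at hw
    rw [hQt, hQt', ← hw]
    abel

namespace Wall

variable {r : ℕ} [AddCommGroup Γ] {γ : ε → Γ} {W : (G.deleteVerts A).Wall r r}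

/-- Every zero `A`-path meets the large 3-block. -/
lemma exists_mem_of_isZeroSetPath (hT : G.Concentrated γ A W.tangle) (hr : 2 ≤ r)
    (hB : (G.deleteVerts A).IsThreeBlock B) (τ : W.Transversal B) {u v : α} {P : G.Walk u v}
    (hP : P.IsZeroSetPath γ A) : ∃ x ∈ P.support, x ∈ B := by
  classical
  by_contra hcon
  push Not at hcon
  by_cases hPA : ∀ x ∈ P.support, x ∈ A
  -- The separation with empty small side belongs to the tangle, so there is no zero `A`-path within
  -- `A`.
  · refine (hT _ _ (W.mem_tangle (K := ∅) (Z := ∅) (by simp) (by simp) (by simp) (by simp)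
      (i := 1) le_rfl (by omega) (by simp))).1 (hasZeroSetPath_induce hP fun x hx => Or.inl (hPA x hx))
  · push Not at hPA
    obtain ⟨x, hx, hxA⟩ := hPA
    -- `N` contains the first vertex in `B` of every walk of `G - A` from x to `B`. But the tangle
    -- joins x off `N` to a row, and thus to a vertex of `B`.
    let N : Set α := {b | (G.deleteVerts A).Attached B x b}
    have hN : N.encard ≤ 2 := hB.encard_attached_le x
    obtain ⟨N', hN'⟩ := (Set.finite_of_encard_le_coe hN).exists_finset_coe
    have hcard : N'.card ≤ 2 := by
      rw [← hN', Set.encard_coe_eq_coe_finsetCard] at hN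
      exact_mod_cast hN
    obtain ⟨i, hi, hi', hiN, hdisj⟩ := τ.exists_mem_row_disjoint (S := τ.verts) (Z := N') subset_rfl
      (by rw [τ.card_verts]; omega)
    rw [hN'] at hdisj
    obtain ⟨y, hy, hxy⟩ := W.exists_joined_row hT hP (Z := N) (fun b hb => hB.subset hb.1)
      (hN.trans (by exact_mod_cast hr)) (fun z hz hzN => hcon z hz hzN.1) hx hxA hi hi'
    obtain ⟨p, hp⟩ := hxy.trans (W.joined_of_mem_row (by omega) hi hi' hdisj hy (τ.mem_row i hi hi'))
    obtain ⟨b, hb, hbx⟩ := p.exists_attached (τ.mem i hi hi')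
    exact hp b hb hbx

variable [Fintype α] [DecidableEq α]

/-- The start of a zero `A`-path that avoids few vertices is not cut off from the wall by them. -/
lemma not_boundary_subset_of_initialOf (hT : G.Concentrated γ A W.tangle)
    (hB : (G.deleteVerts A).IsThreeBlock B) (τ : W.Transversal B) {u v : α} {P : G.Walk u v}
    (hP : P.IsZeroSetPath γ A) {Q : G.Start A B} (hQ : Q.InitialOf P) {Z : Finset α}
    (hZ : 2 * Z.card + 2 ≤ r) (hPZ : ∀ z ∈ P.support, z ∉ Z) {C : Finset α}
    (hC : SimpleGraph.Small τ.verts C) (hbC : Q.b ∈ C) :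
    ¬ (((G.deleteVerts A).torso B).deleteEdges {s(Q.b, Q.f)}).boundary C ⊆ Z := by
  classical
  intro hCZ
  have hstep : ∀ x y, x ∈ C → y ∉ C → ((G.deleteVerts A).torso B).Adj x y →
      x ∈ Z ∨ x = Q.b ∧ y = Q.f := by
    intro x y hx hy hxy
    by_cases he : s(x, y) = s(Q.b, Q.f)
    · rw [Sym2.eq_iff] at he
      rcases he with he | he
      · exact Or.inr he
      · exact absurd (he.2 ▸ hbC) hy
    · refine Or.inl (hCZ (SimpleGraph.mem_boundary.2 ⟨hx, y, hy, ?_⟩))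
      rw [SimpleGraph.deleteEdges_adj]
      exact ⟨hxy, he⟩
  -- Between b and f the path `P` consists of `B`-paths that avoid `Z` and the inner vertices of
  -- `Q`. None of them realizes the blocked edge, so none leaves `C`.
  have hfC : Q.f ∈ P.support → Q.f ∈ C := by
    intro hf
    by_cases hfb : Q.f = Q.b
    · rwa [hfb]
    have hbl := (Q.blocks_iff hB).2 ⟨rfl, hfb⟩
    have hfB := mem_of_torso_adj hbl.1.symm
    obtain ⟨m, hm, hmP⟩ := hQ.2 _ hf hfB
    refine hm.induction_isSetPath (motive := fun x => x ∈ C) Q.mem_b hfB ?_ hbC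
    intro x y q hq hsub hx
    by_contra hy
    rcases hstep x y hx hy ⟨q, hq⟩ with h | ⟨rfl, rfl⟩
    · exact hPZ x (hmP x (hsub q.start_mem_support)).1 h
    · obtain ⟨z, hz, hzQ⟩ := hbl.2 q hq
      exact (hmP z (hsub hz)).2 hzQ
  -- Every torso edge that leaves `C` has an end in `Z'`, while `P` still avoids `Z'` by `hfC`. The
  -- filter discards vertices outside `G - A`.
  let Z' : Finset α := (if Q.f ∈ C then Z else insert Q.f Z).filter (· ∈ V(G.deleteVerts A))
  have hZ' : ∀ z, z ∈ Z' ↔ (z ∈ Z ∨ z = Q.f ∧ Q.f ∉ C) ∧ z ∈ V(G.deleteVerts A) := by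
    intro z
    simp only [Z', Finset.mem_filter]
    split_ifs with h
    · simp [h]
    · simp [h, or_comm]
  have hcard : Z'.card ≤ Z.card + 1 := by
    refine (Finset.card_filter_le _ _).trans ?_
    split_ifs
    · omega
    · exact Finset.card_insert_le _ _
  have hcardU := Finset.card_sdiff_add_card_inter τ.verts C
  rw [τ.card_verts, Finset.inter_comm] at hcardU
  unfold SimpleGraph.Small at hC
  rw [τ.card_verts] at hC
  -- More than half of the r + 1 transversal vertices lie outside `C`; this exceeds |Z| + 1.
  obtain ⟨i, hi, hi', hiC, hdisj⟩ := τ.exists_mem_row_disjoint (S := τ.verts \ C) (Z := Z')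
    Finset.sdiff_subset (by omega)
  have hbP : Q.b ∈ P.support := hQ.1 _ Q.path.end_mem_support
  have hbA : Q.b ∉ A := (hB.subset Q.mem_b).2
  obtain ⟨y, hy, hby⟩ := W.exists_joined_row hT hP (Z := (Z' : Set α))
    (fun z hz => ((hZ' z).1 hz).2)
    (by rw [Set.encard_coe_eq_coe_finsetCard]; exact_mod_cast (by omega : Z'.card ≤ r))
    (fun z hz hzZ => by
      rcases ((hZ' z).1 hzZ).1 with h | ⟨rfl, h⟩
      · exact hPZ z hz h
      · exact h (hfC hz)) hbP hbA hi hi'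
  obtain ⟨p, hp⟩ := (hby.trans (W.joined_of_mem_row (by omega) hi hi' hdisj hy
    (τ.mem_row i hi hi'))).exists_torso_walk Q.mem_b (τ.mem i hi hi')
  have hwalk : ∀ {x y : α} (p : ((G.deleteVerts A).torso B).Walk x y), x ∈ C →
      (∀ z ∈ p.support, z ∉ Z') → y ∈ C := by
    intro x y p
    induction p with
    | nil => exact fun hx _ => hx
    | @cons x w _ h p ih =>
      intro hx hp
      refine ih ?_ fun z hz => hp z (List.mem_cons_of_mem _ hz)
      by_contra hw
      rcases hstep x w hx hw h with hxZ | ⟨-, rfl⟩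
      · exact hp x List.mem_cons_self ((hZ' x).2 ⟨Or.inl hxZ, hB.subset (mem_of_torso_adj h)⟩)
      · exact hp Q.f (List.mem_cons_of_mem _ p.start_mem_support)
          ((hZ' _).2 ⟨Or.inr ⟨rfl, hw⟩, hB.subset (mem_of_torso_adj h.symm)⟩)
  exact (Finset.mem_sdiff.1 hiC).2 (hwalk p hbC fun z hz hzZ => hp z hz hzZ)

end Wall

end Graph

/-! ### Compatible families and the final dichotomy. -/

namespace Graph

variable {α ε Γ : Type*} {G : Graph α ε} {A B : Set α}

lemma card_filter_mem_le {n m : ℕ} {g : Fin n → α} (hg : Function.Injective g) {s : Set α}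
    [DecidablePred fun j => g j ∈ s] (hs : s.encard ≤ m) :
    (Finset.univ.filter fun j => g j ∈ s).card ≤ m := by
  have h1 : (g '' ((Finset.univ.filter fun j => g j ∈ s : Finset (Fin n)) : Set (Fin n))) ⊆ s := by
    rintro x ⟨j, hj, rfl⟩
    simpa using hj
  have h2 := (Set.encard_le_encard h1).trans hs
  rw [hg.encard_image, Set.encard_coe_eq_coe_finsetCard] at h2
  exact_mod_cast h2

/-- Among many pairs of starts there are `m` such that starts from different pairs are compatible. -/
lemma Start.exists_compatible_subset (hB : (G.deleteVerts A).IsThreeBlock B) {n m : ℕ}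
    {q q' : Fin n → G.Start A B} (ha : Function.Injective fun i => (q i).a)
    (hb : Function.Injective fun i => (q i).b) (ha' : Function.Injective fun i => (q' i).a)
    (hb' : Function.Injective fun i => (q' i).b) (hn : 19 * m ≤ n) :
    ∃ I : Finset (Fin n), I.card = m ∧ ∀ i ∈ I, ∀ j ∈ I, i ≠ j →
      (q i).Compatible (q j) ∧ (q i).Compatible (q' j) ∧ (q' i).Compatible (q' j) := by
  classical
  let r : Fin n → Fin n → Prop := fun i j =>
    (q j).b ∈ (q i).att ∨ (q' j).b ∈ (q i).att ∨ (q j).b ∈ (q' i).att ∨ (q' j).b ∈ (q' i).att ∨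
      (q' j).a ∈ ({(q i).a} : Set α)
  -- For fixed i each of the four attachment conditions holds for at most two j and the last for at
  -- most one. So d = 9 and 2d + 1 = 19.
  obtain ⟨I, -, hI, hIr⟩ := Finset.exists_independent_subset r 9 m Finset.univ (by simpa using hn) (by
    intro i _
    have h1 := card_filter_mem_le (m := 2) hb ((q i).encard_att_le hB)
    have h2 := card_filter_mem_le (m := 2) hb' ((q i).encard_att_le hB)
    have h3 := card_filter_mem_le (m := 2) hb ((q' i).encard_att_le hB)
    have h4 := card_filter_mem_le (m := 2) hb' ((q' i).encard_att_le hB)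
    have h5 := card_filter_mem_le (m := 1) ha' (s := {(q i).a}) (by simp)
    simp only [r, Finset.filter_or]
    refine (Finset.card_union_le _ _).trans ?_
    refine (add_le_add_right ((Finset.card_union_le _ _).trans (add_le_add_right
      ((Finset.card_union_le _ _).trans (add_le_add_right (Finset.card_union_le _ _) _)) _)) _).trans ?_
    omega)
  refine ⟨I, hI, fun i hi j hj hij => ?_⟩
  have h1 := hIr i hi j hj hij
  have h2 := hIr j hj i hi hij.symm
  simp only [r, not_or, Set.mem_singleton_iff] at h1 h2
  exact ⟨⟨fun h => hij (ha h), h2.1, h1.1⟩, ⟨fun h => h1.2.2.2.2 h.symm, h2.2.2.1, h1.2.1⟩,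
    ⟨fun h => hij (ha' h), h2.2.2.2.1, h1.2.2.2.1⟩⟩

/-- The starts of type `t`. -/
abbrev StartOfType [AddCommGroup Γ] (G : Graph α ε) (A B : Set α) (γ : ε → Γ) (φ : α → Γ) (t : Γ) :=
  {Q : G.Start A B // Q.type γ φ = t}

variable [Fintype α] [DecidableEq α] [AddCommGroup Γ] {γ : ε → Γ} {φ : α → Γ}

/-- Packable families of starts of opposite types yield disjoint zero `A`-paths. -/
lemma hasDisjointZeroSetPaths_of_packable (hB : (G.deleteVerts A).IsThreeBlock B)
    (h2 : ∀ v, φ v + φ v = 0)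
    (hφ : ∀ u v (p : (G.deleteVerts A).Walk u v), p.IsSetPath B → p.weight γ = φ u + φ v)
    {U : Finset α} {h k : ℕ} (sp : ((G.deleteVerts A).torso B).Spread U h) (hk : 190 * k ≤ h)
    {t : Γ} {J : Finset (G.StartOfType A B γ φ t)} {J' : Finset (G.StartOfType A B γ φ (-t))}
    (hJ : J.card = 95 * k) (hJ' : J'.card = 95 * k)
    (hp : ((G.deleteVerts A).torso B).Packable U (fun Q => Q.1.a) (fun Q => Q.1.b)
      (fun Q => Q.1.f) J)
    (hp' : ((G.deleteVerts A).torso B).Packable U (fun Q => Q.1.a) (fun Q => Q.1.b)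
      (fun Q => Q.1.f) J') : G.HasDisjointZeroSetPaths γ A k := by
  classical
  let e := (Finset.equivFinOfCardEq hJ).symm
  let e' := (Finset.equivFinOfCardEq hJ').symm
  have hinj : Function.Injective fun i => (e i).1 := Subtype.val_injective.comp e.injective
  have hinj' : Function.Injective fun i => (e' i).1 := Subtype.val_injective.comp e'.injective
  -- Starts of the two types are matched by index, and those with equal index may be incompatible.
  -- So the 5k surviving indices are split into 3k for type t and 2k for type -t, as `exists_linked`
  -- requires; 95k = 19 · 5k.
  obtain ⟨I, hI, hcomp⟩ := Start.exists_compatible_subset hB (n := 95 * k) (m := 5 * k)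
    (q := fun i => (e i).1.1) (q' := fun i => (e' i).1.1)
    (fun i j hij => hinj (hp.1 (e i).2 (e j).2 hij))
    (fun i j hij => hinj (hp.injOn sp (by omega) (e i).2 (e j).2 hij))
    (fun i j hij => hinj' (hp'.1 (e' i).2 (e' j).2 hij))
    (fun i j hij => hinj' (hp'.injOn sp (by omega) (e' i).2 (e' j).2 hij)) (by omega)
  obtain ⟨I₁, hI₁, hI₁c⟩ := Finset.exists_subset_card_eq (s := I) (n := 3 * k) (by omega)
  have hI₂c : (I \ I₁).card = 2 * k := by
    rw [Finset.card_sdiff_of_subset hI₁]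
    omega
  obtain ⟨K, hK, K', hK', hl⟩ := SimpleGraph.exists_linked sp
    (J := I₁.image fun i => (e i).1) (J' := (I \ I₁).image fun i => (e' i).1) (k := k)
    (hp.subset sp (by omega) (by
      intro x hx
      obtain ⟨i, -, rfl⟩ := Finset.mem_image.1 hx
      exact (e i).2))
    (hp'.subset sp (by omega) (by
      intro x hx
      obtain ⟨i, -, rfl⟩ := Finset.mem_image.1 hx
      exact (e' i).2))
    (by rw [Finset.card_image_of_injective _ hinj, hI₁c])
    (by rw [Finset.card_image_of_injective _ hinj', hI₂c]) (by omega)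
  let 𝒮₁ : Set (G.Start A B) := {Q | ∃ x ∈ K, x.1 = Q}
  let 𝒮₂ : Set (G.Start A B) := {Q | ∃ x ∈ K', x.1 = Q}
  have h𝒮₁ : ∀ Q ∈ 𝒮₁, ∃ i ∈ I₁, (e i).1.1 = Q := by
    rintro _ ⟨x, hx, rfl⟩
    obtain ⟨i, hi, rfl⟩ := Finset.mem_image.1 (hK hx)
    exact ⟨i, hi, rfl⟩
  have h𝒮₂ : ∀ Q ∈ 𝒮₂, ∃ i ∈ I, i ∉ I₁ ∧ (e' i).1.1 = Q := by
    rintro _ ⟨x, hx, rfl⟩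
    obtain ⟨i, hi, rfl⟩ := Finset.mem_image.1 (hK' hx)
    rw [Finset.mem_sdiff] at hi
    exact ⟨i, hi.1, hi.2, rfl⟩
  have hcross : ∀ Q ∈ 𝒮₁, ∀ Q' ∈ 𝒮₂, Q.Compatible Q' := by
    intro Q hQ Q' hQ'
    obtain ⟨i, hi, rfl⟩ := h𝒮₁ Q hQ
    obtain ⟨j, hj, hj₁, rfl⟩ := h𝒮₂ Q' hQ'
    exact (hcomp i (hI₁ hi) j hj (fun h => hj₁ (h ▸ hi))).2.1
  refine hasDisjointZeroSetPaths_of_linked hB h2 hφ (𝒮 := 𝒮₁ ∪ 𝒮₂) Set.subset_union_left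
    Set.subset_union_right ?_ ?_ ?_ ?_ ?_ hl
  · rintro Q (hQ | hQ) Q' (hQ' | hQ') hne
    · obtain ⟨i, hi, rfl⟩ := h𝒮₁ Q hQ
      obtain ⟨j, hj, rfl⟩ := h𝒮₁ Q' hQ'
      exact (hcomp i (hI₁ hi) j (hI₁ hj) (fun h => hne (by rw [h]))).1
    · exact hcross Q hQ Q' hQ'
    · exact (hcross Q' hQ' Q hQ).symm
    · obtain ⟨i, hi, -, rfl⟩ := h𝒮₂ Q hQ
      obtain ⟨j, hj, -, rfl⟩ := h𝒮₂ Q' hQ'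
      exact (hcomp i hi j hj (fun h => hne (by rw [h]))).2.2
  · intro Q hQ Q' hQ'
    refine ⟨fun h => (hcross Q hQ Q' hQ').1 (by rw [h]), ?_⟩
    obtain ⟨x, -, rfl⟩ := hQ
    obtain ⟨y, -, rfl⟩ := hQ'
    rw [x.2, y.2, add_neg_cancel]
  · intro x y hxy
    rw [SimpleGraph.deleteEdges_adj, Finset.mem_coe, Finset.mem_union] at hxy
    refine ⟨hxy.1, ?_⟩
    rintro Q (⟨x, hx, rfl⟩ | ⟨x, hx, rfl⟩) h
    · exact hxy.2 (Or.inl (SimpleGraph.mem_pairs.2 ⟨x, hx, h⟩))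
    · exact hxy.2 (Or.inr (SimpleGraph.mem_pairs.2 ⟨x, hx, h⟩))
  · intro b hb
    obtain ⟨x, hx, rfl⟩ := Finset.mem_image.1 hb
    exact ⟨x.1, ⟨x, hx, rfl⟩, rfl⟩
  · intro b hb
    obtain ⟨x, hx, rfl⟩ := Finset.mem_image.1 hb
    exact ⟨x.1, ⟨x, hx, rfl⟩, rfl⟩

/-- In the presence of a large wall whose large 3-block is `Γ`-bipartite, there are `k` disjoint
zero `A`-paths or few vertices that meet all zero `A`-paths. -/
theorem Wall.hasDisjointZeroSetPaths_or_hits [Fintype Γ] {r k : ℕ} {W : (G.deleteVerts A).Wall r r}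
    (hT : G.Concentrated γ A W.tangle) (hB : (G.deleteVerts A).IsLargeThreeBlock W.tangle B)
    (hbip : ((G.deleteVerts A).blockGraph γ B).IsGroupBipartite Prod.snd)
    (hr : 1900 * (k + 1) * (Fintype.card Γ + 1) ≤ r) :
    G.HasDisjointZeroSetPaths γ A k ∨
      ∃ Z : Finset α, Z.card ≤ Fintype.card Γ * (475 * k) ∧ G.HitsZeroSetPaths γ A Z := by
  classical
  -- The first bound is 4h ≤ r for h = 475k = 5 · 95k, the second lets the hitting set be used as
  -- `Z` in `not_boundary_subset_of_initialOf`, and the third gives `B` four vertices.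
  have hr1 : 1900 * k ≤ r ∧ 2 * (Fintype.card Γ * (475 * k)) + 2 ≤ r ∧ 3 ≤ r := by
    refine ⟨?_, ?_, ?_⟩ <;> nlinarith [Nat.zero_le (k * Fintype.card Γ), Nat.zero_le k]
  obtain ⟨τ⟩ := W.nonempty_transversal (by omega) hB
  obtain ⟨φ, h2, hφ⟩ := hB.1.exists_potential (γ := γ) (le_trans (by
    exact_mod_cast (by omega : 4 ≤ r + 1)) τ.le_encard) hbip
  have hAB : Disjoint A B := Set.disjoint_left.2 fun x hx hxB => (hB.1.subset hxB).2 hx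
  have sp := τ.spread hT hB.1 (h := 475 * k) (by omega)
  have hdich := fun t => SimpleGraph.exists_packable_or_hitting sp
    (fun Q : G.StartOfType A B γ φ t => Q.1.a) (fun Q => Q.1.b) (fun Q => Q.1.f) (N := 95 * k)
    (by omega)
  by_cases hpack : ∃ t, (∃ J : Finset (G.StartOfType A B γ φ t), J.card = 95 * k ∧
      ((G.deleteVerts A).torso B).Packable τ.verts (fun Q => Q.1.a) (fun Q => Q.1.b)
        (fun Q => Q.1.f) J) ∧
      ∃ J : Finset (G.StartOfType A B γ φ (-t)), J.card = 95 * k ∧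
      ((G.deleteVerts A).torso B).Packable τ.verts (fun Q => Q.1.a) (fun Q => Q.1.b)
        (fun Q => Q.1.f) J
  · obtain ⟨t, ⟨J, hJ, hp⟩, J', hJ', hp'⟩ := hpack
    exact Or.inl (hasDisjointZeroSetPaths_of_packable hB.1 h2 hφ sp (by omega) hJ hJ' hp hp')
  · right
    push Not at hpack
    -- A type found to be packable contributes the empty set.
    have hZ : ∀ t, ∃ Z : Finset α, Z.card ≤ 475 * k ∧
        ((∃ J : Finset (G.StartOfType A B γ φ t), J.card = 95 * k ∧
          ((G.deleteVerts A).torso B).Packable τ.verts (fun Q => Q.1.a) (fun Q => Q.1.b)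
            (fun Q => Q.1.f) J) ∨
          ∀ Q : G.StartOfType A B γ φ t, Q.1.a ∉ Z → ∃ C, SimpleGraph.Small τ.verts C ∧ Q.1.b ∈ C ∧
            (((G.deleteVerts A).torso B).deleteEdges {s(Q.1.b, Q.1.f)}).boundary C ⊆ Z) := by
      intro t
      rcases hdich t with h | ⟨Z, hZ, h⟩
      · exact ⟨∅, by simp, Or.inl h⟩
      · exact ⟨Z, by omega, Or.inr h⟩
    choose Z hZc hZ using hZ
    have hcard : (Finset.univ.biUnion Z).card ≤ Fintype.card Γ * (475 * k) :=
      Finset.card_biUnion_le_card_mul _ _ _ fun t _ => hZc t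
    refine ⟨Finset.univ.biUnion Z, hcard, fun u v P hP => ?_⟩
    by_contra hcon
    push Not at hcon
    have hPZ : ∀ z ∈ P.support, z ∉ Finset.univ.biUnion Z := fun z hz hzZ => hcon z hzZ hz
    obtain ⟨x, hx, hxB⟩ := W.exists_mem_of_isZeroSetPath hT (by omega) hB.1 τ hP
    obtain ⟨Q, Q', hQ, hQ', htt⟩ := exists_two_initialOf h2 hφ hAB hP hx hxB
    -- `P` avoids the union, so its starts are not cut off and their types must be packable. These
    -- types are opposite, which contradicts `hpack`.
    have key : ∀ Q : G.Start A B, Q.InitialOf P →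
        ∃ J : Finset (G.StartOfType A B γ φ (Q.type γ φ)), J.card = 95 * k ∧
          ((G.deleteVerts A).torso B).Packable τ.verts (fun Q => Q.1.a) (fun Q => Q.1.b)
            (fun Q => Q.1.f) J := by
      intro Q hQ
      refine (hZ (Q.type γ φ)).resolve_right fun h => ?_
      have hsub : Z (Q.type γ φ) ⊆ Finset.univ.biUnion Z :=
        Finset.subset_biUnion_of_mem Z (Finset.mem_univ _)
      obtain ⟨C, hC, hbC, hCZ⟩ := h ⟨Q, rfl⟩
        fun h => hPZ _ (hQ.1 _ Q.path.start_mem_support) (hsub h)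
      exact not_boundary_subset_of_initialOf hT hB.1 τ hP hQ (by omega) hPZ hC hbC (hCZ.trans hsub)
    obtain ⟨J, hJ, hp⟩ := key Q hQ
    have hQ't := key Q' hQ'
    rw [← neg_eq_of_add_eq_zero_right htt] at hQ't
    obtain ⟨J', hJ', hp'⟩ := hQ't
    exact hpack _ ⟨J, hJ, hp⟩ J' hJ' hp'

end Graph

/-! ### Comparison with the hitting bound and conclusion. -/

/-- This trivial bound is all that is needed about bipartite Ramsey numbers: a `K_{k,k}` inside
`K_{b,b}` uses k of b vertices. -/
lemma le_bipartiteRamsey (k : ℕ) : k ≤ bipartiteRamsey k := by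
  obtain ⟨col, S, T, hS, -, -⟩ := Nat.sInf_mem (exists_bipartiteRamseyProp k) fun _ _ => true
  have := Finset.card_le_univ S
  rw [Fintype.card_fin, hS] at this
  exact this

lemma lt_hittingParameter {k : ℕ} (hk : 0 < k) : 475 * k < 12 * hittingParameter k := by
  have h := le_bipartiteRamsey k
  unfold hittingParameter
  nlinarith [Nat.mul_le_mul h h]

theorem mainTheorem6 :
    ∃ β : ℕ → ℕ → ℕ, (∀ k n, 2 ≤ β k n) ∧
      ∀ (Γ : Type*) [AddCommGroup Γ] [Finite Γ] (k : ℕ), 0 < k →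
      ∀ (α ε : Type*) [Finite α] [Finite ε] (G : Graph α ε) (γ : ε → Γ) (A : Set α), A ⊆ V(G) →
        -- no fewer than `12 T(k) |Γ|` vertices intersect every zero `A`-path
        (¬ ∃ Y ⊆ V(G), Y.encard < ((12 * hittingParameter k * Nat.card Γ : ℕ) : ℕ∞) ∧
          G.HitsZeroSetPaths γ A Y) →
        -- `G - A` contains a wall such that the large 3-block for its tangle is `Γ`-bipartite
        ∀ (W : (G.deleteVerts A).Wall (β k (Nat.card Γ)) (β k (Nat.card Γ))) (B : Set α),
        (G.deleteVerts A).IsLargeThreeBlock W.tangle B →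
        ((G.deleteVerts A).blockGraph γ B).IsGroupBipartite Prod.snd →
        -- the position of the zero `A`-paths relative to the tangle
        (∀ C D, (C, D) ∈ W.tangle →
          ¬ (G.induce (A ∪ V(C))).HasZeroSetPath γ A ∧
          (G.induce (A ∪ (V(D) \ V(C)))).HasZeroSetPath γ A) →
        G.HasDisjointZeroSetPaths γ A k := by
  classical
  refine ⟨fun k n => 1900 * (k + 1) * (n + 1), fun k n => ?_, ?_⟩
  · nlinarith [Nat.zero_le (k * n), Nat.zero_le k, Nat.zero_le n]
  intro Γ _ _ k hk α ε _ _ G γ A _ hhit W B hB hbip hT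
  have := Fintype.ofFinite α
  have := Fintype.ofFinite Γ
  refine (Graph.Wall.hasDisjointZeroSetPaths_or_hits (W := W) hT hB hbip
    (by rw [Nat.card_eq_fintype_card])).resolve_right ?_
  rintro ⟨Z, hZ, hits⟩
  -- The hitting set is a set of elements of the ambient type, so it is first cut down to the
  -- vertices of `G`.
  refine hhit ⟨Z ∩ V(G), Set.inter_subset_right, ?_, fun u v P hP => ?_⟩
  · refine (Set.encard_le_encard Set.inter_subset_left).trans_lt ?_
    rw [Set.encard_coe_eq_coe_finsetCard, Nat.card_eq_fintype_card]
    have h1 : Fintype.card Γ * (475 * k) < 12 * hittingParameter k * Fintype.card Γ := by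
      rw [mul_comm]
      exact Nat.mul_lt_mul_of_pos_right (lt_hittingParameter hk) Fintype.card_pos
    exact_mod_cast hZ.trans_lt h1
  · obtain ⟨z, hz, hzP⟩ := hits u v P hP
    exact ⟨z, ⟨hz, P.mem_vertexSet hzP⟩, hzP⟩
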